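/- Let $q$ be a power of an odd prime, let $k$ be an algebraic closure of $\mathbb{F}_q$, let $n\ge 0$ and $m=\lfloor n/2\rfloor$, and let $G=\mathrm{GL}_n(k)$ with the Frobenius endomorphism $F$ raising matrix entries to the power $q$. Let $J_n$ be the matrix with ones on the antidiagonal and zeros elsewhere, let $t_0=\mathrm{diag}(1,\dots,1,-1,\dots,-1)$ with $\lfloor (n+1)/2\rfloor$ entries $1$, and put $\mathscr{J}=t_0J_n$ if $n$ is even and $\mathscr{J}=J_n$ if $n$ is odd. Let $\bar G=G\rtimes\mathbb{Z}/2\mathbb{Z}$ be defined either by the involution $g\mapsto\mathscr{J}\,{}^tg^{-1}\mathscr{J}^{-1}$, in which case $\sigma$ denotes $(1,1)$, or by the involution $g\mapsto J_n\,{}^tg^{-1}J_n^{-1}$, in which case $\sigma$ denotes $(t_0,1)$ if $n$ is even and $(1,1)$ if $n$ is odd; in both cases $\sigma$ acts on $G$ by $g\mapsto\mathscr{J}\,{}^tg^{-1}\mathscr{J}^{-1}$, and $F$ is extended to $\bar G$ by acting trivially on $\mathbb{Z}/2\mathbb{Z}$, so that $F(\sigma)=\sigma$. An element of $\bar G$ is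 quasi-semi-simple if conjugation by it stabilises some maximal torus of $G$ and some Borel subgroup of $G$ containing that torus. For $a_1,\dots,a_m\in k^*$ write $[a_1,\dots,a_m]=\mathrm{diag}(a_1,\dots,a_m,a_m^{-1},\dots,a_1^{-1})$ if $n=2m$, and $\mathrm{diag}(a_1,\dots,a_m,1,a_m^{-1},\dots,a_1^{-1})$ if $n=2m+1$. Let $\hat k$ be the quotient of $k^*$ by $a\mapsto a^{-1}$ and $a\mapsto -a$, let $\hat a\in\hat k$ be the class of $a\in k^*$, and fix $\mathfrak{i}\in k$ with $\mathfrak{i}^2=-1$. Let $\Phi_*$ be the set of orbits in $\hat k$ of $F:\hat a\mapsto\widehat{a^q}$, and write $|x|$ for the number of elements of $x\in\Phi_*$; the classes $\hat 1$ and $\hat{\mathfrak{i}}$ are fixed by $F$, and are regarded also as elements of $\Phi_*$. For a finitely supported map $f:\Phi_*\to\mathbb{Z}_{\ge0}$ put $$\|f\|=f(\hat 1)+f(\hat{\mathfrak{i}})+\sum_{x\in\Phi_*\setminus\{\hat 1,\hat{\mathfrak{i}}\}}2f(x)|x| .$$ Let $\bar{\mathfrak{T}}_{C,s}$ be the set of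 all $f$ with $\|f\|=n$ and $f(\hat 1)\equiv n\pmod 2$ (so that $f(\hat{\mathfrak{i}})$ is even). (1) The $F$-stable quasi-semi-simple $G$-conjugacy classes in $G\sigma$ are in bijection with $\bar{\mathfrak{T}}_{C,s}$. There is a bijection $\psi$ from $\bar{\mathfrak{T}}_{C,s}$ onto the set of these classes such that for every $f$ the class $\psi(f)$ contains an element of the form $[a_1,\dots,a_m]\sigma$, and such that $[a_1,\dots,a_m]\sigma\in\psi(f)$ if and only if in the multiset $\{\hat a_1,\dots,\hat a_m\}$ the element $\hat 1$ has multiplicity $\lfloor f(\hat 1)/2\rfloor$, the element $\hat{\mathfrak{i}}$ has multiplicity $f(\hat{\mathfrak{i}})/2$, and every other $y\in\hat k$ has multiplicity $f(x)$, where $x\in\Phi_*$ is the orbit of $y$. (2) The $G^F$-conjugacy classes of quasi-semi-simple elements in $G^F\sigma$ are in bijection with the pairs $(\eta,f)\in\{\pm1\}\times\bar{\mathfrak{T}}_{C,s}$ for which $\eta$ can be $-1$ only if $n$ is even and $f(\hat{\mathfrak{i}})>0$, or $n$ is odd and $f(\hat 1)>0$ (that is, only if the orthogonal factor of the centraliser,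 which has size $f(\hat{\mathfrak{i}})$ for even $n$ and $f(\hat 1)$ for odd $n$, is non-trivial). The bijection can be chosen so that a $G^F$-class corresponding to $(\eta,f)$ is contained in $\psi(f)$ and, whenever $\eta=-1$ is allowed for $f$, the sign $\eta$ of the $G^F$-class of $g\sigma$ (with $g\in G^F$) is $+1$ exactly when $\det g$ is a square in $\mathbb{F}_q^*$. -/

import Mathlib

open scoped Matrix MatrixGroups

namespace TwistedGL

noncomputable section

/-! ### The group `GL_n(k)` with its Zariski topology, tori and Borel subgroups -/

section Algebraic

variable (n : ℕ) (k : Type*) [Field k]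

/-- The Zariski topology on `GL_n(k)`: the non-vanishing loci of the polynomials in the matrix
entries form a basis of open sets. -/
@[reducible] def zariski : TopologicalSpace (GL (Fin n) k) :=
  TopologicalSpace.generateFrom
    {U | ∃ P : MvPolynomial (Fin n × Fin n) k,
      U = {g : GL (Fin n) k | MvPolynomial.eval (fun ij => (g : Matrix (Fin n) (Fin n) k) ij.1 ij.2) P ≠ 0}}

variable {n k}

/-- A subgroup of `GL_n(k)` that is closed and connected in the Zariski topology. -/
def IsClosedConnected (H : Subgroup (GL (Fin n) k)) : Prop :=
  @IsClosed _ (zariski n k) (H : Set (GL (Fin n) k)) ∧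
    @IsConnected _ (zariski n k) (H : Set (GL (Fin n) k))

/-- A Borel subgroup: maximal among the closed connected solvable subgroups. -/
def IsBorel (B : Subgroup (GL (Fin n) k)) : Prop :=
  Maximal (fun H : Subgroup (GL (Fin n) k) => IsClosedConnected H ∧ Group.IsSolvable H) B

/-- A torus: a closed connected subgroup that is diagonalisable, i.e. is conjugate to a group of
diagonal matrices. -/
def IsTorus (T : Subgroup (GL (Fin n) k)) : Prop :=
  IsClosedConnected T ∧
    ∃ g : GL (Fin n) k, ∀ t ∈ T, ((g * t * g⁻¹ : GL (Fin n) k) : Matrix (Fin n) (Fin n) k).IsDiag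

/-- A maximal torus. -/
def IsMaximalTorus (T : Subgroup (GL (Fin n) k)) : Prop :=
  Maximal IsTorus T

end Algebraic

/-! ### The automorphisms and the group `GL_n(k) ⋊ ℤ/2` -/

section Group

variable (n : ℕ) (k : Type*) [Field k]

/-- The diagonal matrix with prescribed (invertible) entries. -/
def diagGL {n : ℕ} {k : Type*} [Field k] (d : Fin n → kˣ) : GL (Fin n) k where
  val := Matrix.diagonal fun i => (d i : k)
  inv := Matrix.diagonal fun i => ((d i)⁻¹ : kˣ).val
  val_inv := by simp
  inv_val := by simp

/-- The matrix with ones on the antidiagonal and zeros elsewhere. -/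
def antiDiag : GL (Fin n) k where
  val := Matrix.of fun i j => if i = Fin.rev j then 1 else 0
  inv := Matrix.of fun i j => if i = Fin.rev j then 1 else 0
  val_inv := by ext i j; simp [Matrix.mul_apply, Matrix.one_apply]
  inv_val := by ext i j; simp [Matrix.mul_apply, Matrix.one_apply]

/-- `diag(1, …, 1, -1, …, -1)`, with `⌊(n+1)/2⌋` entries equal to `1`. -/
def tZero : GL (Fin n) k :=
  diagGL fun i => if i.val < (n + 1) / 2 then 1 else -1

/-- The element `t₀` if `n` is even, and `1` if `n` is odd. -/
def signElt : GL (Fin n) k := if Even n then tZero n k else 1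

/-- The two kinds of extension by an exterior involution: the one defined by the standard
automorphism `σ`, and the one defined by `g ↦ J ᵗg⁻¹ J⁻¹` with `J` the antidiagonal matrix of ones
(these coincide if `n` is odd). -/
inductive Kind
  | standard
  | orthogonal

/-- The matrix `J` defining the exterior involution `g ↦ J ᵗg⁻¹ J⁻¹`. -/
def gram : Kind → GL (Fin n) k
  | .standard => signElt n k * antiDiag n k
  | .orthogonal => antiDiag n k

variable {n k}

/-- The transpose inverse, as an automorphism of `GL_n(k)`. -/
def transInv : MulAut (GL (Fin n) k) where
  toFun g := ⟨((g⁻¹ : GL (Fin n) k) : Matrix (Fin n) (Fin n) k)ᵀ, (g : Matrix (Fin n) (Fin n) k)ᵀ,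
    by rw [← Matrix.transpose_mul, Units.mul_inv, Matrix.transpose_one],
    by rw [← Matrix.transpose_mul, Units.inv_mul, Matrix.transpose_one]⟩
  invFun g := ⟨((g⁻¹ : GL (Fin n) k) : Matrix (Fin n) (Fin n) k)ᵀ, (g : Matrix (Fin n) (Fin n) k)ᵀ,
    by rw [← Matrix.transpose_mul, Units.mul_inv, Matrix.transpose_one],
    by rw [← Matrix.transpose_mul, Units.inv_mul, Matrix.transpose_one]⟩
  left_inv g := by ext i j; rfl
  right_inv g := by ext i j; rfl
  map_mul' g h := by
    apply Units.ext
    change ((g * h)⁻¹ : GL (Fin n) k).valᵀ = (g⁻¹).valᵀ * (h⁻¹).valᵀ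
    rw [mul_inv_rev, Units.val_mul, Matrix.transpose_mul]

variable (n k)

/-- The exterior involution `g ↦ J ᵗg⁻¹ J⁻¹`. -/
def extAut (κ : Kind) : MulAut (GL (Fin n) k) :=
  MulAut.conj (gram n k κ) * transInv

theorem gram_transpose (κ : Kind) :
    (gram n k κ : Matrix (Fin n) (Fin n) k)ᵀ = gram n k κ ∨
      (gram n k κ : Matrix (Fin n) (Fin n) k)ᵀ = -(gram n k κ : Matrix (Fin n) (Fin n) k) := by
  have hanti : (antiDiag n k : Matrix (Fin n) (Fin n) k)ᵀ = antiDiag n k := by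
    ext i j
    simp only [antiDiag, Matrix.transpose_apply, Matrix.of_apply]
    congr 1
    exact propext ⟨fun h => by rw [h, Fin.rev_rev], fun h => by rw [h, Fin.rev_rev]⟩
  cases κ with
  | orthogonal => exact Or.inl hanti
  | standard =>
    by_cases hn : Even n
    · right
      ext i j
      simp only [gram, signElt, hn, if_true, tZero, diagGL, antiDiag, Matrix.transpose_apply,
        Units.val_mul, Matrix.diagonal_mul, Matrix.of_apply, Matrix.neg_apply]
      obtain ⟨m, rfl⟩ := hn
      by_cases h : j = Fin.rev i
      · subst h
        have h1 := i.isLt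
        have h2 : (Fin.rev i).val = m + m - (i.val + 1) := Fin.val_rev i
        simp only [Fin.rev_rev, if_true, mul_one, h2]
        by_cases h3 : i.val < (m + m + 1) / 2
        · have h4 : ¬ (m + m - (i.val + 1) < (m + m + 1) / 2) := by omega
          simp [h3, h4]
        · have h4 : m + m - (i.val + 1) < (m + m + 1) / 2 := by omega
          simp [h3, h4]
      · have h' : ¬ i = Fin.rev j := fun e => h (by rw [e, Fin.rev_rev])
        simp [h, h']
    · left
      simpa [gram, signElt, hn] using hanti

theorem extAut_mul_self (κ : Kind) : extAut n k κ * extAut n k κ = 1 := by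
  have key : ∀ J : GL (Fin n) k, ((J : Matrix (Fin n) (Fin n) k)ᵀ = J ∨
      (J : Matrix (Fin n) (Fin n) k)ᵀ = -(J : Matrix (Fin n) (Fin n) k)) →
      (transInv J = J⁻¹ ∨ transInv J = -J⁻¹) := by
    intro J hJ
    have h : (transInv J)⁻¹ = J ∨ (transInv J)⁻¹ = -J :=
      hJ.imp (fun h => Units.ext h) (fun h => Units.ext h)
    rcases h with h | h
    · left; rw [← h, inv_inv, h]
    · right
      rw [← inv_inv (transInv J), h]
      rw [inv_eq_iff_mul_eq_one]; simp
  have hT : ∀ g : GL (Fin n) k, transInv (transInv g) = g := fun g => transInv.left_inv g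
  ext1 g
  change gram n k κ * transInv (gram n k κ * transInv g * (gram n k κ)⁻¹) * (gram n k κ)⁻¹ = g
  rw [map_mul, map_mul, map_inv, hT]
  rcases key _ (gram_transpose n k κ) with h | h <;> rw [h]
  · group
  · have : (-(gram n k κ)⁻¹)⁻¹ = -gram n k κ := by rw [inv_eq_iff_mul_eq_one]; simp
    rw [this]
    simp [mul_assoc]

/-- The action of `ℤ/2` defined by an involution. -/
def involHom {G : Type*} [Group G] (τ : MulAut G) (h : τ * τ = 1) :
    Multiplicative (ZMod 2) →* MulAut G where
  toFun x := if x.toAdd = 0 then 1 else τ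
  map_one' := by simp
  map_mul' x y := by
    rw [toAdd_mul]
    generalize x.toAdd = a
    generalize y.toAdd = b
    have h2 : ∀ c : ZMod 2, c = 0 ∨ c = 1 := by decide
    have e : (1 : ZMod 2) + 1 = 0 := by decide
    rcases h2 a with rfl | rfl <;> rcases h2 b with rfl | rfl <;> simp [e, h]

/-- The group `GL_n(k) ⋊ ℤ/2`. -/
abbrev Bar (κ : Kind) : Type _ :=
  GL (Fin n) k ⋊[involHom (extAut n k κ) (extAut_mul_self n k κ)] Multiplicative (ZMod 2)

variable {n k}

/-- The inclusion of `GL_n(k)` in `GL_n(k) ⋊ ℤ/2`. -/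
abbrev incl {κ : Kind} : GL (Fin n) k →* Bar n k κ := SemidirectProduct.inl

/-- The element `σ`: it induces the standard automorphism of `GL_n(k)` by conjugation, whatever
the extension. It is `(1, 1)` in the standard extension; in the extension of orthogonal type with
`n` even, it is `t₀ σ'`, where `σ' = (1, 1)`. -/
def sig : (κ : Kind) → Bar n k κ
  | .standard => SemidirectProduct.inr (Multiplicative.ofAdd 1)
  | .orthogonal => incl (signElt n k) * SemidirectProduct.inr (Multiplicative.ofAdd 1)

/-- An element is quasi-semi-simple if conjugation by it leaves stable a maximal torus and a Borel
subgroup of `GL_n(k)` containing it. -/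
def IsQuasiSemisimple {κ : Kind} (x : Bar n k κ) : Prop :=
  ∃ T B : Subgroup (GL (Fin n) k), IsMaximalTorus T ∧ IsBorel B ∧ T ≤ B ∧
    (T.map incl).map (MulAut.conj x).toMonoidHom = T.map incl ∧
    (B.map incl).map (MulAut.conj x).toMonoidHom = B.map incl

end Group

/-! ### Frobenius and conjugacy classes -/

section Frobenius

variable (K : Type*) [Field K] [Fintype K] (k : Type*) [Field k] [Algebra K k] (n : ℕ)

/-- The Frobenius endomorphism of `GL_n(k)`, raising the entries to the power `|K|`. -/
def frobGL : GL (Fin n) k →* GL (Fin n) k :=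
  Matrix.GeneralLinearGroup.map (FiniteField.frobeniusAlgHom K k : k →+* k)

theorem frobGL_gram (κ : Kind) : frobGL K k n (gram n k κ) = gram n k κ := by
  have ha : frobGL K k n (antiDiag n k) = antiDiag n k := by
    ext i j
    change (FiniteField.frobeniusAlgHom K k) (if i = Fin.rev j then 1 else 0) =
      if i = Fin.rev j then 1 else 0
    split_ifs <;> simp only [map_one, map_zero]
  have hs : frobGL K k n (signElt n k) = signElt n k := by
    unfold signElt
    split_ifs
    · ext i j
      change (FiniteField.frobeniusAlgHom K k) (Matrix.diagonal (fun i : Fin n =>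
        ((if i.val < (n + 1) / 2 then 1 else -1 : kˣ) : k)) i j) = Matrix.diagonal (fun i : Fin n =>
        ((if i.val < (n + 1) / 2 then 1 else -1 : kˣ) : k)) i j
      rw [Matrix.diagonal_apply]
      split_ifs <;> simp only [map_one, map_zero, Units.val_one, Units.val_neg, map_neg]
    · rw [map_one]
  cases κ with
  | standard => rw [gram, map_mul, ha, hs]
  | orthogonal => exact ha

theorem frobGL_extAut (κ : Kind) (g : GL (Fin n) k) :
    frobGL K k n (extAut n k κ g) = extAut n k κ (frobGL K k n g) := by
  have hT : frobGL K k n (transInv g) = transInv (frobGL K k n g) := by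
    apply Units.ext
    change _ = ((frobGL K k n g)⁻¹).valᵀ
    rw [← map_inv]
    rfl
  change frobGL K k n (gram n k κ * transInv g * (gram n k κ)⁻¹) =
    gram n k κ * transInv (frobGL K k n g) * (gram n k κ)⁻¹
  rw [map_mul, map_mul, map_inv, frobGL_gram, hT]

/-- The Frobenius endomorphism of `GL_n(k) ⋊ ℤ/2`, trivial on the second factor; it fixes `σ`. -/
def frobBar (κ : Kind) : Bar n k κ →* Bar n k κ :=
  SemidirectProduct.map (frobGL K k n) (MonoidHom.id _) (by
    intro x
    ext1 g
    change frobGL K k n ((if x.toAdd = 0 then (1 : MulAut _) else extAut n k κ) g) =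
      (if x.toAdd = 0 then (1 : MulAut _) else extAut n k κ) (frobGL K k n g)
    split_ifs
    · rfl
    · exact frobGL_extAut K k n κ g)

/-- The `F`-stable quasi-semi-simple `GL_n(k)`-conjugacy classes in `GL_n(k)σ`, as subsets of
`GL_n(k) ⋊ ℤ/2`. -/
def FStableClasses (κ : Kind) : Set (Set (Bar n k κ)) :=
  {C | (∃ g : GL (Fin n) k, IsQuasiSemisimple (incl g * sig κ) ∧
      C = Set.range fun h : GL (Fin n) k => incl h * (incl g * sig κ) * (incl h)⁻¹) ∧
    frobBar K k n κ '' C = C}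

/-- The conjugacy classes under `GL_n(k)^F` of the quasi-semi-simple elements of `GL_n(k)^F σ`,
as subsets of `GL_n(k) ⋊ ℤ/2`. -/
def RationalClasses (κ : Kind) : Set (Set (Bar n k κ)) :=
  {D | ∃ g : GL (Fin n) k, frobGL K k n g = g ∧ IsQuasiSemisimple (incl g * sig κ) ∧
    D = {x | ∃ h : GL (Fin n) k, frobGL K k n h = h ∧
      x = incl h * (incl g * sig κ) * (incl h)⁻¹}}

end Frobenius

/-! ### The combinatorial data -/

section Combinatorics

/-- The relation `b ∈ {a, -a, a⁻¹, -a⁻¹}` on `k*`. -/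
def hatSetoid (k : Type*) [Field k] : Setoid kˣ where
  r a b := b = a ∨ b = -a ∨ b = a⁻¹ ∨ b = -a⁻¹
  iseqv := by
    refine ⟨fun a => Or.inl rfl, ?_, ?_⟩
    · rintro a b (rfl | rfl | rfl | rfl) <;> simp
    · rintro a b c (rfl | rfl | rfl | rfl) (rfl | rfl | rfl | rfl) <;> simp

/-- The quotient of `k*` by `a ↦ a⁻¹` and `a ↦ -a`. -/
abbrev KHat (k : Type*) [Field k] : Type _ := Quotient (hatSetoid k)

/-- The class of `a` in the quotient. -/
def hat {k : Type*} [Field k] (a : kˣ) : KHat k := Quotient.mk (hatSetoid k) a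

theorem exists_sq_eq_neg_one (k : Type*) [Field k] [IsAlgClosed k] : ∃ a : kˣ, a ^ 2 = -1 := by
  obtain ⟨z, hz⟩ := IsAlgClosed.exists_pow_nat_eq (-1 : k) (n := 2) (by norm_num)
  have h0 : z ≠ 0 := by
    rintro rfl
    simp at hz
  exact ⟨Units.mk0 z h0, Units.ext (by simpa using hz)⟩

/-- A square root of `-1` in `k`. -/
def imag (k : Type*) [Field k] [IsAlgClosed k] : kˣ := (exists_sq_eq_neg_one k).choose

variable (K : Type*) [Field K] [Fintype K] (k : Type*) [Field k] [Algebra K k]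
  [Algebra.IsAlgebraic K k]

/-- The action of the Frobenius, `â ↦ (a ^ |K|)^`, on the quotient of `k*`. -/
def frobHat : Equiv.Perm (KHat k) :=
  Quotient.congr
    (Units.mapEquiv (FiniteField.frobeniusAlgEquivOfAlgebraic K k).toMulEquiv).toEquiv (by
      intro a b
      have hneg : ∀ a : kˣ, Units.mapEquiv
          (FiniteField.frobeniusAlgEquivOfAlgebraic K k).toMulEquiv (-a) =
          -Units.mapEquiv (FiniteField.frobeniusAlgEquivOfAlgebraic K k).toMulEquiv a :=
        fun a => Units.ext (map_neg (FiniteField.frobeniusAlgEquivOfAlgebraic K k) (a : k))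
      change (b = a ∨ b = -a ∨ b = a⁻¹ ∨ b = -a⁻¹) ↔ (_ = _ ∨ _ = _ ∨ _ = _ ∨ _ = _)
      simp only [MulEquiv.toEquiv_eq_coe, EquivLike.coe_coe, ← hneg, ← map_inv,
        EmbeddingLike.apply_eq_iff_eq])

/-- The set `Φ_*` of the orbits of the Frobenius in the quotient of `k*`. -/
abbrev PhiStar : Type _ := Quotient (Equiv.Perm.SameCycle.setoid (frobHat K k))

variable {k}

/-- The orbit of an element of the quotient. -/
def orb (y : KHat k) : PhiStar K k := Quotient.mk (Equiv.Perm.SameCycle.setoid (frobHat K k)) y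

variable {K}

/-- The number of elements of an orbit. -/
def orbSize (x : PhiStar K k) : ℕ := {y : KHat k | orb K y = x}.ncard

variable (K k) [IsAlgClosed k]

/-- The orbit `{1̂}`. -/
def orbOne : PhiStar K k := orb K (hat 1)

/-- The orbit `{î}`, where `i² = -1`. -/
def orbI : PhiStar K k := orb K (hat (imag k))

variable {K k}

open Classical in
/-- `‖f‖ = f(1̂) + f(î) + ∑ 2 f(x) |x|`, the sum being over the other orbits `x`. -/
def phiNorm (f : PhiStar K k →₀ ℕ) : ℕ :=
  f (orbOne K k) + f (orbI K k) +
    ∑ x ∈ (f.support.erase (orbOne K k)).erase (orbI K k), 2 * f x * orbSize x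

variable (K k) in
/-- The combinatorial data: `f : Φ_* → ℕ` with `‖f‖ = n` and `f(1̂) ≡ n` modulo `2`. -/
abbrev TBar (n : ℕ) : Type _ :=
  {f : PhiStar K k →₀ ℕ // f (orbOne K k) % 2 = n % 2 ∧ phiNorm f = n}

open Classical in
/-- The multiplicity of `y` as an "eigenvalue" of the class attached to `f`. -/
def eigMult (f : PhiStar K k →₀ ℕ) (y : KHat k) : ℕ :=
  if y = hat 1 ∨ y = hat (imag k) then f (orb K y) / 2 else f (orb K y)

/-- The orthogonal factor of the centraliser is non-trivial: its size is `n_- = f(î)` if `n` is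
even, and `n_+ = f(1̂)` if `n` is odd. -/
def OrthNontrivial {n : ℕ} (t : TBar K k n) : Prop :=
  (Even n ∧ 0 < t.1 (orbI K k)) ∨ (Odd n ∧ 0 < t.1 (orbOne K k))

variable (K k) in
/-- The pairs `(η, t)`, where the sign `η` can be `-1` only if the orthogonal factor of the
centraliser is non-trivial. -/
abbrev SignedTBar (n : ℕ) : Type _ :=
  {p : ℤˣ × TBar K k n // p.1 = -1 → OrthNontrivial p.2}

end Combinatorics

/-- The matrix `[a₁, …, a_m] = diag(a₁, …, a_m, (1), a_m⁻¹, …, a₁⁻¹)`, where `m = ⌊n/2⌋` and the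
middle entry is present only if `n` is odd. -/
def symDiag {k : Type*} [Field k] {n : ℕ} (a : Fin (n / 2) → kˣ) : GL (Fin n) k :=
  diagGL fun i =>
    if h : i.val < n / 2 then a ⟨i.val, h⟩
    else if h' : (Fin.rev i).val < n / 2 then (a ⟨(Fin.rev i).val, h'⟩)⁻¹
    else 1

end

end TwistedGL

open TwistedGL

/-! Attach to gσ the non-degenerate bilinear form with matrix A = g𝒥. Conjugating gσ by h replaces A
by hAᵗh, so the classes in Gσ are congruence classes of forms, over k for G and over 𝔽_q for G^F.
The main invariant is the asymmetry S = A⁻¹ᵗA, an isometry of A whose conjugacy class depends only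
on the congruence class of A.

By the Lie–Kolchin theorem, a maximal torus inside a Borel subgroup can be moved to the diagonal
matrices inside the upper triangular ones. This standard pair is σ-stable, and an element of G
normalising both of its members is diagonal. So the quasi-semi-simple elements of Gσ are the
conjugates of the diag(d)σ (`isQuasiSemisimple_iff_exists_diagGL`), and their asymmetries are
diagonalisable.

If A and B = Ay have the same asymmetry S, then y is self-adjoint for A and commutes with S. Put δ =
S - S⁻¹, which is skew-adjoint. If y = a² - δ²b² with a, b in the commutative algebra generated by y
and δ², then a + bδ, whose adjoint is a - δb, carries A to B (`congr_of_asymmetry_eq`). Over k this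
is solved with b = 0, so the conjugacy class of S determines the form. For [a₁, …, a_m]σ the
eigenvalues of S are εa_j² and their inverses, with ε = -1 for n even and ε = 1 for n odd, and one
more eigenvalue 1 for n odd. Hence the class is the multiset of the â_j, and it is F-stable exactly
when the multiplicities are constant on the orbits of F; this is the datum f.

Over 𝔽_q, Lang's theorem puts a rational element in every F-stable class. Two rational forms
congruent over k have asymmetries conjugate over k, hence over 𝔽_q by semisimplicity, so these may
be assumed equal. Then the space splits into the eigenspaces of S for 1 and -1 and a remainder. On
the remainder δ is invertible and the norm equation is solvable, because the residue fields are
finite. The part for -1 is alternating, hence unique. The part for 1 is symmetric and classified by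
its discriminant modulo squares (`congr_of_asymmetry_pow_eq`). So there are two rational classes,
separated by det g modulo squares, if 1 is an eigenvalue of S, and one otherwise. The eigenvalue 1
occurs always for n odd, and for n even when some â_j is î; this is the condition on the orthogonal
factor. -/

namespace TwistedGL

/-! ### Twisted conjugacy as congruence of bilinear forms -/

section Conjugation

variable {n : ℕ} {k : Type*} [Field k]

/-- The automorphism of `GL_n(k)` induced by `σ`. -/
abbrev theta : MulAut (GL (Fin n) k) := extAut n k .standard

/-- In the orthogonal extension σ carries the factor `signElt`, and conjugation by it turns the
involution of the antidiagonal matrix into `theta`. Nothing after this depends on the kind of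
extension. -/
theorem sig_mul_incl (κ : Kind) (g : GL (Fin n) k) :
    sig κ * incl g = incl (theta g) * sig κ := by
  have key : ∀ κ : Kind, (SemidirectProduct.inr (Multiplicative.ofAdd 1) : Bar n k κ) * incl g =
      incl (extAut n k κ g) * SemidirectProduct.inr (Multiplicative.ofAdd 1) := by
    intro κ
    have h := SemidirectProduct.inl_aut (φ := involHom (extAut n k κ) (extAut_mul_self n k κ))
      (Multiplicative.ofAdd 1) g
    have h1 : involHom (extAut n k κ) (extAut_mul_self n k κ) (Multiplicative.ofAdd 1) =
        extAut n k κ := by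
      simp [involHom]
    rw [h1] at h
    rw [incl, h]
    simp
  cases κ with
  | standard => exact key .standard
  | orthogonal =>
    rw [sig, mul_assoc, key, ← mul_assoc, ← mul_assoc, ← map_mul, ← map_mul]
    have h : signElt n k * extAut n k .orthogonal g = theta g * signElt n k := by
      change _ * (antiDiag n k * _ * (antiDiag n k)⁻¹) =
        (signElt n k * antiDiag n k) * _ * (signElt n k * antiDiag n k)⁻¹ * _
      group
    rw [h]

theorem conj_incl_mul_sig (κ : Kind) (h g : GL (Fin n) k) :
    incl h * (incl g * sig κ) * (incl h)⁻¹ = incl (h * g * (theta h)⁻¹) * sig κ := by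
  rw [← map_inv, mul_assoc, mul_assoc, sig_mul_incl, ← mul_assoc, ← mul_assoc, ← map_mul,
    ← map_mul, map_inv]

theorem incl_mul_sig_conj (κ : Kind) (g b : GL (Fin n) k) :
    incl g * sig κ * incl b * (incl g * sig κ)⁻¹ = incl (g * theta b * g⁻¹) := by
  rw [mul_assoc (incl g), sig_mul_incl, map_mul, map_mul, map_inv]
  group

theorem incl_mul_sig_inj (κ : Kind) {g g' : GL (Fin n) k} :
    (incl g * sig κ : Bar n k κ) = incl g' * sig κ ↔ g = g' :=
  ⟨fun h => SemidirectProduct.inl_injective (mul_right_cancel h), fun h => by rw [h]⟩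

theorem frobBar_incl_mul_sig (K : Type*) [Field K] [Fintype K] [Algebra K k] (κ : Kind)
    (g : GL (Fin n) k) :
    frobBar K k n κ (incl g * sig κ) = incl (frobGL K k n g) * sig κ := by
  have h1 : ∀ g : GL (Fin n) k, frobBar K k n κ (incl g) = incl (frobGL K k n g) :=
    fun g => SemidirectProduct.map_inl _ _ _ _
  have h2 : frobBar K k n κ (SemidirectProduct.inr (Multiplicative.ofAdd 1)) =
      SemidirectProduct.inr (Multiplicative.ofAdd 1) := SemidirectProduct.map_inr _ _ _ _
  rw [map_mul, h1]
  congr 1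
  cases κ with
  | standard => exact h2
  | orthogonal =>
    rw [sig, map_mul, h1, h2]
    congr 2
    have ha := frobGL_gram K k n .orthogonal
    have hb := frobGL_gram K k n .standard
    rw [gram] at ha
    rw [gram, map_mul, ha] at hb
    exact mul_right_cancel hb

/-- The matrix `g𝒥` of the bilinear form attached to `gσ`. -/
def form (g : GL (Fin n) k) : Matrix (Fin n) (Fin n) k :=
  ((g * gram n k .standard : GL (Fin n) k) : Matrix (Fin n) (Fin n) k)

theorem form_injective : Function.Injective (form : GL (Fin n) k → _) := fun _ _ h =>
  mul_right_cancel (Units.ext h)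

/-- The factor 𝒥 absorbs the twist: 𝒥 conjugates `transInv h` into `theta h`, and the inverse of
`transInv h` is the transpose of h. -/
theorem form_mul_theta_inv (h g : GL (Fin n) k) :
    form (h * g * (theta h)⁻¹) = (h : Matrix (Fin n) (Fin n) k) * form g * (h : Matrix _ _ k)ᵀ := by
  have h1 : h * g * (theta h)⁻¹ * gram n k .standard =
      h * (g * gram n k .standard) * (transInv h)⁻¹ := by
    change _ * (gram n k .standard * transInv h * (gram n k .standard)⁻¹)⁻¹ * _ = _
    group
  rw [form, h1]
  rfl

end Conjugation

/-! ### Irreducibility of linear subsets -/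

section Zariski

open MvPolynomial

variable {n : ℕ} {k : Type*} [Field k]

theorem exists_basic_open_subset {U : Set (GL (Fin n) k)} (hU : @IsOpen _ (zariski n k) U)
    {x : GL (Fin n) k} (hx : x ∈ U) :
    ∃ P : MvPolynomial (Fin n × Fin n) k, eval (fun ij => x.1 ij.1 ij.2) P ≠ 0 ∧
      ∀ g : GL (Fin n) k, eval (fun ij => g.1 ij.1 ij.2) P ≠ 0 → g ∈ U := by
  induction hU with
  | basic s hs =>
    obtain ⟨P, rfl⟩ := hs
    exact ⟨P, hx, fun g hg => hg⟩
  | univ => exact ⟨1, by simp, fun _ _ => trivial⟩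
  | inter s t _ _ ihs iht =>
    obtain ⟨P, hP, hPs⟩ := ihs hx.1
    obtain ⟨Q, hQ, hQt⟩ := iht hx.2
    refine ⟨P * Q, by rw [map_mul]; exact mul_ne_zero hP hQ, fun g hg => ?_⟩
    rw [map_mul] at hg
    exact ⟨hPs g (left_ne_zero_of_mul hg), hQt g (right_ne_zero_of_mul hg)⟩
  | sUnion S _ ih =>
    obtain ⟨s, hs, hxs⟩ := hx
    obtain ⟨P, hP, hPs⟩ := ih s hs hxs
    exact ⟨P, hP, fun g hg => ⟨s, hs, hPs g hg⟩⟩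

theorem isClosed_eval_eq_zero (P : MvPolynomial (Fin n × Fin n) k) :
    @IsClosed _ (zariski n k) {g : GL (Fin n) k | eval (fun ij => g.1 ij.1 ij.2) P = 0} := by
  let := zariski n k
  refine ⟨TopologicalSpace.isOpen_generateFrom_of_mem ⟨P, rfl⟩⟩

/-- The determinant as a polynomial. -/
noncomputable def detPoly (n : ℕ) (k : Type*) [Field k] : MvPolynomial (Fin n × Fin n) k :=
  (Matrix.mvPolynomialX (Fin n) (Fin n) k).det

theorem eval_detPoly (M : Matrix (Fin n) (Fin n) k) :
    eval (fun ij => M ij.1 ij.2) (detPoly n k) = M.det := by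
  rw [detPoly, RingHom.map_det]
  congr 1
  ext i j
  simp [Matrix.mvPolynomialX]

theorem exists_polynomial_line (x y : Matrix (Fin n) (Fin n) k)
    (P : MvPolynomial (Fin n × Fin n) k) :
    ∃ p : Polynomial k, ∀ s : k,
      p.eval s = eval (fun ij => (x + s • (y - x)) ij.1 ij.2) P := by
  refine ⟨aeval (fun ij => Polynomial.C (x ij.1 ij.2) +
    Polynomial.X * Polynomial.C (y ij.1 ij.2 - x ij.1 ij.2)) P, fun s => ?_⟩
  induction P using MvPolynomial.induction_on with
  | C a => simp
  | add p q hp hq => simp only [map_add, Polynomial.eval_add, hp, hq]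
  | mul_X p i hp =>
    simp only [map_mul, Polynomial.eval_mul, hp, aeval_X, eval_X]
    simp

/-- Join a point x of one open set to a point y of the other by an affine line. Along it the
polynomials cutting out the two open sets and the determinant are non-zero polynomials in one
variable, so over an infinite field some point of the line avoids all their zeros. -/
theorem isPreirreducible_linear [Infinite k] (B : Submodule k (Matrix (Fin n) (Fin n) k)) :
    @IsPreirreducible _ (zariski n k) {g : GL (Fin n) k | g.1 ∈ B} := by
  rintro u v hu hv ⟨x, hxB, hxu⟩ ⟨y, hyB, hyv⟩
  obtain ⟨P, hP, hPu⟩ := exists_basic_open_subset hu hxu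
  obtain ⟨Q, hQ, hQv⟩ := exists_basic_open_subset hv hyv
  obtain ⟨p, hp⟩ := exists_polynomial_line x.1 y.1 P
  obtain ⟨q, hq⟩ := exists_polynomial_line x.1 y.1 Q
  obtain ⟨d, hd⟩ := exists_polynomial_line x.1 y.1 (detPoly n k)
  have hp0 : p ≠ 0 := by
    rintro rfl
    apply hP
    simpa using (hp 0).symm
  have hq0 : q ≠ 0 := by
    rintro rfl
    apply hQ
    simpa using (hq 1).symm
  have hd0 : d ≠ 0 := by
    rintro rfl
    have := (hd 0).symm
    rw [eval_detPoly] at this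
    simp only [zero_smul, add_zero, Polynomial.eval_zero] at this
    exact (Matrix.isUnits_det_units x).ne_zero this
  obtain ⟨s, hs⟩ := Polynomial.exists_eval_ne_zero_of_natDegree_lt_card (p * q * d)
    (mul_ne_zero (mul_ne_zero hp0 hq0) hd0)
    (lt_of_lt_of_le (Cardinal.natCast_lt_aleph0) (Cardinal.aleph0_le_mk k))
  rw [Polynomial.eval_mul, Polynomial.eval_mul, hp, hq, hd, eval_detPoly] at hs
  have hsd := right_ne_zero_of_mul hs
  have hsp := left_ne_zero_of_mul (left_ne_zero_of_mul hs)
  have hsq := right_ne_zero_of_mul (left_ne_zero_of_mul hs)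
  refine ⟨Matrix.GeneralLinearGroup.mkOfDetNeZero _ hsd, ?_, hPu _ hsp, hQv _ hsq⟩
  exact B.add_mem hxB (B.smul_mem _ (B.sub_mem hyB hxB))

end Zariski

/-! ### Regular functions on the general linear group -/

section RegularFunctions

open MvPolynomial

variable {n : ℕ} {k : Type*} [Field k]

/-- The algebra of regular functions on `GL_n(k)`. -/
def regular (n : ℕ) (k : Type*) [Field k] : Subalgebra k (GL (Fin n) k → k) :=
  Algebra.adjoin k ({f | ∃ i j, f = fun g => g.1 i j} ∪ {f | ∃ i j, f = fun g => (g⁻¹).1 i j})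

theorem entry_mem_regular (i j : Fin n) : (fun g : GL (Fin n) k => g.1 i j) ∈ regular n k :=
  Algebra.subset_adjoin (Or.inl ⟨i, j, rfl⟩)

theorem inv_entry_mem_regular (i j : Fin n) :
    (fun g : GL (Fin n) k => (g⁻¹).1 i j) ∈ regular n k :=
  Algebra.subset_adjoin (Or.inr ⟨i, j, rfl⟩)

/-- A map all whose matrix entries, and those of its inverse, are regular. -/
def IsRegularMap (φ : GL (Fin n) k → GL (Fin n) k) : Prop :=
  ∀ i j, (fun g => (φ g).1 i j) ∈ regular n k ∧ (fun g => ((φ g)⁻¹).1 i j) ∈ regular n k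

theorem IsRegularMap.comp_mem {φ : GL (Fin n) k → GL (Fin n) k} (hφ : IsRegularMap φ)
    {f : GL (Fin n) k → k} (hf : f ∈ regular n k) : (fun g => f (φ g)) ∈ regular n k := by
  induction hf using Algebra.adjoin_induction with
  | mem f hf =>
    rcases hf with ⟨i, j, rfl⟩ | ⟨i, j, rfl⟩
    · exact (hφ i j).1
    · exact (hφ i j).2
  | algebraMap r => exact (regular n k).algebraMap_mem r
  | add f g _ _ hf hg => exact (regular n k).add_mem hf hg
  | mul f g _ _ hf hg => exact (regular n k).mul_mem hf hg

theorem isRegularMap_id : IsRegularMap (fun g : GL (Fin n) k => g) := fun i j =>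
  ⟨entry_mem_regular i j, inv_entry_mem_regular i j⟩

theorem isRegularMap_const (a : GL (Fin n) k) : IsRegularMap (fun _ => a) := fun _ _ =>
  ⟨(regular n k).algebraMap_mem _, (regular n k).algebraMap_mem _⟩

theorem IsRegularMap.inv {φ : GL (Fin n) k → GL (Fin n) k} (hφ : IsRegularMap φ) :
    IsRegularMap (fun g => (φ g)⁻¹) := fun i j =>
  ⟨(hφ i j).2, by simpa using (hφ i j).1⟩

theorem IsRegularMap.mul {φ φ' : GL (Fin n) k → GL (Fin n) k} (hφ : IsRegularMap φ)
    (hφ' : IsRegularMap φ') : IsRegularMap (fun g => φ g * φ' g) := by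
  have key : ∀ u v : GL (Fin n) k → Matrix (Fin n) (Fin n) k,
      (∀ i j, (fun g => u g i j) ∈ regular n k) → (∀ i j, (fun g => v g i j) ∈ regular n k) →
      ∀ i j, (fun g => (u g * v g) i j) ∈ regular n k := by
    intro u v hu hv i j
    have : (fun g => (u g * v g) i j) = ∑ l, (fun g => u g i l) * (fun g => v g l j) := by
      ext g
      simp [Matrix.mul_apply, Finset.sum_apply]
    rw [this]
    exact (regular n k).sum_mem fun l _ => (regular n k).mul_mem (hu i l) (hv l j)
  intro i j
  refine ⟨key _ _ (fun i j => (hφ i j).1) (fun i j => (hφ' i j).1) i j, ?_⟩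
  simp only [mul_inv_rev]
  exact key _ _ (fun i j => (hφ' i j).2) (fun i j => (hφ i j).2) i j

/-- By Cramer's rule the entries of the inverse have only a power of the determinant as denominator.
Zero loci of regular functions are therefore zero loci of polynomials, hence closed. -/
theorem exists_mul_det_pow_eq_eval {f : GL (Fin n) k → k} (hf : f ∈ regular n k) :
    ∃ (N : ℕ) (P : MvPolynomial (Fin n × Fin n) k), ∀ g : GL (Fin n) k,
      f g * g.1.det ^ N = eval (fun ij => g.1 ij.1 ij.2) P := by
  induction hf using Algebra.adjoin_induction with
  | mem f hf =>
    rcases hf with ⟨i, j, rfl⟩ | ⟨i, j, rfl⟩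
    · exact ⟨0, X (i, j), fun g => by simp⟩
    · refine ⟨1, (Matrix.mvPolynomialX (Fin n) (Fin n) k).adjugate i j, fun g => ?_⟩
      have h1 : eval (fun ij => g.1 ij.1 ij.2)
          ((Matrix.mvPolynomialX (Fin n) (Fin n) k).adjugate i j) = g.1.adjugate i j := by
        have := RingHom.map_adjugate (eval (fun ij : Fin n × Fin n => g.1 ij.1 ij.2))
          (Matrix.mvPolynomialX (Fin n) (Fin n) k)
        have h2 := congrFun (congrFun this i) j
        rw [RingHom.mapMatrix_apply, Matrix.map_apply] at h2
        rw [h2]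
        congr 2
        ext i j
        simp [Matrix.mvPolynomialX]
      have h3 : (g⁻¹).1 i j = g.1.det⁻¹ * g.1.adjugate i j := by
        rw [Matrix.coe_units_inv, Matrix.inv_def, Matrix.smul_apply, smul_eq_mul,
          Ring.inverse_eq_inv']
      rw [h1, pow_one]
      change (g⁻¹).1 i j * _ = _
      rw [h3]
      have := (Matrix.isUnits_det_units g).ne_zero
      field_simp
  | algebraMap r => exact ⟨0, C r, fun g => by simp⟩
  | add f g _ _ hf hg =>
    obtain ⟨N, P, hP⟩ := hf
    obtain ⟨M, Q, hQ⟩ := hg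
    refine ⟨N + M, P * detPoly n k ^ M + Q * detPoly n k ^ N, fun g => ?_⟩
    rw [map_add, map_mul, map_mul, map_pow, map_pow, eval_detPoly, ← hP, ← hQ, Pi.add_apply]
    ring
  | mul f g _ _ hf hg =>
    obtain ⟨N, P, hP⟩ := hf
    obtain ⟨M, Q, hQ⟩ := hg
    refine ⟨N + M, P * Q, fun g => ?_⟩
    rw [map_mul, ← hP, ← hQ, Pi.mul_apply]
    ring

theorem isClosed_regular_eq {f : GL (Fin n) k → k} (hf : f ∈ regular n k) (c : k) :
    @IsClosed _ (zariski n k) {g : GL (Fin n) k | f g = c} := by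
  obtain ⟨N, P, hP⟩ := exists_mul_det_pow_eq_eval hf
  convert isClosed_eval_eq_zero (P - C c * detPoly n k ^ N) using 1
  ext g
  have h := pow_ne_zero N (Matrix.isUnits_det_units g).ne_zero
  rw [Set.mem_ofPred_eq, Set.mem_ofPred_eq, map_sub, map_mul, map_pow, eval_detPoly, ← hP, eval_C,
    ← sub_mul, mul_eq_zero, or_iff_left h, sub_eq_zero]

theorem continuous_of_isRegularMap {φ : GL (Fin n) k → GL (Fin n) k} (hφ : IsRegularMap φ) :
    @Continuous _ _ (zariski n k) (zariski n k) φ := by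
  let := zariski n k
  refine continuous_generateFrom_iff.2 ?_
  rintro _ ⟨P, rfl⟩
  have h : (fun g : GL (Fin n) k => eval (fun ij => (φ g).1 ij.1 ij.2) P) ∈ regular n k := by
    induction P using MvPolynomial.induction_on with
    | C a =>
      simp only [eval_C]
      exact (regular n k).algebraMap_mem a
    | add p q hp hq =>
      simp only [map_add]
      exact (regular n k).add_mem hp hq
    | mul_X p i hp =>
      simp only [map_mul, eval_X]
      exact (regular n k).mul_mem hp (hφ i.1 i.2).1
  exact isOpen_compl_iff.2 (isClosed_regular_eq h 0)

/-- The level sets are closed; finitely many of them would cut H into two disjoint closed pieces.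
This is the only consequence of connectedness that the Lie–Kolchin theorem needs. -/
theorem regular_constant_of_isConnected {H : Set (GL (Fin n) k)}
    (hH : @IsPreconnected _ (zariski n k) H) {f : GL (Fin n) k → k} (hf : f ∈ regular n k)
    (hfin : (f '' H).Finite) {x y : GL (Fin n) k} (hx : x ∈ H) (hy : y ∈ H) : f x = f y := by
  by_contra hne
  let := zariski n k
  have h2 : IsClosed (⋃ c ∈ (f '' H) \ {f x}, {g : GL (Fin n) k | f g = c}) :=
    (hfin.subset Set.sdiff_subset).isClosed_biUnion fun c _ => isClosed_regular_eq hf c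
  obtain ⟨z, -, hz1, hz2⟩ := isPreconnected_closed_iff.1 hH _ _ (isClosed_regular_eq hf (f x)) h2
    (fun g hg => by
      by_cases h : f g = f x
      · exact Or.inl h
      · exact Or.inr (Set.mem_biUnion ⟨⟨g, hg, rfl⟩, h⟩ rfl))
    ⟨x, hx, rfl⟩ ⟨y, hy, Set.mem_biUnion ⟨⟨y, hy, rfl⟩, fun h => hne h.symm⟩ rfl⟩
  simp only [Set.mem_iUnion] at hz2
  obtain ⟨c, hc, hzc⟩ := hz2
  exact hc.2 (hzc.symm.trans hz1)

end RegularFunctions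

/-! ### Closed connected subgroups cut out by linear equations -/

section LinearSubsets

open MvPolynomial

variable {n : ℕ} {k : Type*} [Field k]

theorem isClosed_linear (B : Submodule k (Matrix (Fin n) (Fin n) k)) :
    @IsClosed _ (zariski n k) {g : GL (Fin n) k | g.1 ∈ B} := by
  let := zariski n k
  have h : {g : GL (Fin n) k | g.1 ∈ B} =
      ⋂ φ : {φ : Module.Dual k (Matrix (Fin n) (Fin n) k) // B ≤ LinearMap.ker φ},
        {g | φ.1 g.1 = 0} := by
    ext g
    simp only [Set.mem_ofPred_eq, Set.mem_iInter]
    refine ⟨fun hg φ => φ.2 hg, fun hg => ?_⟩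
    by_contra hgB
    obtain ⟨φ, hφ, hB⟩ := Submodule.exists_le_ker_of_notMem hgB
    exact hφ (hg ⟨φ, hB⟩)
  rw [h]
  refine isClosed_iInter fun φ => isClosed_regular_eq (f := fun g => φ.1 g.1) ?_ 0
  have : (fun g : GL (Fin n) k => φ.1 g.1) =
      ∑ i, ∑ j, φ.1 (Matrix.single i j 1) • fun g : GL (Fin n) k => g.1 i j := by
    ext g
    conv_lhs => rw [Matrix.matrix_eq_sum_single g.1]
    simp only [map_sum, Finset.sum_apply, Pi.smul_apply, smul_eq_mul]
    refine Finset.sum_congr rfl fun i _ => Finset.sum_congr rfl fun j _ => ?_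
    rw [mul_comm, ← smul_eq_mul, ← map_smul, Matrix.smul_single, smul_eq_mul, mul_one]
  rw [this]
  exact sum_mem fun i _ => sum_mem fun j _ => (regular n k).smul_mem (entry_mem_regular i j) _

theorem isClosedConnected_of_linear [Infinite k] {H : Subgroup (GL (Fin n) k)}
    (B : Submodule k (Matrix (Fin n) (Fin n) k)) (h : ∀ g : GL (Fin n) k, g ∈ H ↔ g.1 ∈ B) :
    IsClosedConnected H := by
  have hH : (H : Set (GL (Fin n) k)) = {g | g.1 ∈ B} := Set.ext h
  refine ⟨hH ▸ isClosed_linear B, ⟨1, H.one_mem⟩, ?_⟩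
  rw [hH]
  exact @IsPreirreducible.isPreconnected _ (zariski n k) _ (isPreirreducible_linear B)

end LinearSubsets

/-! ### Conjugates of tori and Borel subgroups -/

section ConjugationInvariance

variable {n : ℕ} {k : Type*} [Field k]

theorem IsClosedConnected.map_conj {H : Subgroup (GL (Fin n) k)} (hH : IsClosedConnected H)
    (g : GL (Fin n) k) : IsClosedConnected (H.map (MulAut.conj g).toMonoidHom) := by
  have hc : ∀ g : GL (Fin n) k, IsRegularMap fun x => g * x * g⁻¹ := fun g =>
    ((isRegularMap_const g).mul isRegularMap_id).mul (isRegularMap_const g⁻¹)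
  let := zariski n k
  refine ⟨?_, ?_⟩
  · have : ((H.map (MulAut.conj g).toMonoidHom : Subgroup _) : Set (GL (Fin n) k)) =
        (fun x => g⁻¹ * x * g⁻¹⁻¹) ⁻¹' H := by
      ext x
      simp only [Subgroup.coe_map, Set.mem_image, SetLike.mem_coe, Set.mem_preimage]
      constructor
      · rintro ⟨y, hy, rfl⟩
        simpa [mul_assoc] using hy
      · intro hx
        exact ⟨_, hx, by simp [mul_assoc]⟩
    rw [this]
    exact hH.1.preimage (continuous_of_isRegularMap (hc g⁻¹))
  · exact hH.2.image _ (continuous_of_isRegularMap (hc g)).continuousOn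

theorem map_conj_conj_inv {G : Type*} [Group G] (H : Subgroup G) (g : G) :
    (H.map (MulAut.conj g⁻¹).toMonoidHom).map (MulAut.conj g).toMonoidHom = H := by
  rw [Subgroup.map_map]
  convert H.map_id
  ext x
  simp [mul_assoc]

theorem maximal_map_conj {P : Subgroup (GL (Fin n) k) → Prop}
    (hP : ∀ H g, P H → P (H.map (MulAut.conj g).toMonoidHom))
    {H : Subgroup (GL (Fin n) k)} (hH : Maximal P H) (g : GL (Fin n) k) :
    Maximal P (H.map (MulAut.conj g).toMonoidHom) := by
  refine ⟨hP _ _ hH.1, fun L hL hle => ?_⟩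
  have h1 := hH.2 (hP L g⁻¹ hL) (by
    have := Subgroup.map_mono (f := (MulAut.conj g⁻¹).toMonoidHom) hle
    have h2 := map_conj_conj_inv H g⁻¹
    rw [inv_inv] at h2
    rwa [h2] at this)
  have := Subgroup.map_mono (f := (MulAut.conj g).toMonoidHom) h1
  rwa [map_conj_conj_inv] at this

theorem IsTorus.map_conj {H : Subgroup (GL (Fin n) k)} (hH : IsTorus H) (g : GL (Fin n) k) :
    IsTorus (H.map (MulAut.conj g).toMonoidHom) := by
  refine ⟨hH.1.map_conj g, ?_⟩
  obtain ⟨x, hx⟩ := hH.2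
  refine ⟨x * g⁻¹, ?_⟩
  rintro _ ⟨t, ht, rfl⟩
  have h : x * g⁻¹ * (MulAut.conj g).toMonoidHom t * (x * g⁻¹)⁻¹ = x * t * x⁻¹ := by
    simp [mul_assoc]
  rw [h]
  exact hx t ht

theorem IsMaximalTorus.map_conj {H : Subgroup (GL (Fin n) k)} (hH : IsMaximalTorus H)
    (g : GL (Fin n) k) : IsMaximalTorus (H.map (MulAut.conj g).toMonoidHom) :=
  maximal_map_conj (fun _ g h => h.map_conj g) hH g

theorem IsBorel.map_conj {H : Subgroup (GL (Fin n) k)} (hH : IsBorel H)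
    (g : GL (Fin n) k) : IsBorel (H.map (MulAut.conj g).toMonoidHom) := by
  refine maximal_map_conj (fun H g h => ⟨h.1.map_conj g, ?_⟩) hH g
  have := h.2
  exact Group.isSolvable_of_surjective
    (f := (MulAut.conj g).toMonoidHom.subgroupMap H) (MonoidHom.subgroupMap_surjective _ _)

end ConjugationInvariance

/-! ### The Lie–Kolchin theorem -/

section LieKolchin

open scoped commutatorElement

variable {Γ k V : Type*} [Group Γ]

/-- Rigidity passes down the derived series without any topology on its terms. Fix y and b: the
function sending x to f(⁅x, y⁆b) has finite range on the previous term, so by induction it keeps its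
value f(b) at x = 1. Hence f is invariant under multiplication by commutators, which generate. -/
theorem constant_on_derivedSeries {R : Set (Γ → k)}
    (h1 : ∀ f ∈ R, ∀ y b, (fun x => f (⁅x, y⁆ * b)) ∈ R)
    (h4 : ∀ f ∈ R, (Set.range f).Finite → ∀ x, f x = f 1) (d : ℕ) :
    ∀ f ∈ R, (f '' (derivedSeries Γ d : Set Γ)).Finite →
      ∀ x ∈ derivedSeries Γ d, f x = f 1 := by
  induction d with
  | zero =>
    intro f hf hfin x _
    exact h4 f hf (by simpa using hfin) x
  | succ d ih =>
    intro f hf hfin x hx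
    have key : ∀ b ∈ derivedSeries Γ (d + 1), f (x * b) = f b := by
      rw [derivedSeries_succ, Subgroup.commutator_def] at hx
      induction hx using Subgroup.closure_induction with
      | mem z hz =>
        obtain ⟨x, hx, y, hy, rfl⟩ := hz
        intro b hb
        have := ih _ (h1 f hf y b) (hfin.subset (by
          rintro _ ⟨z, hz, rfl⟩
          refine ⟨_, mul_mem ?_ hb, rfl⟩
          exact Subgroup.commutator_mem_commutator hz hy)) x hx
        simpa using this
      | one => simp
      | mul y z _ hz' hy hz =>
        intro b hb
        have hz2 : z ∈ derivedSeries Γ (d + 1) := by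
          rw [derivedSeries_succ, Subgroup.commutator_def]; exact hz'
        rw [mul_assoc, hy _ (mul_mem hz2 hb), hz b hb]
      | inv y hy' hy =>
        intro b hb
        have hy2 : y ∈ derivedSeries Γ (d + 1) := by
          rw [derivedSeries_succ, Subgroup.commutator_def]; exact hy'
        rw [← hy _ (mul_mem (inv_mem hy2) hb), mul_inv_cancel_left]
    simpa using key 1 (one_mem _)

variable [Field k] [AddCommGroup V] [Module k V] (ρ : Γ →* Module.End k V)

/-- Either every x acts on U by a scalar, or some x has a proper eigenspace, which is stable under
the other elements because they commute with x on U; induct on the dimension. -/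
theorem exists_common_eigenvector_of_commute [IsAlgClosed k] [FiniteDimensional k V]
    (H : Subgroup Γ) (U : Submodule k V) (hU : U ≠ ⊥) (hst : ∀ x ∈ H, ∀ u ∈ U, ρ x u ∈ U)
    (hcomm : ∀ x ∈ H, ∀ y ∈ H, ∀ u ∈ U, ρ x (ρ y u) = ρ y (ρ x u)) :
    ∃ u ∈ U, u ≠ 0 ∧ ∀ x ∈ H, ∃ c : k, ρ x u = c • u := by
  induction hd : Module.finrank k U using Nat.strong_induction_on generalizing U with
  | _ d ih =>
  by_cases hs : ∀ x ∈ H, ∃ c : k, ∀ u ∈ U, ρ x u = c • u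
  · obtain ⟨u, hu, hu0⟩ := U.ne_bot_iff.1 hU
    exact ⟨u, hu, hu0, fun x hx => (hs x hx).imp fun c hc => hc u hu⟩
  · push Not at hs
    obtain ⟨x, hx, hxc⟩ := hs
    have : Nontrivial U := Submodule.nontrivial_iff_ne_bot.2 hU
    obtain ⟨c, hc⟩ := Module.End.exists_eigenvalue ((ρ x).restrict (hst x hx))
    obtain ⟨⟨v, hvU⟩, hv⟩ := hc.exists_hasEigenvector
    have hv0 : v ≠ 0 := fun h => hv.2 (Subtype.ext h)
    have hvc : ρ x v = c • v := congrArg Subtype.val hv.apply_eq_smul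
    obtain ⟨w, hwU, hw⟩ := hxc c
    let U' : Submodule k V := U ⊓ Module.End.eigenspace (ρ x) c
    have hlt : U' < U := by
      refine lt_of_le_of_ne inf_le_left fun h => hw ?_
      rw [← h] at hwU
      exact Module.End.mem_eigenspace_iff.1 hwU.2
    obtain ⟨u, hu, hu0, huH⟩ := ih _ (hd ▸ Submodule.finrank_lt_finrank_of_lt hlt) U'
      (U'.ne_bot_iff.2 ⟨v, ⟨hvU, Module.End.mem_eigenspace_iff.2 hvc⟩, hv0⟩)
      (fun y hy u hu => ⟨hst y hy u hu.1, Module.End.mem_eigenspace_iff.2 (by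
        rw [hcomm x hx y hy u hu.1, Module.End.mem_eigenspace_iff.1 hu.2, map_smul])⟩)
      (fun y hy z hz u hu => hcomm y hy z hz u hu.1) rfl
    exact ⟨u, hu.1, hu0, huH⟩

/-- A product of commutators has determinant 1 on U, while the scalar c has determinant c to the
power of the dimension. -/
theorem commutator_smul_pow_finrank_eq_one (H : Subgroup Γ) (U : Submodule k V)
    (hst : ∀ x ∈ H, ∀ u ∈ U, ρ x u ∈ U) {x : Γ} (hx : x ∈ ⁅H, H⁆) {c : k}
    (hc : ∀ u ∈ U, ρ x u = c • u) : c ^ Module.finrank k U = 1 := by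
  let ρU : H →* Module.End k U :=
    { toFun := fun x => (ρ x).restrict (hst x x.2)
      map_one' := by ext u; simp
      map_mul' := fun x y => by ext u; simp }
  let δ : H →* kˣ := ((LinearMap.det : Module.End k U →* k).comp ρU).toHomUnits
  have hle : ⁅H, H⁆ ≤ δ.ker.map H.subtype := by
    rw [Subgroup.commutator_le]
    intro y hy z hz
    refine ⟨⁅(⟨y, hy⟩ : H), (⟨z, hz⟩ : H)⁆, ?_, rfl⟩
    rw [SetLike.mem_coe, MonoidHom.mem_ker, map_commutatorElement, commutatorElement_def,
      mul_comm (δ _) (δ _)]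
    group
  obtain ⟨y, hy, rfl⟩ := hle hx
  have h2 : (δ y : k) = 1 := by rw [MonoidHom.mem_ker.1 hy, Units.val_one]
  have h3 : ρU y = c • LinearMap.id := by
    ext u
    exact hc u u.2
  have h4 : (δ y : k) = LinearMap.det (ρU y) := rfl
  rw [← h2, h4, h3, LinearMap.det_smul, LinearMap.det_id, mul_one]

/-- The Lie–Kolchin theorem: a solvable group whose matrix coefficients lie in a space of functions
among which only the constants have finite range has a common eigenvector. -/
theorem exists_common_eigenvector_of_isSolvable [IsAlgClosed k] [FiniteDimensional k V]
    [Nontrivial V] [Group.IsSolvable Γ] {R : Set (Γ → k)}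
    (h1 : ∀ f ∈ R, ∀ y b, (fun x => f (⁅x, y⁆ * b)) ∈ R)
    (h2 : ∀ f ∈ R, ∀ x, (fun h => f (h⁻¹ * x * h)) ∈ R)
    (h3 : ∀ (φ : Module.Dual k V) v, (fun x => φ (ρ x v)) ∈ R)
    (h4 : ∀ f ∈ R, (Set.range f).Finite → ∀ x, f x = f 1) :
    ∃ v : V, v ≠ 0 ∧ ∀ x, ∃ c : k, ρ x v = c • v := by
  classical
  have hrigid := constant_on_derivedSeries h1 h4
  -- The induction climbs the derived series from its trivial end; j counts the terms left below the
  -- current one.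
  have main : ∀ j d, derivedSeries Γ (d + j) = ⊥ → ∀ W : Submodule k V, W ≠ ⊥ →
      (∀ x ∈ derivedSeries Γ d, ∀ w ∈ W, ρ x w ∈ W) →
      ∃ v ∈ W, v ≠ 0 ∧ ∀ x ∈ derivedSeries Γ d, ∃ c : k, ρ x v = c • v := by
    intro j
    induction j with
    | zero =>
      intro d hd W hW _
      obtain ⟨v, hv, hv0⟩ := W.ne_bot_iff.1 hW
      refine ⟨v, hv, hv0, fun x hx => ⟨1, ?_⟩⟩
      rw [add_zero] at hd
      rw [hd, Subgroup.mem_bot] at hx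
      simp [hx]
    | succ j ih =>
      intro d hd W hW hst
      have hle : derivedSeries Γ (d + 1) ≤ derivedSeries Γ d := derivedSeries_antitone Γ d.le_succ
      obtain ⟨v, hv, hv0, hvc⟩ := ih (d + 1) (by rw [← hd]; congr 1; omega) W hW
        (fun x hx => hst x (hle hx))
      choose! χ hχ using hvc
      obtain ⟨φ, hφ⟩ : ∃ φ : Module.Dual k V, φ v = 1 := by
        obtain ⟨φ, hφ⟩ := not_forall.1 (mt (Module.forall_dual_apply_eq_zero_iff k v).1 hv0)
        exact ⟨(φ v)⁻¹ • φ, inv_mul_cancel₀ hφ⟩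
      have hf : ∀ x ∈ derivedSeries Γ (d + 1), φ (ρ x v) = χ x := fun x hx => by
        rw [hχ x hx, map_smul, hφ, smul_eq_mul, mul_one]
      have hinj : ∀ x, Function.Injective (ρ x) := fun x => by
        refine Function.LeftInverse.injective (g := ρ x⁻¹) fun u => ?_
        rw [← Module.End.mul_apply, ← map_mul]
        simp
      have hnorm : ∀ h, ∀ x ∈ derivedSeries Γ (d + 1), h⁻¹ * x * h ∈ derivedSeries Γ (d + 1) :=
        fun h x hx => by simpa using (derivedSeries_normal Γ (d + 1)).conj_mem x hx h⁻¹
      have hswap : ∀ h x u, ρ x (ρ h u) = ρ h (ρ (h⁻¹ * x * h) u) := fun h x u => by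
        rw [← Module.End.mul_apply, ← map_mul, ← Module.End.mul_apply, ← map_mul]
        group
      -- If v has weight χ, then ρ(y)v is an eigenvector of ρ(x) with eigenvalue χ(y⁻¹xy). There are
      -- finitely many eigenvalues, so rigidity makes χ invariant under conjugation.
      have hconj : ∀ h ∈ derivedSeries Γ d, ∀ x ∈ derivedSeries Γ (d + 1),
          χ (h⁻¹ * x * h) = χ x := by
        intro h hh x hx
        have := hrigid d _ (h2 _ (h3 φ v) x) ((Module.End.finite_hasEigenvalue (ρ x)).subset (by
          rintro _ ⟨y, hy, rfl⟩
          change Module.End.HasEigenvalue (ρ x) (φ (ρ (y⁻¹ * x * y) v))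
          rw [hf _ (hnorm y x hx)]
          refine Module.End.hasEigenvalue_of_hasEigenvector (x := ρ y v)
            ⟨Module.End.mem_eigenspace_iff.2 ?_, fun h0 => hv0 (hinj y (by rw [h0, map_zero]))⟩
          rw [hswap, hχ _ (hnorm y x hx), map_smul])) h hh
        simp only [inv_one, one_mul, mul_one] at this
        rwa [hf _ (hnorm h x hx), hf x hx] at this
      -- The weight space of χ in W; invariance of χ makes it stable under the larger group.
      let U : Submodule k V :=
        { carrier := {u | u ∈ W ∧ ∀ x ∈ derivedSeries Γ (d + 1), ρ x u = χ x • u}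
          zero_mem' := ⟨W.zero_mem, fun x _ => by simp⟩
          add_mem' := fun {a b} ha hb => ⟨W.add_mem ha.1 hb.1, fun x hx => by
            rw [map_add, ha.2 x hx, hb.2 x hx, smul_add]⟩
          smul_mem' := fun c a ha => ⟨W.smul_mem c ha.1, fun x hx => by
            rw [map_smul, ha.2 x hx, smul_comm]⟩ }
      have hUst : ∀ x ∈ derivedSeries Γ d, ∀ u ∈ U, ρ x u ∈ U := fun h hh u hu =>
        ⟨hst h hh u hu.1, fun x hx => by
          rw [hswap, hu.2 _ (hnorm h x hx), hconj h hh x hx, map_smul]⟩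
      have hU0 : U ≠ ⊥ := U.ne_bot_iff.2 ⟨v, ⟨hv, hχ⟩, hv0⟩
      have : Nontrivial U := Submodule.nontrivial_iff_ne_bot.2 hU0
      have hpow : ∀ x ∈ derivedSeries Γ (d + 1), χ x ^ Module.finrank k U = 1 := fun x hx =>
        commutator_smul_pow_finrank_eq_one ρ _ U hUst hx fun u hu => hu.2 x hx
      -- The values of χ are roots of unity of bounded order, so rigidity forces χ = 1. Commutators
      -- then act trivially on U, and the current term acts on U by commuting operators.
      have hχ1 : ∀ x ∈ derivedSeries Γ (d + 1), χ x = 1 := by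
        intro x hx
        have := hrigid (d + 1) _ (h3 φ v) (((Polynomial.nthRoots (Module.finrank k U)
          (1 : k)).toFinset.finite_toSet).subset (by
          rintro _ ⟨y, hy, rfl⟩
          change φ (ρ y v) ∈ _
          rw [hf y hy]
          simpa [Polynomial.mem_nthRoots Module.finrank_pos] using hpow y hy)) x hx
        simp only [map_one, Module.End.one_apply, hφ] at this
        rwa [hf x hx] at this
      obtain ⟨u, hu, hu0, huc⟩ := exists_common_eigenvector_of_commute ρ (derivedSeries Γ d) U hU0
        hUst (fun x hx y hy u hu => by
          have hc : ⁅x, y⁆ ∈ derivedSeries Γ (d + 1) := by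
            rw [derivedSeries_succ]
            exact Subgroup.commutator_mem_commutator hx hy
          have h5 := (hUst y hy _ (hUst x hx u hu)).2 _ hc
          rw [hχ1 _ hc, one_smul, ← Module.End.mul_apply, ← Module.End.mul_apply, ← map_mul,
            ← map_mul] at h5
          rw [← h5, ← Module.End.mul_apply, ← map_mul, commutatorElement_def]
          group)
      exact ⟨u, hu.1, hu0, huc⟩
  obtain ⟨N, hN⟩ := (Group.isSolvable_def Γ).1 ‹_›
  obtain ⟨v, -, hv0, hv⟩ := main N 0 (by rwa [zero_add]) ⊤ top_ne_bot (fun _ _ _ _ => trivial)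
  exact ⟨v, hv0, fun x => hv x (by simp)⟩

end LieKolchin

/-! ### Diagonal and triangular groups, and their solvability -/

section PatternGroups

variable {n : ℕ} {k : Type*} [Field k]

/-- The matrices whose non-zero entries are at the positions allowed by a relation. -/
def patternSubmodule (k : Type*) [Field k] (R : Fin n → Fin n → Prop) :
    Submodule k (Matrix (Fin n) (Fin n) k) where
  carrier := {M | ∀ i j, M i j ≠ 0 → R i j}
  zero_mem' := fun i j h => absurd rfl h
  add_mem' := fun {A B} hA hB i j h => by
    by_cases h' : A i j = 0
    · exact hB i j fun h2 => h (by rw [Matrix.add_apply, h', h2, add_zero])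
    · exact hA i j h'
  smul_mem' := fun c A hA i j h => hA i j (right_ne_zero_of_mul h)

theorem mul_mem_patternSubmodule {R R' R'' : Fin n → Fin n → Prop}
    (h : ∀ i j l, R i j → R' j l → R'' i l) {A B : Matrix (Fin n) (Fin n) k}
    (hA : A ∈ patternSubmodule k R) (hB : B ∈ patternSubmodule k R') :
    A * B ∈ patternSubmodule k R'' := by
  intro i l hil
  obtain ⟨j, -, hj⟩ := Finset.exists_ne_zero_of_sum_ne_zero (Matrix.mul_apply (M := A) ▸ hil)
  exact h i j l (hA i j (left_ne_zero_of_mul hj)) (hB j l (right_ne_zero_of_mul hj))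

/-- Left multiplication by g is an injective endomorphism of a finite-dimensional space, so it is
surjective and reaches the identity matrix. -/
theorem inv_mem_patternSubmodule {R : Fin n → Fin n → Prop} (hr : ∀ i, R i i)
    (ht : ∀ i j l, R i j → R j l → R i l) {g : GL (Fin n) k}
    (hg : g.1 ∈ patternSubmodule k R) : (g⁻¹).1 ∈ patternSubmodule k R := by
  let L : patternSubmodule k R →ₗ[k] patternSubmodule k R :=
    (LinearMap.mulLeft k g.1).restrict fun X hX => mul_mem_patternSubmodule ht hg hX
  have hinj : Function.Injective L := by
    intro X Y h
    have h1 : g.1 * X.1 = g.1 * Y.1 := congrArg Subtype.val h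
    have h2 := congrArg (fun M => (g⁻¹).1 * M) h1
    simp only [← mul_assoc, Units.inv_mul, one_mul] at h2
    exact Subtype.ext h2
  have h1 : (1 : Matrix (Fin n) (Fin n) k) ∈ patternSubmodule k R := fun i j h => by
    by_cases hij : i = j
    · exact hij ▸ hr i
    · exact absurd (Matrix.one_apply_ne hij) h
  obtain ⟨X, hX⟩ := LinearMap.injective_iff_surjective.1 hinj ⟨1, h1⟩
  have h2 : g.1 * X.1 = 1 := congrArg Subtype.val hX
  have h3 : (g⁻¹).1 = X.1 := by
    rw [← mul_one (g⁻¹).1, ← h2, ← mul_assoc, Units.inv_mul, one_mul]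
  rw [h3]
  exact X.2

/-- The invertible matrices whose non-zero entries are at the positions allowed by a preorder. -/
def patternGroup (k : Type*) [Field k] (R : Fin n → Fin n → Prop) (hr : ∀ i, R i i)
    (ht : ∀ i j l, R i j → R j l → R i l) : Subgroup (GL (Fin n) k) where
  carrier := {g | g.1 ∈ patternSubmodule k R}
  one_mem' := fun i j h => by
    by_cases hij : i = j
    · exact hij ▸ hr i
    · exact absurd (Matrix.one_apply_ne hij) h
  mul_mem' := fun hg hh => mul_mem_patternSubmodule ht hg hh
  inv_mem' := fun hg => inv_mem_patternSubmodule hr ht hg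

/-- The group of diagonal matrices. -/
def diagGroup (n : ℕ) (k : Type*) [Field k] : Subgroup (GL (Fin n) k) :=
  patternGroup k (fun i j => i = j) (fun _ => rfl) (fun _ _ _ => Eq.trans)

/-- The stabiliser of the flag defined by an ordering of the basis vectors. -/
def flagGroup (k : Type*) [Field k] (f : Fin n → ℕ) : Subgroup (GL (Fin n) k) :=
  patternGroup k (fun i j => f i ≤ f j) (fun _ => le_rfl) (fun _ _ _ => le_trans)

theorem isClosedConnected_patternGroup [Infinite k] (R : Fin n → Fin n → Prop) (hr : ∀ i, R i i)
    (ht : ∀ i j l, R i j → R j l → R i l) : IsClosedConnected (patternGroup k R hr ht) :=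
  isClosedConnected_of_linear (patternSubmodule k R) fun _ => Iff.rfl

theorem diagGL_mem_patternGroup (R : Fin n → Fin n → Prop) (hr : ∀ i, R i i)
    (ht : ∀ i j l, R i j → R j l → R i l) (d : Fin n → kˣ) :
    diagGL d ∈ patternGroup k R hr ht := fun i j h => by
  by_cases hij : i = j
  · exact hij ▸ hr i
  · exact absurd (Matrix.diagonal_apply_ne _ hij) h

theorem exists_eq_diagGL {g : GL (Fin n) k} (hg : g ∈ diagGroup n k) :
    ∃ d, g = diagGL d := by
  have hd : g.1 = Matrix.diagonal fun i => g.1 i i := by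
    ext i j
    by_cases hij : i = j
    · subst hij; simp
    · rw [Matrix.diagonal_apply_ne _ hij]
      by_contra h
      exact hij (hg i j h)
  have h0 : ∀ i, g.1 i i ≠ 0 := by
    have := (Matrix.isUnits_det_units g).ne_zero
    rw [hd, Matrix.det_diagonal, Finset.prod_ne_zero_iff] at this
    exact fun i => this i (Finset.mem_univ i)
  exact ⟨fun i => Units.mk0 _ (h0 i), Units.ext hd⟩

theorem diagGroup_le_flagGroup (f : Fin n → ℕ) : diagGroup n k ≤ flagGroup k f := by
  intro g hg
  obtain ⟨d, rfl⟩ := exists_eq_diagGL hg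
  exact diagGL_mem_patternGroup _ _ _ d

theorem isTorus_diagGroup [Infinite k] : IsTorus (diagGroup n k) := by
  refine ⟨isClosedConnected_patternGroup _ _ _, 1, fun t ht i j hij => ?_⟩
  by_contra h
  rw [one_mul, inv_one, mul_one] at h
  exact hij (ht i j h)

/-- For m > 0 both products already lie 2m steps above the diagonal. For m = 0 the diagonal entries
of the two products agree, and injectivity of f makes any other allowed position at least one step
above. -/
theorem mul_sub_mul_mem {f : Fin n → ℕ} (hf : Function.Injective f) {m : ℕ}
    {a b : Matrix (Fin n) (Fin n) k} (ha : a ∈ patternSubmodule k fun i j => f i + m ≤ f j)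
    (hb : b ∈ patternSubmodule k fun i j => f i + m ≤ f j) :
    a * b - b * a ∈ patternSubmodule k fun i j => f i + (m + 1) ≤ f j := by
  have h2 : ∀ {a b : Matrix (Fin n) (Fin n) k},
      (a ∈ patternSubmodule k fun i j => f i + m ≤ f j) →
      (b ∈ patternSubmodule k fun i j => f i + m ≤ f j) →
      a * b ∈ patternSubmodule k fun i j => f i + (m + m) ≤ f j :=
    fun {a b} => mul_mem_patternSubmodule fun i j l h1 h2 => by omega
  rcases Nat.eq_zero_or_pos m with rfl | hm
  · have hdiag : ∀ {a b : Matrix (Fin n) (Fin n) k},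
        (a ∈ patternSubmodule k fun i j => f i + 0 ≤ f j) →
        (b ∈ patternSubmodule k fun i j => f i + 0 ≤ f j) → ∀ i, (a * b) i i = a i i * b i i := by
      intro a b ha hb i
      rw [Matrix.mul_apply]
      refine Finset.sum_eq_single i (fun j _ hj => ?_) (fun h => absurd (Finset.mem_univ i) h)
      by_contra h
      have h1 := ha i j (left_ne_zero_of_mul h)
      have h2 := hb j i (right_ne_zero_of_mul h)
      exact hj (hf (by omega))
    intro i j hij
    have hle := Submodule.sub_mem _ (h2 ha hb) (h2 hb ha) i j hij
    have hne : i ≠ j := by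
      rintro rfl
      apply hij
      rw [Matrix.sub_apply, hdiag ha hb, hdiag hb ha, mul_comm, sub_self]
    have : f i ≠ f j := fun h => hne (hf h)
    omega
  · intro i j hij
    have hle := Submodule.sub_mem _ (h2 ha hb) (h2 hb ha) i j hij
    omega

/-- The m-th derived group is contained in the group of g with g - 1 at least m steps above the
diagonal, because ⁅x, y⁆ - 1 is the additive commutator of x - 1 and y - 1 times (yx)⁻¹. -/
theorem isSolvable_flagGroup {f : Fin n → ℕ} (hf : Function.Injective f) :
    Group.IsSolvable (flagGroup k f) := by
  let L : ℕ → Submodule k (Matrix (Fin n) (Fin n) k) :=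
    fun m => patternSubmodule k fun i j => f i + m ≤ f j
  have hmul : ∀ {a b p}, a ∈ (patternSubmodule k fun i j : Fin n => f i ≤ f j) → b ∈ L p →
      a * b ∈ L p := fun {a b p} => mul_mem_patternSubmodule fun i j l h1 h2 => by omega
  have hmul' : ∀ {a b p}, b ∈ (patternSubmodule k fun i j : Fin n => f i ≤ f j) → a ∈ L p →
      a * b ∈ L p := fun {a b p} hb ha =>
    mul_mem_patternSubmodule (fun i j l h1 h2 => by omega) ha hb
  let N : ℕ → Subgroup (flagGroup k f) := fun m =>
    { carrier := {g | g.1.1 - 1 ∈ L m}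
      one_mem' := by
        change (1 : Matrix (Fin n) (Fin n) k) - 1 ∈ L m
        rw [sub_self]
        exact zero_mem _
      mul_mem' := fun {g h} hg hh => by
        change g.1.1 * h.1.1 - 1 ∈ L m
        have : g.1.1 * h.1.1 - 1 = g.1.1 * (h.1.1 - 1) + (g.1.1 - 1) := by noncomm_ring
        rw [this]
        exact add_mem (hmul g.2 hh) hg
      inv_mem' := fun {g} hg => by
        change (g.1⁻¹).1 - 1 ∈ L m
        have : (g.1⁻¹).1 - 1 = -((g.1⁻¹).1 * (g.1.1 - 1)) := by
          rw [mul_sub, Units.inv_mul, mul_one, neg_sub]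
        rw [this]
        exact neg_mem (hmul (g⁻¹).2 hg) }
  have hle : ∀ m, derivedSeries (flagGroup k f) m ≤ N m := by
    intro m
    induction m with
    | zero =>
      intro g _
      have h1 : (1 : GL (Fin n) k) ∈ flagGroup k f := one_mem _
      exact Submodule.sub_mem (patternSubmodule k fun i j : Fin n => f i ≤ f j) g.2 h1
    | succ m ih =>
      rw [derivedSeries_succ, Subgroup.commutator_le]
      intro x hx y hy
      have hx := ih hx
      have hy := ih hy
      change (x.1 * y.1 * x.1⁻¹ * y.1⁻¹).1 - 1 ∈ L (m + 1)
      have : (x.1 * y.1 * x.1⁻¹ * y.1⁻¹).1 - 1 =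
          ((x.1.1 - 1) * (y.1.1 - 1) - (y.1.1 - 1) * (x.1.1 - 1)) * ((y.1 * x.1)⁻¹).1 := by
        have e1 : (x.1.1 - 1) * (y.1.1 - 1) - (y.1.1 - 1) * (x.1.1 - 1) =
            (x.1 * y.1).1 - (y.1 * x.1).1 := by
          push_cast
          noncomm_ring
        rw [e1, sub_mul, Units.mul_inv, ← Units.val_mul]
        congr 2
        group
      rw [this]
      exact hmul' ((y * x)⁻¹).2 (mul_sub_mul_mem hf hx hy)
  rw [Group.isSolvable_def]
  -- No value of f exceeds the sum of all values, so no matrix position is left at this level.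
  refine ⟨(∑ i, f i) + 1, eq_bot_iff.2 fun g hg => ?_⟩
  have hg := hle _ hg
  rw [Subgroup.mem_bot]
  refine Subtype.ext (Units.ext (sub_eq_zero.1 ?_))
  ext i j
  by_contra h
  have h1 := hg i j h
  have h2 : f j ≤ ∑ i, f i := Finset.single_le_sum (fun i _ => Nat.zero_le _) (Finset.mem_univ j)
  omega

end PatternGroups

/-! ### Borel subgroups containing the diagonal torus -/

section Flags

open scoped commutatorElement

variable {n : ℕ} {k : Type*} [Field k]

theorem exists_ne_zero_and_ne_one (k : Type*) [Field k] [Infinite k] :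
    ∃ t : k, t ≠ 0 ∧ t ≠ 1 := by
  classical
  obtain ⟨t, ht⟩ := Infinite.exists_notMem_finset ({0, 1} : Finset k)
  exact ⟨t, by simpa [not_or] using ht⟩

/-- Lie–Kolchin on the quotient by W, the admissible functions being the restrictions to H of
regular functions. -/
theorem exists_eigenvector_mod_of_isSolvable [IsAlgClosed k] {H : Subgroup (GL (Fin n) k)}
    (hH : IsClosedConnected H) (hs : Group.IsSolvable H) {W : Submodule k (Fin n → k)}
    (hW : W ≠ ⊤) (hst : ∀ h ∈ H, ∀ w ∈ W, h.1 *ᵥ w ∈ W) :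
    ∃ v ∉ W, ∀ h ∈ H, ∃ c : k, h.1 *ᵥ v - c • v ∈ W := by
  have : Nontrivial ((Fin n → k) ⧸ W) := Submodule.Quotient.nontrivial_iff.2 hW
  let ρ : H →* Module.End k ((Fin n → k) ⧸ W) :=
    { toFun := fun h => W.mapQ W (Matrix.toLin' h.1.1) fun w hw => hst h.1 h.2 w hw
      map_one' := by
        ext v
        simp
      map_mul' := fun x y => by
        apply LinearMap.ext
        rintro ⟨v⟩
        change W.mkQ _ = W.mkQ _
        congr 1
        simp [Matrix.mulVec_mulVec] }
  obtain ⟨v, hv0, hv⟩ := exists_common_eigenvector_of_isSolvable ρ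
    (R := {f | ∃ F ∈ regular n k, f = fun x => F x.1}) (by
      rintro _ ⟨F, hF, rfl⟩ y b
      have := ((((isRegularMap_id (n := n) (k := k)).mul (isRegularMap_const y.1)).mul
        isRegularMap_id.inv).mul (isRegularMap_const y.1).inv).mul (isRegularMap_const b.1)
      exact ⟨_, this.comp_mem hF, rfl⟩) (by
      rintro _ ⟨F, hF, rfl⟩ y
      have := (((isRegularMap_id (n := n) (k := k)).inv).mul (isRegularMap_const y.1)).mul
        isRegularMap_id
      exact ⟨_, this.comp_mem hF, rfl⟩) (by
      rintro φ ⟨v⟩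
      refine ⟨∑ i, ∑ j, (φ (W.mkQ (Pi.single i 1)) * v j) • fun g : GL (Fin n) k => g.1 i j,
        sum_mem fun i _ => sum_mem fun j _ =>
          (regular n k).smul_mem (entry_mem_regular i j) _, ?_⟩
      ext x
      change φ (W.mkQ (x.1.1 *ᵥ v)) = _
      conv_lhs => rw [pi_eq_sum_univ' (x.1.1 *ᵥ v)]
      simp only [map_sum, map_smul, Finset.sum_apply, Pi.smul_apply, smul_eq_mul]
      refine Finset.sum_congr rfl fun i _ => ?_
      rw [Matrix.mulVec, dotProduct, Finset.sum_mul]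
      refine Finset.sum_congr rfl fun j _ => ?_
      ring_nf) (by
      rintro _ ⟨F, hF, rfl⟩ hfin x
      refine regular_constant_of_isConnected hH.2.2 hF (hfin.subset ?_) x.2 H.one_mem
      rintro _ ⟨g, hg, rfl⟩
      exact ⟨⟨g, hg⟩, rfl⟩)
  obtain ⟨v, rfl⟩ := W.mkQ_surjective v
  refine ⟨v, fun h => hv0 ((Submodule.Quotient.mk_eq_zero W).2 h), fun h hh => ?_⟩
  obtain ⟨c, hc⟩ := hv ⟨h, hh⟩
  refine ⟨c, (Submodule.Quotient.mk_eq_zero W).1 ?_⟩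
  exact sub_eq_zero.2 hc

/-- The flag is built one index at a time from H-stable coordinate subspaces. A common eigenvector
modulo such a subspace is again a coordinate vector, because H contains the diagonal matrices; its
index comes next in the ordering f. -/
theorem exists_le_flagGroup [IsAlgClosed k] {H : Subgroup (GL (Fin n) k)}
    (hH : IsClosedConnected H) (hs : Group.IsSolvable H) (hD : diagGroup n k ≤ H) :
    ∃ f : Fin n → ℕ, Function.Injective f ∧ H ≤ flagGroup k f := by
  have : Infinite k := IsAlgClosed.instInfinite
  have key : ∀ m ≤ n, ∃ (S : Finset (Fin n)) (f : Fin n → ℕ), S.card = m ∧ Set.InjOn f S ∧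
      (∀ i ∈ S, f i < m) ∧ ∀ h ∈ H, ∀ j ∈ S, ∀ i, h.1 i j ≠ 0 → i ∈ S ∧ f i ≤ f j := by
    intro m
    induction m with
    | zero => exact fun _ => ⟨∅, fun _ => 0, by simp⟩
    | succ m ih =>
      intro hm
      obtain ⟨S, f, hc, hinj, hlt, hst⟩ := ih (by omega)
      let W : Submodule k (Fin n → k) :=
        { carrier := {v | ∀ i ∉ S, v i = 0}
          zero_mem' := fun _ _ => rfl
          add_mem' := fun ha hb i hi => by rw [Pi.add_apply, ha i hi, hb i hi, add_zero]
          smul_mem' := fun c a ha i hi => by rw [Pi.smul_apply, ha i hi, smul_zero] }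
      have hW : W ≠ ⊤ := by
        obtain ⟨i, hi⟩ : ∃ i, i ∉ S := by
          by_contra! h
          rw [Finset.eq_univ_of_forall h, Finset.card_univ, Fintype.card_fin] at hc
          omega
        intro h
        have h1 : (fun _ => 1 : Fin n → k) ∈ W := h ▸ trivial
        exact one_ne_zero (h1 i hi)
      obtain ⟨v, hvW, hv⟩ := exists_eigenvector_mod_of_isSolvable hH hs hW (by
        intro h hh w hw i hi
        change ∑ j, h.1 i j * w j = 0
        refine Finset.sum_eq_zero fun j _ => ?_
        by_cases hj : j ∈ S
        · by_contra h0
          exact hi (hst h hh j hj i (left_ne_zero_of_mul h0)).1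
        · rw [hw j hj, mul_zero])
      obtain ⟨i₀, hi₀, hvi₀⟩ : ∃ i ∉ S, v i ≠ 0 := by
        by_contra! h
        exact hvW h
      -- Test with the diagonal matrix having 1 at i₀ and t ≠ 1 elsewhere: the coordinate at i₀
      -- forces the eigenvalue 1, and this kills every other coordinate outside S.
      have hvi : ∀ i ∉ S, i ≠ i₀ → v i = 0 := by
        intro i hi hne
        obtain ⟨t, ht⟩ := exists_ne_zero_and_ne_one k
        let d : Fin n → kˣ := fun j => if j = i₀ then 1 else Units.mk0 t ht.1
        obtain ⟨c, hc⟩ := hv (diagGL d) (hD (diagGL_mem_patternGroup _ _ _ d))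
        have h1 : ∀ j ∉ S, (d j : k) * v j - c * v j = 0 := fun j hj => by
          have := hc j hj
          rwa [Pi.sub_apply, Pi.smul_apply, smul_eq_mul, diagGL, Matrix.mulVec_diagonal] at this
        have h2 := h1 i₀ hi₀
        have h3 := h1 i hi
        simp only [d, if_true, Units.val_one, if_neg hne, Units.val_mk0, ← sub_mul] at h2 h3
        have hc1 : c = 1 := (sub_eq_zero.1 ((mul_eq_zero.1 h2).resolve_right hvi₀)).symm
        rw [hc1] at h3
        exact (mul_eq_zero.1 h3).resolve_left fun h => ht.2 (sub_eq_zero.1 h)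
      refine ⟨insert i₀ S, fun i => if i = i₀ then m else f i, ?_, ?_, ?_, ?_⟩
      · rw [Finset.card_insert_of_notMem hi₀, hc]
      · intro i hi j hj hij
        simp only [Finset.coe_insert, Set.mem_insert_iff, Finset.mem_coe] at hi hj
        dsimp only at hij
        split_ifs at hij with h1 h2 h2
        · rw [h1, h2]
        · have := hlt j (hj.resolve_left h2)
          omega
        · have := hlt i (hi.resolve_left h1)
          omega
        · exact hinj (hi.resolve_left h1) (hj.resolve_left h2) hij
      · intro i hi
        dsimp only
        split_ifs with h1
        · omega
        · have := hlt i (Finset.mem_of_mem_insert_of_ne hi h1)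
          omega
      · intro h hh j hj i hij
        dsimp only
        by_cases hj0 : j = i₀
        · subst hj0
          have hi : i ∈ insert j S := by
            by_contra hi
            rw [Finset.mem_insert, not_or] at hi
            obtain ⟨c, hc⟩ := hv h hh
            have h1 := hc i hi.2
            rw [Pi.sub_apply, Pi.smul_apply, hvi i hi.2 hi.1, smul_zero, sub_zero,
              Matrix.mulVec, dotProduct, Finset.sum_eq_single j] at h1
            · exact (mul_ne_zero hij hvi₀) h1
            · intro l _ hl
              by_cases hlS : l ∈ S
              · by_contra h0
                exact hi.2 (hst h hh l hlS i (left_ne_zero_of_mul h0)).1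
              · rw [hvi l hlS hl, mul_zero]
            · exact fun h => absurd (Finset.mem_univ j) h
          refine ⟨hi, ?_⟩
          rw [if_pos rfl]
          split_ifs with h1
          · exact le_rfl
          · exact (hlt i (Finset.mem_of_mem_insert_of_ne hi h1)).le
        · have hjS := Finset.mem_of_mem_insert_of_ne hj hj0
          have h1 := hst h hh j hjS i hij
          have hne : i ≠ i₀ := fun h => hi₀ (h ▸ h1.1)
          exact ⟨Finset.mem_insert_of_mem h1.1, by rw [if_neg hne, if_neg hj0]; exact h1.2⟩
  obtain ⟨S, f, hc, hinj, -, hst⟩ := key n le_rfl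
  have hS : S = Finset.univ := Finset.eq_univ_of_card S (by simpa using hc)
  subst hS
  exact ⟨f, fun i j h => hinj (Finset.mem_coe.2 (Finset.mem_univ i))
    (Finset.mem_coe.2 (Finset.mem_univ j)) h, fun h hh i j hij => (hst h hh j (Finset.mem_univ j) i hij).2⟩

theorem exists_eq_flagGroup [IsAlgClosed k] {B : Subgroup (GL (Fin n) k)} (hB : IsBorel B)
    (hD : diagGroup n k ≤ B) : ∃ f : Fin n → ℕ, Function.Injective f ∧ B = flagGroup k f := by
  have : Infinite k := IsAlgClosed.instInfinite
  obtain ⟨f, hf, hle⟩ := exists_le_flagGroup hB.1.1 hB.1.2 hD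
  exact ⟨f, hf, le_antisymm hle (hB.2 ⟨isClosedConnected_patternGroup _ _ _,
    isSolvable_flagGroup hf⟩ hle)⟩

/-- The elementary matrix `1 + E_{ij}`. -/
theorem exists_transvection_mem_flagGroup {f : Fin n → ℕ} {i j : Fin n} (hij : i ≠ j)
    (hf : f i ≤ f j) : ∃ g ∈ flagGroup k f, g.1 = 1 + Matrix.single i j 1 := by
  have h : (1 + Matrix.single i j (1 : k)).det ≠ 0 := by
    rw [← Matrix.transvection, Matrix.det_transvection_of_ne _ _ hij]
    exact one_ne_zero
  refine ⟨Matrix.GeneralLinearGroup.mkOfDetNeZero _ h, ?_, rfl⟩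
  intro a b hab
  change (1 + Matrix.single i j (1 : k)) a b ≠ 0 at hab
  by_cases h1 : a = b
  · exact h1 ▸ le_rfl
  · rw [Matrix.add_apply, Matrix.one_apply_ne h1, zero_add, Matrix.single_apply] at hab
    obtain ⟨rfl, rfl⟩ := (ite_ne_right_iff.1 hab).1
    exact hf

/-- A larger closed connected solvable group lies in some `flagGroup k f`. An entry of it below the
diagonal at (i, j) gives f i ≤ f j, and the upper transvection at (j, i) gives the opposite
inequality, contradicting injectivity of f. -/
theorem isBorel_flagGroup_val [IsAlgClosed k] : IsBorel (flagGroup k fun i : Fin n => i.val) := by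
  have : Infinite k := IsAlgClosed.instInfinite
  refine ⟨⟨isClosedConnected_patternGroup _ _ _, isSolvable_flagGroup Fin.val_injective⟩, ?_⟩
  intro H hH hle
  obtain ⟨f, hf, hHf⟩ := exists_le_flagGroup hH.1 hH.2 ((diagGroup_le_flagGroup _).trans hle)
  refine hHf.trans fun g hg i j hij => ?_
  by_contra! hlt
  have h1 := hg i j hij
  have hne : j ≠ i := fun h => by rw [h] at hlt; exact lt_irrefl _ hlt
  obtain ⟨t, ht, hte⟩ := exists_transvection_mem_flagGroup (k := k)
    (f := fun i : Fin n => i.val) hne hlt.le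
  have h2 := hHf (hle ht) j i (by rw [hte]; simp [hne])
  exact hne (hf (le_antisymm h2 h1))

/-- A torus is commutative, so a torus containing all diagonal matrices commutes with them; one with
distinct entries at i and j kills the entry (i, j). -/
theorem isMaximalTorus_diagGroup [Infinite k] : IsMaximalTorus (diagGroup n k) := by
  refine ⟨isTorus_diagGroup, fun T hT hle => ?_⟩
  obtain ⟨x, hx⟩ := hT.2
  intro g hg i j hij
  by_contra hne
  obtain ⟨t, ht⟩ := exists_ne_zero_and_ne_one k
  let d : Fin n → kˣ := fun j => if j = i then 1 else Units.mk0 t ht.1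
  have hcomm : ∀ a ∈ T, ∀ b ∈ T, a * b = b * a := by
    intro a ha b hb
    have h1 : (x * a * x⁻¹) * (x * b * x⁻¹) = (x * b * x⁻¹) * (x * a * x⁻¹) := by
      apply Units.ext
      rw [Units.val_mul (x * a * x⁻¹), Units.val_mul (x * b * x⁻¹), ← (hx a ha).diagonal_diag,
        ← (hx b hb).diagonal_diag,
        Matrix.diagonal_mul_diagonal, Matrix.diagonal_mul_diagonal]
      simp only [mul_comm]
    have h2 : x * (a * b) * x⁻¹ = x * (b * a) * x⁻¹ := by
      rw [show x * (a * b) * x⁻¹ = (x * a * x⁻¹) * (x * b * x⁻¹) by group, h1]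
      group
    exact mul_left_cancel (mul_right_cancel h2)
  have h1 := congrArg (fun y : GL (Fin n) k => y.1 i j)
    (hcomm g hg (diagGL d) (hle (diagGL_mem_patternGroup _ _ _ d)))
  simp only [Units.val_mul, diagGL, Matrix.mul_diagonal, Matrix.diagonal_mul, d, if_true,
    Units.val_one, one_mul, if_neg (Ne.symm hne), Units.val_mk0] at h1
  exact ht.2 (mul_left_cancel₀ hij (by rw [h1, mul_one]))

end Flags

/-! ### Reduction of quasi-semi-simple elements to the diagonal torus -/

section Theta

variable {n : ℕ} {k : Type*} [Field k]

/-- The entries of the matrix `𝒥` on the antidiagonal. -/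
def gramSign (n : ℕ) (k : Type*) [Field k] (i : Fin n) : kˣ :=
  if Even n then (if i.val < (n + 1) / 2 then 1 else -1) else 1

theorem gram_standard_apply (i j : Fin n) :
    (gram n k .standard).1 i j = if i = Fin.rev j then (gramSign n k i : k) else 0 := by
  have h : (signElt n k).1 = Matrix.diagonal fun i => (gramSign n k i : k) := by
    unfold signElt gramSign
    by_cases hn : Even n
    · simp only [if_pos hn]
      rfl
    · simp only [if_neg hn, Units.val_one]
      exact Matrix.diagonal_one.symm
  rw [gram, Units.val_mul, h, Matrix.diagonal_mul]
  simp [antiDiag]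

theorem diagGL_mul_gram_apply (d : Fin n → kˣ) (i j : Fin n) :
    form (diagGL d) i j = if i = Fin.rev j then (d i * gramSign n k i : k) else 0 := by
  rw [form, Units.val_mul, diagGL, Matrix.diagonal_mul, gram_standard_apply]
  simp

/-- Since 𝒥 is monomial on the antidiagonal, the (i, j) entry of θ(g) is a non-zero multiple of the
(rev j, rev i) entry of g⁻¹. Zero patterns invariant under this reversal are preserved by θ. -/
theorem inv_apply_ne_zero_of_theta {g : GL (Fin n) k} {i j : Fin n} (h : (theta g).1 i j ≠ 0) :
    (g⁻¹).1 (Fin.rev j) (Fin.rev i) ≠ 0 := by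
  have h1 : theta g * gram n k .standard = gram n k .standard * transInv g := by
    change gram n k .standard * transInv g * (gram n k .standard)⁻¹ * _ = _
    group
  have h2 := congrArg (fun x : GL (Fin n) k => x.1 i (Fin.rev j)) h1
  simp only [Units.val_mul, Matrix.mul_apply, gram_standard_apply, Fin.rev_rev] at h2
  rw [Finset.sum_eq_single j (fun l _ hl => by rw [if_neg hl, mul_zero])
    (fun h => absurd (Finset.mem_univ j) h), if_pos rfl,
    Finset.sum_eq_single (Fin.rev i) (fun l _ hl => by
      rw [if_neg (fun h => hl (by rw [h, Fin.rev_rev])), zero_mul])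
    (fun h => absurd (Finset.mem_univ _) h), if_pos (Fin.rev_rev i).symm] at h2
  intro h0
  have h3 : (transInv g).1 (Fin.rev i) (Fin.rev j) = 0 := h0
  rw [h3, mul_zero] at h2
  exact (mul_ne_zero h (Units.ne_zero _)) h2

theorem theta_mem_flagGroup {g : GL (Fin n) k} (hg : g ∈ flagGroup k fun i : Fin n => i.val) :
    theta g ∈ flagGroup k fun i : Fin n => i.val := by
  intro i j hij
  have h := inv_mem hg _ _ (inv_apply_ne_zero_of_theta hij)
  simp only [Fin.val_rev] at h
  have := i.isLt
  dsimp only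
  omega

theorem theta_mem_diagGroup {g : GL (Fin n) k} (hg : g ∈ diagGroup n k) :
    theta g ∈ diagGroup n k := fun _ _ hij =>
  (Fin.rev_injective (inv_mem hg _ _ (inv_apply_ne_zero_of_theta hij))).symm

theorem theta_theta (g : GL (Fin n) k) : theta (theta g) = g := by
  rw [← MulAut.mul_apply, extAut_mul_self, MulAut.one_apply]

theorem map_incl_map_conj_eq_iff (κ : Kind) (g : GL (Fin n) k) (B : Subgroup (GL (Fin n) k)) :
    (B.map incl).map (MulAut.conj (incl g * sig κ)).toMonoidHom = B.map incl ↔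
      B.map (MulAut.conj g * theta).toMonoidHom = B := by
  rw [Subgroup.map_map]
  have h : (MulAut.conj (incl g * sig κ : Bar n k κ)).toMonoidHom.comp incl =
      incl.comp (MulAut.conj g * theta).toMonoidHom := by
    ext1 b
    exact incl_mul_sig_conj κ g b
  rw [h, ← Subgroup.map_map]
  exact (Subgroup.map_injective (f := (incl : GL (Fin n) k →* Bar n k κ))
    SemidirectProduct.inl_injective).eq_iff

theorem isQuasiSemisimple_iff (κ : Kind) (g : GL (Fin n) k) :
    IsQuasiSemisimple (incl g * sig κ : Bar n k κ) ↔
      ∃ T B : Subgroup (GL (Fin n) k), IsMaximalTorus T ∧ IsBorel B ∧ T ≤ B ∧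
        T.map (MulAut.conj g * theta).toMonoidHom = T ∧
        B.map (MulAut.conj g * theta).toMonoidHom = B := by
  simp only [IsQuasiSemisimple, map_incl_map_conj_eq_iff]

theorem map_conj_theta_conj (h g : GL (Fin n) k) {B : Subgroup (GL (Fin n) k)}
    (hB : B.map (MulAut.conj g * theta).toMonoidHom = B) :
    (B.map (MulAut.conj h).toMonoidHom).map
      (MulAut.conj (h * g * (theta h)⁻¹) * theta).toMonoidHom =
      B.map (MulAut.conj h).toMonoidHom := by
  conv_rhs => rw [← hB]
  rw [Subgroup.map_map, Subgroup.map_map]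
  congr 1
  ext1 b
  change h * g * (theta h)⁻¹ * theta (h * b * h⁻¹) * (h * g * (theta h)⁻¹)⁻¹ =
    h * (g * theta b * g⁻¹) * h⁻¹
  rw [map_mul, map_mul, map_inv]
  group

theorem isQuasiSemisimple_conj (κ : Kind) (h g : GL (Fin n) k)
    (hg : IsQuasiSemisimple (incl g * sig κ : Bar n k κ)) :
    IsQuasiSemisimple (incl (h * g * (theta h)⁻¹) * sig κ : Bar n k κ) := by
  rw [isQuasiSemisimple_iff] at hg ⊢
  obtain ⟨T, B, hT, hB, hle, hgT, hgB⟩ := hg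
  exact ⟨_, _, hT.map_conj h, hB.map_conj h, Subgroup.map_mono hle,
    map_conj_theta_conj h g hgT, map_conj_theta_conj h g hgB⟩

theorem isQuasiSemisimple_diagGL [IsAlgClosed k] (κ : Kind) (d : Fin n → kˣ) :
    IsQuasiSemisimple (incl (diagGL d) * sig κ : Bar n k κ) := by
  have : Infinite k := IsAlgClosed.instInfinite
  rw [isQuasiSemisimple_iff]
  refine ⟨diagGroup n k, flagGroup k fun i => i.val, isMaximalTorus_diagGroup,
    isBorel_flagGroup_val, diagGroup_le_flagGroup _, ?_, ?_⟩
  all_goals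
    refine le_antisymm (Subgroup.map_le_iff_le_comap.2 fun b hb => ?_) fun b hb => ?_
  · have hd : diagGL d ∈ diagGroup n k := diagGL_mem_patternGroup _ _ _ d
    exact mul_mem (mul_mem hd (theta_mem_diagGroup hb)) (inv_mem hd)
  · have hd : diagGL d ∈ diagGroup n k := diagGL_mem_patternGroup _ _ _ d
    refine ⟨theta ((diagGL d)⁻¹ * b * diagGL d),
      theta_mem_diagGroup (mul_mem (mul_mem (inv_mem hd) hb) hd), ?_⟩
    change diagGL d * theta (theta _) * (diagGL d)⁻¹ = b
    rw [theta_theta]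
    group
  · have hd : diagGL d ∈ flagGroup k fun i : Fin n => i.val := diagGL_mem_patternGroup _ _ _ d
    exact mul_mem (mul_mem hd (theta_mem_flagGroup hb)) (inv_mem hd)
  · have hd : diagGL d ∈ flagGroup k fun i : Fin n => i.val := diagGL_mem_patternGroup _ _ _ d
    refine ⟨theta ((diagGL d)⁻¹ * b * diagGL d),
      theta_mem_flagGroup (mul_mem (mul_mem (inv_mem hd) hb) hd), ?_⟩
    change diagGL d * theta (theta _) * (diagGL d)⁻¹ = b
    rw [theta_theta]
    group

/-- The permutation matrices act on the coordinates. -/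
theorem exists_perm_matrix (e : Equiv.Perm (Fin n)) : ∃ p : GL (Fin n) k,
    ∀ (g : GL (Fin n) k) (i j : Fin n), (p * g * p⁻¹).1 i j = g.1 (e i) (e j) := by
  refine ⟨⟨(Equiv.toPEquiv e).toMatrix, (Equiv.toPEquiv e.symm).toMatrix, ?_, ?_⟩, ?_⟩
  · rw [← PEquiv.toMatrix_trans, ← Equiv.toPEquiv_trans]
    simp
  · rw [← PEquiv.toMatrix_trans, ← Equiv.toPEquiv_trans]
    simp
  · intro g i j
    change ((Equiv.toPEquiv e).toMatrix * g.1 * (Equiv.toPEquiv e.symm).toMatrix :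
      Matrix (Fin n) (Fin n) k) i j = _
    rw [PEquiv.toMatrix_toPEquiv_mul, PEquiv.mul_toMatrix_toPEquiv]
    simp

theorem exists_flag_perm {f : Fin n → ℕ} (hf : Function.Injective f) :
    ∃ p : GL (Fin n) k,
      (diagGroup n k).map (MulAut.conj p).toMonoidHom = diagGroup n k ∧
      (flagGroup k f).map (MulAut.conj p).toMonoidHom = flagGroup k fun i : Fin n => i.val := by
  let e : Equiv.Perm (Fin n) := Tuple.sort f
  have he : StrictMono (f ∘ e) :=
    (Tuple.monotone_sort f).strictMono_of_injective (hf.comp e.injective)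
  obtain ⟨p, hp⟩ := exists_perm_matrix (k := k) e
  have hinv : ∀ g, p * (p⁻¹ * g * p) * p⁻¹ = g := fun g => by group
  have hle : ∀ i j : Fin n, f (e i) ≤ f (e j) ↔ i ≤ j := fun i j => he.le_iff_le
  refine ⟨p, ?_, ?_⟩
  · refine le_antisymm (Subgroup.map_le_iff_le_comap.2 fun b hb => ?_) fun b hb => ?_
    · intro i j hij
      exact e.injective (hb _ _ ((hp b i j) ▸ hij))
    · refine ⟨p⁻¹ * b * p, fun i j hij => ?_, hinv b⟩
      have h := hp (p⁻¹ * b * p) (e.symm i) (e.symm j)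
      rw [hinv, e.apply_symm_apply, e.apply_symm_apply] at h
      exact e.symm.injective (hb _ _ (h ▸ hij))
  · refine le_antisymm (Subgroup.map_le_iff_le_comap.2 fun b hb => ?_) fun b hb => ?_
    · intro i j hij
      exact (hle i j).1 (hb _ _ ((hp b i j) ▸ hij))
    · refine ⟨p⁻¹ * b * p, fun i j hij => ?_, hinv b⟩
      have h := hp (p⁻¹ * b * p) (e.symm i) (e.symm j)
      rw [hinv, e.apply_symm_apply, e.apply_symm_apply] at h
      have h2 := (hle _ _).2 (hb _ _ (h ▸ hij))
      rwa [e.apply_symm_apply, e.apply_symm_apply] at h2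

/-- Normalising the torus makes g monomial. Conjugating transvections into upper triangular matrices
makes its permutation increasing, and the only increasing permutation is the identity. -/
theorem mem_diagGroup_of_normalizes [Infinite k] {g : GL (Fin n) k}
    (hD : ∀ d ∈ diagGroup n k, g * d * g⁻¹ ∈ diagGroup n k)
    (hU : ∀ u ∈ flagGroup k (fun i : Fin n => i.val),
      g * u * g⁻¹ ∈ flagGroup k fun i : Fin n => i.val) : g ∈ diagGroup n k := by
  have hrow : ∀ i j j', g.1 i j ≠ 0 → g.1 i j' ≠ 0 → j = j' := by
    intro i j j' hj hj'
    by_contra hne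
    obtain ⟨t, ht⟩ := exists_ne_zero_and_ne_one k
    let d : Fin n → kˣ := fun l => if l = j then 1 else Units.mk0 t ht.1
    obtain ⟨c, hc⟩ := exists_eq_diagGL (hD (diagGL d) (diagGL_mem_patternGroup _ _ _ d))
    have h1 : g * diagGL d = diagGL c * g := by rw [← hc]; group
    have h2 : ∀ l, g.1 i l * d l = c i * g.1 i l := fun l => by
      have := congrArg (fun x : GL (Fin n) k => x.1 i l) h1
      simpa only [Units.val_mul, diagGL, Matrix.mul_diagonal, Matrix.diagonal_mul] using this
    have h3 := h2 j
    have h4 := h2 j'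
    simp only [d, if_true, Units.val_one, if_neg (Ne.symm hne), Units.val_mk0] at h3 h4
    rw [mul_comm] at h3 h4
    rw [← mul_right_cancel₀ hj h3] at h4
    exact ht.2 (mul_right_cancel₀ hj' h4)
  have hex : ∀ i, ∃ j, g.1 i j ≠ 0 := by
    intro i
    by_contra! h
    exact (Matrix.isUnits_det_units g).ne_zero (Matrix.det_eq_zero_of_row_eq_zero i h)
  choose w hw using hex
  have hw' : ∀ i j, g.1 i j ≠ 0 → j = w i := fun i j h => hrow i j _ h (hw i)
  have hwinj : Function.Injective w := by
    intro i j hij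
    by_contra hne
    obtain ⟨l, hl⟩ : ∃ l, ∀ i, w i ≠ l := by
      by_contra! h
      exact hne ((Finite.injective_iff_surjective.2 h) hij)
    exact (Matrix.isUnits_det_units g).ne_zero (Matrix.det_eq_zero_of_column_eq_zero l fun i => by
      by_contra h
      exact hl i (hw' i l h).symm)
  have hwmono : ∀ i j, w i < w j → i < j := by
    intro i j hij
    obtain ⟨u, hu, hue⟩ := exists_transvection_mem_flagGroup (k := k)
      (f := fun i : Fin n => i.val) hij.ne (le_of_lt hij)
    have h1 : g * u = (g * u * g⁻¹) * g := by group
    have h2 := congrArg (fun x : GL (Fin n) k => x.1 i (w j)) h1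
    simp only [Units.val_mul _ g, Units.val_mul g u, hue, mul_add, mul_one, Matrix.add_apply] at h2
    rw [Matrix.mul_single_apply_same, mul_one] at h2
    have h3 : g.1 i (w j) = 0 := by
      by_contra h
      exact hij.ne' (hw' _ _ h)
    rw [h3, zero_add, Matrix.mul_apply, Finset.sum_eq_single j (fun l _ hl => by
      have : g.1 l (w j) = 0 := by
        by_contra h
        exact hl (hwinj (hw' _ _ h)).symm
      rw [this, mul_zero]) (fun h => absurd (Finset.mem_univ j) h)] at h2
    have h4 := hU u hu i j (left_ne_zero_of_mul (h2 ▸ hw i))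
    refine lt_of_le_of_ne h4 fun h => ?_
    rw [h] at hij
    exact lt_irrefl _ hij
  have hmono : StrictMono w := by
    intro i j hij
    rcases lt_trichotomy (w i) (w j) with h | h | h
    · exact h
    · exact absurd (hwinj h) hij.ne
    · exact absurd (hwmono _ _ h) hij.asymm
  have hid : ∀ i, w i = i := by
    have : Set.range w = Set.range (id : Fin n → Fin n) := by
      rw [Set.range_id]
      exact (Finite.injective_iff_surjective.1 hwinj).range_eq
    have h := (StrictMono.range_inj hmono strictMono_id).1 this
    exact fun i => congrFun h i
  intro i j hij
  rw [hw' i j hij, hid]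

/-- A quasi-semi-simple element of `GL_n(k)σ` is conjugate to an element of `Tσ`, where `T` is the
diagonal torus. -/
theorem isQuasiSemisimple_iff_exists_diagGL [IsAlgClosed k] (κ : Kind) (g : GL (Fin n) k) :
    IsQuasiSemisimple (incl g * sig κ : Bar n k κ) ↔
      ∃ (h : GL (Fin n) k) (d : Fin n → kˣ), h * g * (theta h)⁻¹ = diagGL d := by
  have : Infinite k := IsAlgClosed.instInfinite
  constructor
  · intro hg
    rw [isQuasiSemisimple_iff] at hg
    obtain ⟨T, B, hT, hB, hle, hgT, hgB⟩ := hg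
    obtain ⟨x, hx⟩ := hT.1.2
    have hTx : T.map (MulAut.conj x).toMonoidHom = diagGroup n k := by
      have h1 : T.map (MulAut.conj x).toMonoidHom ≤ diagGroup n k := by
        refine Subgroup.map_le_iff_le_comap.2 fun t ht i j hij => ?_
        by_contra hne
        exact hij (hx t ht hne)
      exact le_antisymm h1 ((hT.map_conj x).2 isTorus_diagGroup h1)
    obtain ⟨f, hf, hBf⟩ := exists_eq_flagGroup (hB.map_conj x) (hTx ▸ Subgroup.map_mono hle)
    have hgT' := map_conj_theta_conj x g hgT
    have hgB' := map_conj_theta_conj x g hgB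
    rw [hTx] at hgT'
    rw [hBf] at hgB'
    obtain ⟨p, hpD, hpB⟩ := exists_flag_perm (k := k) hf
    have hgT'' := map_conj_theta_conj p _ hgT'
    have hgB'' := map_conj_theta_conj p _ hgB'
    rw [hpD] at hgT''
    rw [hpB] at hgB''
    set g' := p * (x * g * (theta x)⁻¹) * (theta p)⁻¹ with hg'
    -- Since θ is an involution stabilising the standard pair, stability under g'σ means that g'
    -- itself normalises the pair.
    obtain ⟨d, hd⟩ := exists_eq_diagGL (mem_diagGroup_of_normalizes (g := g')
      (fun d hd => by
        rw [← hgT'']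
        exact ⟨theta d, theta_mem_diagGroup hd, by
          change g' * theta (theta d) * g'⁻¹ = _
          rw [theta_theta]⟩)
      (fun d hd => by
        rw [← hgB'']
        exact ⟨theta d, theta_mem_flagGroup hd, by
          change g' * theta (theta d) * g'⁻¹ = _
          rw [theta_theta]⟩))
    refine ⟨p * x, d, ?_⟩
    rw [← hd, hg', map_mul]
    group
  · rintro ⟨h, d, hd⟩
    have h1 := isQuasiSemisimple_conj κ h⁻¹ _ (isQuasiSemisimple_diagGL κ d)
    rw [← hd, map_inv] at h1
    convert h1 using 3
    group

end Theta

/-! ### Congruence of forms and orthogonal decompositions -/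

section Congruence

variable {ι κ μ F : Type*} [Fintype ι] [DecidableEq ι] [Fintype κ] [DecidableEq κ]
  [Fintype μ] [DecidableEq μ] [Field F]

/-- Congruence of the matrices of two bilinear forms, whose index sets may be different. -/
def Congr (A : Matrix ι ι F) (B : Matrix κ κ F) : Prop :=
  ∃ (h : Matrix ι κ F) (g : Matrix κ ι F), g * h = 1 ∧ h * g = 1 ∧ B = hᵀ * A * h

theorem Congr.symm {A : Matrix ι ι F} {B : Matrix κ κ F} (hAB : Congr A B) : Congr B A := by
  obtain ⟨h, g, hgh, hhg, rfl⟩ := hAB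
  refine ⟨g, h, hhg, hgh, ?_⟩
  have h1 : gᵀ * hᵀ = 1 := by rw [← Matrix.transpose_mul, hhg, Matrix.transpose_one]
  calc A = (gᵀ * hᵀ) * A * (h * g) := by rw [h1, hhg, one_mul, mul_one]
    _ = _ := by simp only [Matrix.mul_assoc]

theorem Congr.trans {A : Matrix ι ι F} {B : Matrix κ κ F} {C : Matrix μ μ F} (hAB : Congr A B)
    (hBC : Congr B C) : Congr A C := by
  obtain ⟨h, g, hgh, hhg, rfl⟩ := hAB
  obtain ⟨h', g', hgh', hhg', rfl⟩ := hBC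
  refine ⟨h * h', g' * g, ?_, ?_, ?_⟩
  · rw [Matrix.mul_assoc, ← Matrix.mul_assoc g, hgh, Matrix.one_mul, hgh']
  · rw [Matrix.mul_assoc, ← Matrix.mul_assoc h', hhg', Matrix.one_mul, hhg]
  · rw [Matrix.transpose_mul]
    simp only [Matrix.mul_assoc]

theorem congr_of_transpose_mul_mul {A B X : Matrix ι ι F} (hB : IsUnit B.det)
    (h : Xᵀ * A * X = B) : Congr A B := by
  have hX : IsUnit X.det := by
    rw [← h, Matrix.det_mul] at hB
    exact isUnit_of_mul_isUnit_right hB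
  exact ⟨X, X⁻¹, Matrix.nonsing_inv_mul X hX, Matrix.mul_nonsing_inv X hX, h.symm⟩

theorem Congr.fromBlocks {A : Matrix ι ι F} {A' : Matrix κ κ F} {ι' κ' : Type*} [Fintype ι']
    [DecidableEq ι'] [Fintype κ'] [DecidableEq κ'] {B : Matrix ι' ι' F} {B' : Matrix κ' κ' F}
    (hA : Congr A A') (hB : Congr B B') :
    Congr (Matrix.fromBlocks A 0 0 B) (Matrix.fromBlocks A' 0 0 B') := by
  obtain ⟨h, g, hgh, hhg, rfl⟩ := hA
  obtain ⟨h', g', hgh', hhg', rfl⟩ := hB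
  refine ⟨Matrix.fromBlocks h 0 0 h', Matrix.fromBlocks g 0 0 g', ?_, ?_, ?_⟩
  · simp [Matrix.fromBlocks_multiply, hgh, hgh']
  · simp [Matrix.fromBlocks_multiply, hhg, hhg']
  · simp [Matrix.fromBlocks_multiply, Matrix.fromBlocks_transpose]

theorem Congr.exists_det_eq {A : Matrix ι ι F} {B : Matrix κ κ F} (hAB : Congr A B) :
    ∃ c : F, c ≠ 0 ∧ B.det = c ^ 2 * A.det := by
  obtain ⟨h, g, hgh, hhg, rfl⟩ := hAB
  have e : ι ≃ κ := Fintype.equivOfCardEq (Matrix.square_of_invertible h g hhg hgh)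
  have h1 : (g.submatrix e id) * (h.submatrix id e) = 1 := by
    have := Matrix.submatrix_mul_equiv g h e (Equiv.refl ι) e
    rw [hgh, Matrix.submatrix_one_equiv] at this
    exact this
  refine ⟨(h.submatrix id e).det, ?_, ?_⟩
  · intro h0
    have := congrArg Matrix.det h1
    rw [Matrix.det_mul, h0, mul_zero, Matrix.det_one] at this
    exact zero_ne_one this
  · have h2 : (hᵀ * A * h).submatrix e e =
        (h.submatrix id e)ᵀ * A * (h.submatrix id e) := by
      rw [Matrix.transpose_submatrix]
      ext i j
      simp [Matrix.mul_apply, Matrix.submatrix_apply]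
    rw [← Matrix.det_submatrix_equiv_self e, h2, Matrix.det_mul, Matrix.det_mul,
      Matrix.det_transpose]
    ring

theorem Congr.isUnit_det_iff {A : Matrix ι ι F} {B : Matrix κ κ F} (hAB : Congr A B) :
    IsUnit B.det ↔ IsUnit A.det := by
  obtain ⟨c, hc, h⟩ := hAB.exists_det_eq
  rw [h, isUnit_iff_ne_zero, isUnit_iff_ne_zero, mul_ne_zero_iff]
  exact and_iff_right (pow_ne_zero 2 hc)

/-- An idempotent matrix factors through its range. -/
theorem exists_factorization_of_idempotent {P : Matrix ι ι F} (hP : P * P = P) :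
    ∃ (a : ℕ) (N : Matrix ι (Fin a) F) (L : Matrix (Fin a) ι F), L * N = 1 ∧ N * L = P := by
  let f := Matrix.toLin' P
  have hf : ∀ v, f (f v) = f v := fun v => by
    rw [← LinearMap.comp_apply, ← Matrix.toLin'_mul, hP]
  let b := Module.finBasis F (LinearMap.range f)
  refine ⟨_, LinearMap.toMatrix' ((LinearMap.range f).subtype ∘ₗ b.equivFun.symm.toLinearMap),
    LinearMap.toMatrix' (b.equivFun.toLinearMap ∘ₗ f.rangeRestrict), ?_, ?_⟩
  · rw [← LinearMap.toMatrix'_comp, ← LinearMap.toMatrix'_one]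
    congr 1
    apply LinearMap.ext
    intro v
    change b.equivFun (f.rangeRestrict (b.equivFun.symm v).1) = v
    have : f.rangeRestrict (b.equivFun.symm v).1 = b.equivFun.symm v := by
      obtain ⟨w, hw⟩ := (b.equivFun.symm v).2
      apply Subtype.ext
      change f _ = _
      rw [← hw, hf]
    rw [this, LinearEquiv.apply_symm_apply]
  · rw [← LinearMap.toMatrix'_comp, ← LinearMap.toMatrix'_toLin' P]
    congr 1
    apply LinearMap.ext
    intro v
    change (b.equivFun.symm (b.equivFun (f.rangeRestrict v))).1 = f v
    rw [LinearEquiv.symm_apply_apply]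
    rfl

/-- The image and the kernel of P are orthogonal to each other on both sides; the columns of N and
N' are bases of the two spaces, and L and L' give the coordinates. -/
theorem congr_fromBlocks_of_idempotent {A P : Matrix ι ι F} (hP : P * P = P)
    (h1 : Pᵀ * A * (1 - P) = 0) (h2 : (1 - P)ᵀ * A * P = 0)
    {N : Matrix ι κ F} {L : Matrix κ ι F} {N' : Matrix ι μ F} {L' : Matrix μ ι F}
    (hLN : L * N = 1) (hNL : N * L = P) (hLN' : L' * N' = 1) (hNL' : N' * L' = 1 - P) :
    Congr A (Matrix.fromBlocks (Nᵀ * A * N) 0 0 (N'ᵀ * A * N')) := by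
  have hPN : P * N = N := by rw [← hNL, Matrix.mul_assoc, hLN, Matrix.mul_one]
  have hPN' : (1 - P) * N' = N' := by rw [← hNL', Matrix.mul_assoc, hLN', Matrix.mul_one]
  have hLP : L * P = L := by rw [← hNL, ← Matrix.mul_assoc, hLN, Matrix.one_mul]
  have hLP' : L' * (1 - P) = L' := by rw [← hNL', ← Matrix.mul_assoc, hLN', Matrix.one_mul]
  have hPP : P * (1 - P) = 0 := by rw [mul_sub, mul_one, hP, sub_self]
  have hPP' : (1 - P) * P = 0 := by rw [sub_mul, one_mul, hP, sub_self]
  have e1 : L * N' = 0 := by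
    rw [← hLP, ← hPN', Matrix.mul_assoc, ← Matrix.mul_assoc P, hPP, Matrix.zero_mul,
      Matrix.mul_zero]
  have e2 : L' * N = 0 := by
    rw [← hLP', ← hPN, Matrix.mul_assoc, ← Matrix.mul_assoc (1 - P), hPP', Matrix.zero_mul,
      Matrix.mul_zero]
  have e3 : Nᵀ * A * N' = 0 := by
    have : Nᵀ * A * N' = Nᵀ * (Pᵀ * A * (1 - P)) * N' := by
      conv_lhs => rw [← hPN, ← hPN', Matrix.transpose_mul]
      simp only [Matrix.mul_assoc]
    rw [this, h1, Matrix.mul_zero, Matrix.zero_mul]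
  have e4 : N'ᵀ * A * N = 0 := by
    have : N'ᵀ * A * N = N'ᵀ * ((1 - P)ᵀ * A * P) * N := by
      conv_lhs => rw [← hPN, ← hPN', Matrix.transpose_mul]
      simp only [Matrix.mul_assoc]
    rw [this, h2, Matrix.mul_zero, Matrix.zero_mul]
  refine ⟨Matrix.fromCols N N', Matrix.fromRows L L', ?_, ?_, ?_⟩
  · rw [Matrix.fromRows_mul_fromCols, hLN, hLN', e1, e2, Matrix.fromBlocks_one]
  · rw [Matrix.fromCols_mul_fromRows, hNL, hNL', add_sub_cancel]
  · rw [Matrix.transpose_fromCols, Matrix.fromRows_mul, Matrix.fromRows_mul_fromCols, e3, e4]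

end Congruence

/-! ### A norm equation in an Artinian ring -/

section SquareRoots

/-- Modulo the nilradical E is the product of its residue fields, so the local solutions glue and
lift to E up to a factor 1 + ν with ν nilpotent. In odd characteristic p, 1 + ν has odd order
dividing a power of p, so it is a square and the factor can be removed. -/
theorem exists_sq_sub_mul_sq_eq {E : Type*} [CommRing E] [IsArtinianRing E] (p : ℕ)
    [hp : Fact p.Prime] [CharP E p] (hp2 : p ≠ 2) (d y : E) (hy : IsUnit y)
    (h : ∀ m : Ideal E, m.IsMaximal → ∃ a b : E ⧸ m,
      a ^ 2 - Ideal.Quotient.mk m d * b ^ 2 = Ideal.Quotient.mk m y) :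
    ∃ a b : E, a ^ 2 - d * b ^ 2 = y := by
  choose a b hab using fun I : MaximalSpectrum E => h I.asIdeal I.isMaximal
  let e := IsArtinianRing.quotNilradicalEquivPi E
  obtain ⟨a₀, ha₀⟩ := Ideal.Quotient.mk_surjective (e.symm a)
  obtain ⟨b₀, hb₀⟩ := Ideal.Quotient.mk_surjective (e.symm b)
  have h1 : Ideal.Quotient.mk (nilradical E) (a₀ ^ 2 - d * b₀ ^ 2) =
      Ideal.Quotient.mk (nilradical E) y := by
    apply e.injective
    rw [map_sub, map_mul, map_pow, map_pow, ha₀, hb₀, map_sub, map_mul, map_pow, map_pow,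
      AlgEquiv.apply_symm_apply, AlgEquiv.apply_symm_apply]
    exact funext fun I => hab I
  rw [Ideal.Quotient.eq, mem_nilradical] at h1
  obtain ⟨y', rfl⟩ := hy
  set ν := (↑y'⁻¹ : E) * (a₀ ^ 2 - d * b₀ ^ 2 - y') with hν
  have hnil : IsNilpotent ν := (Commute.all _ _).isNilpotent_mul_left h1
  obtain ⟨N, hN⟩ := hnil
  have hu : (1 + ν) ^ p ^ N = 1 := by
    rw [add_pow_char_pow, one_pow, pow_eq_zero_of_le (Nat.lt_pow_self hp.out.one_lt).le hN,
      add_zero]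
  have hodd : Odd (p ^ N) := (hp.out.odd_of_ne_two hp2).pow
  obtain ⟨r, hr⟩ := hodd
  -- `w` is an inverse of a square root of `1 + ν`
  set w := (1 + ν) ^ r with hw
  have hww : w ^ 2 * (1 + ν) = 1 := by
    rw [hw, ← pow_mul, ← pow_succ, mul_comm, ← hr, hu]
  have hyy : (y' : E) * (1 + ν) = a₀ ^ 2 - d * b₀ ^ 2 := by
    rw [hν, mul_add, Units.mul_inv_cancel_left]
    ring
  refine ⟨a₀ * w, b₀ * w, ?_⟩
  calc (a₀ * w) ^ 2 - d * (b₀ * w) ^ 2 = (a₀ ^ 2 - d * b₀ ^ 2) * w ^ 2 := by ring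
    _ = y' * (w ^ 2 * (1 + ν)) := by rw [← hyy]; ring
    _ = y' := by rw [hww, mul_one]

end SquareRoots

/-! ### Forms with the same asymmetry -/

section CommonAsymmetry

open scoped IsMulCommutative

universe u v

variable {ι : Type u} {F : Type v} [Fintype ι] [DecidableEq ι] [Field F]

/-- Transposing the defining relation once more shows that S is an isometry of A, so its adjoint is
its inverse. -/
theorem transpose_mul_inv_of_asymmetry {A S : Matrix ι ι F} (hA : IsUnit A.det)
    (hAS : Aᵀ = A * S) : IsUnit S.det ∧ Sᵀ * A = A * S⁻¹ ∧ (S⁻¹)ᵀ * A = A * S := by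
  have hS : IsUnit S.det := by
    have := congrArg Matrix.det hAS
    rw [Matrix.det_transpose, Matrix.det_mul] at this
    exact isUnit_of_mul_isUnit_right (this ▸ hA)
  have h1 : Sᵀ * A * S = A := by
    have := congrArg Matrix.transpose hAS
    rw [Matrix.transpose_transpose, Matrix.transpose_mul, hAS, ← Matrix.mul_assoc] at this
    exact this.symm
  refine ⟨hS, ?_, ?_⟩
  · conv_rhs => rw [← h1]
    rw [Matrix.mul_assoc, Matrix.mul_nonsing_inv S hS, Matrix.mul_one]
  · conv_lhs => rw [← h1]
    rw [Matrix.mul_assoc Sᵀ, ← Matrix.mul_assoc, ← Matrix.transpose_mul,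
      Matrix.mul_nonsing_inv S hS, Matrix.transpose_one, Matrix.one_mul]

/-- Commuting matrices generate a commutative algebra. -/
theorem exists_commutative_algebra {x y : Matrix ι ι F} (hxy : x * y = y * x)
    {Q : Matrix ι ι F → Prop} (hx : Q x) (hy : Q y) (halg : ∀ r, Q (algebraMap F _ r))
    (hadd : ∀ a b, Q a → Q b → Q (a + b)) (hmul : ∀ a b, a * b = b * a → Q a → Q b → Q (a * b)) :
    ∃ (E : Type (max u v)) (_ : CommRing E) (_ : Algebra F E) (φ : E →ₐ[F] Matrix ι ι F),
      Function.Injective φ ∧ x ∈ φ.range ∧ y ∈ φ.range ∧ ∀ e, Q (φ e) := by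
  have hcomm : ∀ a ∈ ({x, y} : Set (Matrix ι ι F)), ∀ b ∈ ({x, y} : Set (Matrix ι ι F)),
      a * b = b * a := by
    rintro a (rfl | rfl) b (rfl | rfl)
    · rfl
    · exact hxy
    · exact hxy.symm
    · rfl
  have := Algebra.isMulCommutative_adjoin F hcomm
  refine ⟨Algebra.adjoin F ({x, y} : Set (Matrix ι ι F)), inferInstance, inferInstance,
    (Algebra.adjoin F _).val, Subtype.val_injective,
    ⟨⟨x, Algebra.subset_adjoin (Or.inl rfl)⟩, rfl⟩,
    ⟨⟨y, Algebra.subset_adjoin (Or.inr rfl)⟩, rfl⟩, ?_⟩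
  rintro ⟨e, he⟩
  change Q e
  induction he using Algebra.adjoin_induction with
  | mem z hz => rcases hz with rfl | rfl <;> assumption
  | algebraMap r => exact halg r
  | add a b _ _ ha hb => exact hadd a b ha hb
  | mul a b ha' hb' ha hb =>
    exact hmul a b (congrArg Subtype.val (mul_comm' (⟨a, ha'⟩ : Algebra.adjoin F _) ⟨b, hb'⟩)) ha hb

/-- Two bilinear forms with the same asymmetry are congruent provided a norm equation can be
solved in a commutative algebra of self-adjoint endomorphisms. -/
theorem congr_of_asymmetry_eq (p : ℕ) [Fact p.Prime] [CharP F p] (hp : p ≠ 2)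
    {A B S : Matrix ι ι F} (hA : IsUnit A.det) (hB : IsUnit B.det)
    (hAS : Aᵀ = A * S) (hBS : Bᵀ = B * S)
    (hsolve : ∀ (E : Type (max u v)) [CommRing E] [Algebra F E] [FiniteDimensional F E]
      (φ : E →ₐ[F] Matrix ι ι F), Function.Injective φ → ∀ d y : E, φ d = (S - S⁻¹) ^ 2 →
      ∀ m : Ideal E, m.IsMaximal → ∃ a b : E ⧸ m,
        a ^ 2 - Ideal.Quotient.mk m d * b ^ 2 = Ideal.Quotient.mk m y) :
    Congr A B := by
  rcases isEmpty_or_nonempty ι with hι | hι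
  · exact ⟨1, 1, by simp, by simp, Subsingleton.elim _ _⟩
  obtain ⟨hS, hSA, hSA'⟩ := transpose_mul_inv_of_asymmetry hA hAS
  obtain ⟨-, hSB, -⟩ := transpose_mul_inv_of_asymmetry hB hBS
  set δ := S - S⁻¹ with hδ
  set y := A⁻¹ * B with hy
  have hAy : A * y = B := by rw [hy, ← mul_assoc, Matrix.mul_nonsing_inv A hA, one_mul]
  have hSS : S * S⁻¹ = 1 := Matrix.mul_nonsing_inv S hS
  have hSS' : S⁻¹ * S = 1 := Matrix.nonsing_inv_mul S hS
  have hyS' : S⁻¹ * y = y * S⁻¹ := by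
    have h1 : A * (S⁻¹ * y) = A * (y * S⁻¹) := by
      rw [← mul_assoc, ← hSA, mul_assoc, hAy, hSB, ← mul_assoc, hAy]
    have := congrArg (A⁻¹ * ·) h1
    simpa only [← mul_assoc, Matrix.nonsing_inv_mul A hA, one_mul] using this
  have hyS : S * y = y * S := by
    calc S * y = S * (y * S⁻¹) * S := by rw [mul_assoc, mul_assoc, hSS', mul_one]
      _ = y * S := by rw [← hyS', ← mul_assoc, hSS, one_mul]
  have hyA : yᵀ * A = A * y := by
    have h1 : (A * y)ᵀ = A * y * S := by rw [hAy, hBS]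
    rw [Matrix.transpose_mul, hAS, mul_assoc A, ← hyS, ← mul_assoc, ← mul_assoc] at h1
    have := congrArg (· * S⁻¹) h1
    simp only [mul_assoc, hSS, mul_one] at this
    rw [this, ← mul_assoc, ← mul_assoc, mul_assoc A, hyS]
    simp only [mul_assoc, hSS, mul_one]
  have hδA : δᵀ * A = -(A * δ) := by
    rw [hδ, Matrix.transpose_sub, sub_mul, hSA, hSA', mul_sub, neg_sub]
  have hδy : δ * y = y * δ := by rw [hδ, sub_mul, mul_sub, hyS, hyS']
  -- E is generated by y and δ². All its elements are self-adjoint for A and commute with δ, whereas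
  -- δ itself is skew-adjoint and is left out.
  obtain ⟨E, _, _, φ, hφ, ⟨d', hd'⟩, ⟨y', hy'⟩, hE⟩ := exists_commutative_algebra (x := δ ^ 2)
    (y := y) (Q := fun x => xᵀ * A = A * x ∧ x * δ = δ * x)
    (by rw [pow_two, mul_assoc, hδy, ← mul_assoc, hδy, mul_assoc])
    ⟨by rw [pow_two, Matrix.transpose_mul, mul_assoc, hδA, mul_neg, ← mul_assoc, hδA, neg_mul,
      neg_neg, mul_assoc], by rw [pow_two, mul_assoc]⟩
    ⟨hyA, hδy.symm⟩
    (fun r => ⟨by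
      rw [Matrix.algebraMap_eq_diagonal, Matrix.diagonal_transpose,
        ← Matrix.algebraMap_eq_diagonal]
      exact Algebra.commutes r A, Algebra.commutes r δ⟩)
    (fun x z hx hz => ⟨by rw [Matrix.transpose_add, add_mul, mul_add, hx.1, hz.1],
        by rw [add_mul, mul_add, hx.2, hz.2]⟩)
    (fun x z hxz hx hz =>
      ⟨by rw [Matrix.transpose_mul, mul_assoc, hx.1, ← mul_assoc, hz.1, mul_assoc, ← hxz],
        by rw [mul_assoc, hz.2, ← mul_assoc, hx.2, mul_assoc]⟩)
  replace hd' : φ d' = δ ^ 2 := hd'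
  replace hy' : φ y' = y := hy'
  have : FiniteDimensional F E := FiniteDimensional.of_injective φ.toLinearMap hφ
  have : IsArtinianRing E := IsArtinianRing.of_finite F E
  have : Nontrivial E := φ.toRingHom.domain_nontrivial
  have : CharP E p := charP_of_injective_algebraMap (algebraMap F E).injective p
  have hyu : IsUnit y.det := by
    rw [hy, Matrix.det_mul]
    exact (Matrix.isUnit_nonsing_inv_det A hA).mul hB
  -- The inverse of the matrix y shows that y is not a zero divisor in E, and in an Artinian ring
  -- this makes it a unit.
  have hyunit : IsUnit y' := by
    refine IsArtinianRing.isUnit_of_mem_nonZeroDivisors (mem_nonZeroDivisors_iff_right.2 ?_)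
    intro z hz
    have h1 : φ z * y = 0 := by rw [← hy', ← map_mul, hz, map_zero]
    have h2 := congrArg (· * y⁻¹) h1
    simp only [mul_assoc, Matrix.mul_nonsing_inv y hyu, mul_one, zero_mul] at h2
    exact hφ (by rw [h2, map_zero])
  obtain ⟨a, b, hab⟩ := exists_sq_sub_mul_sq_eq p hp d' y' hyunit (hsolve E φ hφ d' y' hd')
  have hab' : φ a ^ 2 - δ ^ 2 * φ b ^ 2 = y := by
    rw [← hd', ← hy', ← hab, map_sub, map_mul, map_pow, map_pow]
  have hba : φ b * φ a = φ a * φ b := by rw [← map_mul, mul_comm, map_mul]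
  refine congr_of_transpose_mul_mul (X := φ a + φ b * δ) hB ?_
  obtain ⟨ha1, ha2⟩ := hE a
  obtain ⟨hb1, hb2⟩ := hE b
  generalize φ a = α at *
  generalize φ b = β at *
  -- The adjoint of α + βδ is α - δβ, so the form transforms into A times the norm α² - δ²β² = y,
  -- which is B.
  have h5 : (α + β * δ)ᵀ * A = A * (α - δ * β) := by
    rw [Matrix.transpose_add, Matrix.transpose_mul, add_mul, ha1, mul_assoc, hb1, ← mul_assoc,
      hδA, neg_mul, mul_assoc, mul_sub, sub_eq_add_neg]
  rw [h5, mul_assoc, ← hAy, ← hab']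
  congr 1
  have e1 : α * (β * δ) = δ * β * α := by
    rw [hb2, ← mul_assoc, ha2, mul_assoc, mul_assoc, ← hba]
  have e2 : δ * β * (β * δ) = δ ^ 2 * β ^ 2 := by
    rw [hb2, pow_two, pow_two, mul_assoc δ, ← mul_assoc β, hb2]
    simp only [mul_assoc]
  rw [sub_mul, mul_add, mul_add, e1, e2, pow_two α]
  abel

/-- The residue fields are F itself, so a square root solves the norm equation with b = 0. -/
theorem congr_of_asymmetry_eq_of_isAlgClosed [IsAlgClosed F] (p : ℕ) [Fact p.Prime] [CharP F p]
    (hp : p ≠ 2) {A B S : Matrix ι ι F} (hA : IsUnit A.det) (hB : IsUnit B.det)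
    (hAS : Aᵀ = A * S) (hBS : Bᵀ = B * S) : Congr A B := by
  refine congr_of_asymmetry_eq p hp hA hB hAS hBS fun E _ _ _ φ _ d y _ m hm => ?_
  let := Ideal.Quotient.field m
  obtain ⟨c, hc⟩ := (IsAlgClosed.algebraMap_bijective_of_isIntegral (k := F) (K := E ⧸ m)).2
    (Ideal.Quotient.mk m y)
  obtain ⟨z, hz⟩ := IsAlgClosed.exists_pow_nat_eq c (n := 2) two_pos
  refine ⟨algebraMap F (E ⧸ m) z, 0, ?_⟩
  rw [← map_pow, hz, hc]
  simp

/-- Invertibility of S - S⁻¹ makes d a unit, and over a finite residue field of odd characteristic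
a² - db² with d ≠ 0 takes every value. -/
theorem congr_of_asymmetry_eq_of_finite [Finite F] (p : ℕ) [Fact p.Prime] [CharP F p]
    (hp : p ≠ 2) {A B S : Matrix ι ι F} (hA : IsUnit A.det) (hB : IsUnit B.det)
    (hAS : Aᵀ = A * S) (hBS : Bᵀ = B * S) (hS : IsUnit (S - S⁻¹).det) : Congr A B := by
  refine congr_of_asymmetry_eq p hp hA hB hAS hBS fun E _ _ _ φ hφ d y hd m hm => ?_
  have : IsArtinianRing E := IsArtinianRing.of_finite F E
  let := Ideal.Quotient.field m
  have hfin : Finite E := Module.finite_of_finite F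
  have : Finite (E ⧸ m) := Finite.of_surjective _ Ideal.Quotient.mk_surjective
  have := Fintype.ofFinite (E ⧸ m)
  have : CharP (E ⧸ m) p := charP_of_injective_algebraMap (algebraMap F (E ⧸ m)).injective p
  have hdu : IsUnit d := by
    refine IsArtinianRing.isUnit_of_mem_nonZeroDivisors (mem_nonZeroDivisors_iff_right.2 ?_)
    intro z hz
    have h1 : φ z * (S - S⁻¹) ^ 2 = 0 := by rw [← hd, ← map_mul, hz, map_zero]
    have h2 := congrArg (· * (S - S⁻¹)⁻¹ * (S - S⁻¹)⁻¹) h1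
    simp only [pow_two, mul_assoc, Matrix.mul_nonsing_inv_cancel_left _ _ hS, zero_mul] at h2
    rw [Matrix.mul_nonsing_inv _ hS, mul_one] at h2
    exact hφ (by rw [h2, map_zero])
  have hd0 : Ideal.Quotient.mk m d ≠ 0 := (hdu.map (Ideal.Quotient.mk m)).ne_zero
  obtain ⟨a, b, hab⟩ := FiniteField.exists_root_sum_quadratic (R := E ⧸ m)
    (f := Polynomial.X ^ 2 - Polynomial.C (Ideal.Quotient.mk m y))
    (g := Polynomial.C (-Ideal.Quotient.mk m d) * Polynomial.X ^ 2)
    (Polynomial.degree_X_pow_sub_C two_pos _)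
    (Polynomial.degree_C_mul_X_pow 2 (neg_ne_zero.2 hd0))
    (FiniteField.odd_card_of_char_ne_two (by
      rwa [ringChar.eq (E ⧸ m) p]))
  refine ⟨a, b, ?_⟩
  simp only [Polynomial.eval_sub, Polynomial.eval_pow, Polynomial.eval_X, Polynomial.eval_C,
    Polynomial.eval_mul] at hab
  linear_combination hab

end CommonAsymmetry

/-! ### Splitting symmetric and alternating forms -/

section EpsilonSymmetric

variable {ι κ F : Type*} [Fintype ι] [DecidableEq ι] [Fintype κ] [DecidableEq κ] [Field F]

theorem Congr.refl (A : Matrix ι ι F) : Congr A A := ⟨1, 1, by simp, by simp, by simp⟩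

theorem congr_submatrix (A : Matrix ι ι F) (e : κ ≃ ι) : Congr A (A.submatrix e e) := by
  refine ⟨(1 : Matrix ι ι F).submatrix id e, (1 : Matrix ι ι F).submatrix e id, ?_, ?_, ?_⟩
  · ext i j
    simp [Matrix.mul_apply, Matrix.one_apply]
  · ext i j
    simp only [Matrix.mul_apply, Matrix.one_apply, Matrix.submatrix_apply, id]
    rw [Finset.sum_eq_single (e.symm i)]
    · simp
    · intro b _ hb
      rw [if_neg (fun h => hb (by rw [h, Equiv.symm_apply_apply])), zero_mul]
    · exact fun h => absurd (Finset.mem_univ _) h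
  · ext i j
    simp [Matrix.mul_apply, Matrix.one_apply]

theorem Congr.card_eq {A : Matrix ι ι F} {B : Matrix κ κ F} (h : Congr A B) :
    Fintype.card ι = Fintype.card κ := by
  obtain ⟨h, g, hgh, hhg, -⟩ := h
  exact Matrix.square_of_invertible h g hhg hgh

/-- A non-degenerate subspace splits off orthogonally. -/
theorem exists_congr_fromBlocks {A : Matrix ι ι F} (hA : IsUnit A.det) {ε : F} (hε : ε * ε = 1)
    (hAε : Aᵀ = ε • A) (N : Matrix ι κ F) (hN : IsUnit (Nᵀ * A * N).det) :
    ∃ (b : ℕ) (A' : Matrix (Fin b) (Fin b) F),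
      Congr A (Matrix.fromBlocks (Nᵀ * A * N) 0 0 A') ∧ IsUnit A'.det ∧ A'ᵀ = ε • A' ∧
      Fintype.card ι = Fintype.card κ + b := by
  set a := Nᵀ * A * N with ha
  have haε : aᵀ = ε • a := by
    rw [ha, Matrix.transpose_mul, Matrix.transpose_mul, Matrix.transpose_transpose, hAε]
    simp [Matrix.mul_assoc]
  have hainv : (a⁻¹)ᵀ = ε • a⁻¹ := by
    rw [Matrix.transpose_nonsing_inv]
    refine Matrix.inv_eq_right_inv ?_
    rw [haε, Matrix.smul_mul, Matrix.mul_smul, smul_smul, hε, one_smul,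
      Matrix.mul_nonsing_inv a hN]
  set L := a⁻¹ * Nᵀ * A with hL
  have hLN : L * N = 1 := by
    rw [hL, Matrix.mul_assoc, Matrix.mul_assoc, ← Matrix.mul_assoc Nᵀ, ← ha,
      Matrix.nonsing_inv_mul a hN]
  set P := N * L with hP
  have hPP : P * P = P := by
    rw [hP, Matrix.mul_assoc, ← Matrix.mul_assoc L, hLN, Matrix.one_mul]
  have hPA : Pᵀ * A = A * P := by
    rw [hP, hL, Matrix.transpose_mul, Matrix.transpose_mul, Matrix.transpose_mul, hainv, hAε,
      Matrix.transpose_transpose]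
    simp only [Matrix.smul_mul, Matrix.mul_smul, smul_smul, hε, one_smul, Matrix.mul_assoc]
  obtain ⟨b, N', L', hLN', hNL'⟩ := exists_factorization_of_idempotent (P := 1 - P) (by
    rw [sub_mul, one_mul, mul_sub, mul_one, hPP, sub_self, sub_zero])
  have h := congr_fromBlocks_of_idempotent (A := A) hPP
    (by rw [hPA, mul_assoc, mul_sub, mul_one, hPP, sub_self, mul_zero])
    (by rw [Matrix.transpose_sub, Matrix.transpose_one, sub_mul, one_mul, hPA, sub_mul, mul_assoc,
      hPP, sub_self]) hLN rfl hLN' hNL'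
  refine ⟨b, N'ᵀ * A * N', h, ?_, ?_, ?_⟩
  · have := h.isUnit_det_iff.2 hA
    rw [Matrix.det_fromBlocks_zero₁₂] at this
    exact isUnit_of_mul_isUnit_right this
  · rw [Matrix.transpose_mul, Matrix.transpose_mul, Matrix.transpose_transpose, hAε]
    simp [Matrix.mul_assoc]
  · simpa using h.card_eq

/-- Polarisation: if the quadratic form vanishes identically, so does the symmetric bilinear form,
as 2 is invertible. -/
theorem exists_dotProduct_ne_zero (h2 : (2 : F) ≠ 0) {A : Matrix ι ι F} (hA : A ≠ 0)
    (hsym : Aᵀ = A) : ∃ v, v ⬝ᵥ A *ᵥ v ≠ 0 := by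
  by_contra! h
  apply hA
  have hs : ∀ v w, v ⬝ᵥ A *ᵥ w = 0 := by
    intro v w
    have h1 := h (v + w)
    have h3 : w ⬝ᵥ A *ᵥ v = v ⬝ᵥ A *ᵥ w := by
      rw [Matrix.dotProduct_mulVec, ← Matrix.mulVec_transpose, hsym, dotProduct_comm]
    rw [Matrix.mulVec_add, add_dotProduct, dotProduct_add, dotProduct_add, h v, h w, h3, zero_add,
      add_zero, ← two_mul] at h1
    exact (mul_eq_zero.1 h1).resolve_left h2
  ext i j
  have := hs (Pi.single i 1) (Pi.single j 1)
  simpa using this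

theorem Congr.exists_dotProduct {A : Matrix ι ι F} {B : Matrix κ κ F} (h : Congr A B)
    (v : κ → F) : ∃ w, w ⬝ᵥ A *ᵥ w = v ⬝ᵥ B *ᵥ v := by
  obtain ⟨h, g, -, -, rfl⟩ := h
  refine ⟨h *ᵥ v, ?_⟩
  rw [← Matrix.mulVec_mulVec, ← Matrix.mulVec_mulVec, Matrix.dotProduct_mulVec v,
    ← Matrix.mulVec_transpose, Matrix.transpose_transpose]

theorem replicateCol_transpose_mul_mul {ι F : Type*} [Fintype ι] [Field F] (A : Matrix ι ι F) (v : ι → F) :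
    (Matrix.replicateCol Unit v)ᵀ * A * Matrix.replicateCol Unit v =
      Matrix.of fun _ _ => v ⬝ᵥ A *ᵥ v := by
  ext i j
  rw [Matrix.mul_assoc, Matrix.mul_apply]
  rfl

end EpsilonSymmetric

/-! ### Symmetric forms over finite fields -/

section FiniteField

variable {F : Type*} [Field F] [Finite F]

theorem exists_mul_sq_add_mul_sq_eq_one (h2 : (2 : F) ≠ 0) {α β : F} (hα : α ≠ 0) (hβ : β ≠ 0) :
    ∃ s t : F, α * s ^ 2 + β * t ^ 2 = 1 := by
  have := Fintype.ofFinite F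
  obtain ⟨s, t, h⟩ := FiniteField.exists_root_sum_quadratic (R := F)
    (f := Polynomial.X ^ 2 - Polynomial.C α⁻¹) (g := Polynomial.C (β / α) * Polynomial.X ^ 2)
    (Polynomial.degree_X_pow_sub_C two_pos _)
    (Polynomial.degree_C_mul_X_pow 2 (div_ne_zero hβ hα))
    (FiniteField.odd_card_of_char_ne_two fun h => h2 (by
      have := ringChar.Nat.cast_ringChar (R := F)
      rw [h] at this
      exact_mod_cast this))
  refine ⟨s, t, ?_⟩
  simp only [Polynomial.eval_sub, Polynomial.eval_pow, Polynomial.eval_X, Polynomial.eval_C,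
    Polynomial.eval_mul] at h
  field_simp at h
  linear_combination h

/-- Two orthogonal anisotropic vectors span a plane on which the form is αs² + βt² with α, β ≠ 0,
and this binary form represents 1. -/
theorem exists_dotProduct_eq_one (h2 : (2 : F) ≠ 0) {m : ℕ} (hm : 2 ≤ m)
    {A : Matrix (Fin m) (Fin m) F} (hA : IsUnit A.det) (hsym : Aᵀ = A) :
    ∃ v, v ⬝ᵥ A *ᵥ v = 1 := by
  have hne : ∀ {b : ℕ} {A : Matrix (Fin b) (Fin b) F}, 0 < b → IsUnit A.det → A ≠ 0 := by
    rintro b A hb hA rfl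
    have : Nonempty (Fin b) := ⟨⟨0, hb⟩⟩
    rw [Matrix.det_zero] at hA
    exact not_isUnit_zero hA
  obtain ⟨v, hv⟩ := exists_dotProduct_ne_zero h2 (hne (by omega) hA) hsym
  obtain ⟨b, A', hAA', hA', hsym', hc⟩ := exists_congr_fromBlocks hA (ε := 1) (one_mul 1)
    (by rw [hsym, one_smul]) (Matrix.replicateCol Unit v) (by
      rw [replicateCol_transpose_mul_mul, Matrix.det_unique]
      exact isUnit_iff_ne_zero.2 hv)
  simp only [Fintype.card_fin, Fintype.card_unit] at hc
  rw [one_smul] at hsym'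
  obtain ⟨w, hw⟩ := exists_dotProduct_ne_zero h2 (hne (by omega) hA') hsym'
  obtain ⟨s, t, hst⟩ := exists_mul_sq_add_mul_sq_eq_one h2 hv hw
  obtain ⟨u, hu⟩ := hAA'.exists_dotProduct (Sum.elim (fun _ => s) (t • w))
  refine ⟨u, ?_⟩
  rw [hu, replicateCol_transpose_mul_mul, Matrix.fromBlocks_mulVec, ← hst]
  simp only [Sum.elim_comp_inl, Sum.elim_comp_inr, Matrix.zero_mulVec, zero_add,
    sumElim_dotProduct_sumElim, Matrix.mulVec_smul, smul_dotProduct, dotProduct_smul,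
    smul_eq_mul]
  congr 1
  · simp [dotProduct, Matrix.mulVec]
    ring
  · ring

/-- Over a finite field of odd characteristic, non-degenerate symmetric bilinear forms of the same
dimension are congruent if the quotient of the determinants is a square. -/
theorem congr_of_symmetric (h2 : (2 : F) ≠ 0) (m : ℕ) :
    ∀ A B : Matrix (Fin m) (Fin m) F, IsUnit A.det → IsUnit B.det → Aᵀ = A → Bᵀ = B →
      (∃ c, c ≠ 0 ∧ B.det = c ^ 2 * A.det) → Congr A B := by
  induction m with
  | zero => exact fun A B _ _ _ _ _ => ⟨1, 1, by simp, by simp, Subsingleton.elim _ _⟩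
  | succ m ih =>
    rintro A B hA hB hAs hBs ⟨c, hc, hAB⟩
    rcases Nat.eq_zero_or_pos m with rfl | hm
    · refine congr_of_transpose_mul_mul (X := c • 1) hB ?_
      rw [Matrix.det_fin_one, Matrix.det_fin_one] at hAB
      ext i j
      rw [Fin.fin_one_eq_zero i, Fin.fin_one_eq_zero j, hAB]
      simp
      ring
    -- A vector of norm 1 splits off from each form, and the complements still have determinants
    -- differing by a square.
    · have key : ∀ A : Matrix (Fin (m + 1)) (Fin (m + 1)) F, IsUnit A.det → Aᵀ = A →
          ∃ A' : Matrix (Fin m) (Fin m) F, Congr A (Matrix.fromBlocks (1 : Matrix Unit Unit F) 0 0 A') ∧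
            IsUnit A'.det ∧ A'ᵀ = A' := by
        intro A hA hAs
        obtain ⟨v, hv⟩ := exists_dotProduct_eq_one h2 (by omega) hA hAs
        have h1 : (Matrix.replicateCol Unit v)ᵀ * A * Matrix.replicateCol Unit v = 1 := by
          rw [replicateCol_transpose_mul_mul, hv]
          ext i j
          simp
        obtain ⟨b, A', hAA', hA', hsym', hcard⟩ := exists_congr_fromBlocks hA (ε := 1) (one_mul 1)
          (by rw [hAs, one_smul]) (Matrix.replicateCol Unit v) (by
            rw [h1, Matrix.det_one]; exact isUnit_one)
        simp only [Fintype.card_fin, Fintype.card_unit] at hcard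
        obtain rfl : b = m := by omega
        rw [h1] at hAA'
        exact ⟨A', hAA', hA', by rwa [one_smul] at hsym'⟩
      obtain ⟨A', hAA', hA', hAs'⟩ := key A hA hAs
      obtain ⟨B', hBB', hB', hBs'⟩ := key B hB hBs
      refine hAA'.trans (Congr.trans ?_ hBB'.symm)
      refine (Congr.refl 1).fromBlocks (ih A' B' hA' hB' hAs' hBs' ?_)
      obtain ⟨a, ha, ha'⟩ := hAA'.exists_det_eq
      obtain ⟨b, hb, hb'⟩ := hBB'.exists_det_eq
      rw [Matrix.det_fromBlocks_zero₁₂, Matrix.det_one, one_mul] at ha' hb'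
      refine ⟨b * c / a, div_ne_zero (mul_ne_zero hb hc) ha, ?_⟩
      rw [ha', hb', hAB]
      field_simp

end FiniteField

/-! ### Alternating forms -/

section Alternating

variable {F : Type*} [Field F]

/-- Non-degenerate alternating bilinear forms of the same dimension are congruent. -/
theorem congr_of_alternating (h2 : (2 : F) ≠ 0) (m : ℕ) :
    ∀ A B : Matrix (Fin m) (Fin m) F, IsUnit A.det → IsUnit B.det → Aᵀ = -A → Bᵀ = -B →
      Congr A B := by
  induction m using Nat.strong_induction_on with
  | _ m ih =>
    intro A B hA hB hAs hBs
    rcases Nat.eq_zero_or_pos m with rfl | hm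
    · exact ⟨1, 1, by simp, by simp, Subsingleton.elim _ _⟩
    have key : ∀ A : Matrix (Fin m) (Fin m) F, IsUnit A.det → Aᵀ = -A →
        ∃ A' : Matrix (Fin (m - 2)) (Fin (m - 2)) F,
          Congr A (Matrix.fromBlocks !![0, 1; -1, 0] 0 0 A') ∧
          IsUnit A'.det ∧ A'ᵀ = -A' := by
      intro A hA hAs
      have hskew : ∀ i j, A j i = -A i j := fun i j => congrFun (congrFun hAs i) j
      have hdiag : ∀ i, A i i = 0 := fun i => by
        have := hskew i i
        have h3 : 2 * A i i = 0 := by linear_combination this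
        exact (mul_eq_zero.1 h3).resolve_left h2
      obtain ⟨i, j, hij⟩ : ∃ i j, A i j ≠ 0 := by
        by_contra! h
        have hA0 : A = 0 := Matrix.ext h
        have : Nonempty (Fin m) := ⟨⟨0, hm⟩⟩
        rw [hA0, Matrix.det_zero] at hA
        exact not_isUnit_zero hA
      -- The columns are e_i and a multiple of e_j, scaled to make them a hyperbolic pair.
      let N : Matrix (Fin m) (Fin 2) F :=
        Matrix.of fun l s => if s = 0 then (Pi.single i 1 : Fin m → F) l
          else (Pi.single j (A i j)⁻¹ : Fin m → F) l
      have hN0 : ∀ l, N l 0 = (Pi.single i 1 : Fin m → F) l := fun l => rfl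
      have hN1 : ∀ l, N l 1 = (Pi.single j (A i j)⁻¹ : Fin m → F) l := fun l => rfl
      have h1 : Nᵀ * A * N = !![0, 1; -1, 0] := by
        ext s t
        fin_cases s <;> fin_cases t <;>
          simp [Matrix.mul_apply, Matrix.transpose_apply, hN0, hN1, Pi.single_apply, hdiag, hij,
            hskew i j]
      obtain ⟨b, A', hAA', hA', hsym', hcard⟩ := exists_congr_fromBlocks hA (ε := -1) (by ring)
        (by rw [hAs, neg_one_smul]) N (by rw [h1]; simp [Matrix.det_fin_two_of])
      simp only [Fintype.card_fin] at hcard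
      obtain rfl : b = m - 2 := by omega
      rw [h1] at hAA'
      exact ⟨A', hAA', hA', by rwa [neg_one_smul] at hsym'⟩
    obtain ⟨A', hAA', hA', hAs'⟩ := key A hA hAs
    obtain ⟨B', hBB', hB', hBs'⟩ := key B hB hBs
    exact hAA'.trans (((Congr.refl _).fromBlocks
      (ih (m - 2) (by omega) A' B' hA' hB' hAs' hBs')).trans hBB'.symm)

end Alternating

/-! ### Finite semisimple modules over principal ideal rings -/

section SemisimpleModules

open Polynomial

variable {R : Type*} [CommRing R]

theorem card_smul_eq_zero_of_equiv {M M' : Type*} [AddCommGroup M] [Module R M] [AddCommGroup M']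
    [Module R M'] (e : M ≃ₗ[R] M') (p : R) :
    Nat.card {x : M // p • x = 0} = Nat.card {x : M' // p • x = 0} :=
  Nat.card_congr (e.toEquiv.subtypeEquiv fun x => by
    change _ ↔ p • e x = 0
    rw [← map_smul, map_eq_zero_iff e e.injective])

theorem card_smul_eq_zero_prod (M M' : Type*) [AddCommGroup M] [Module R M] [AddCommGroup M']
    [Module R M'] (p : R) :
    Nat.card {x : M × M' // p • x = 0} =
      Nat.card {x : M // p • x = 0} * Nat.card {x : M' // p • x = 0} := by
  rw [← Nat.card_prod]
  refine Nat.card_congr ((Equiv.subtypeEquivRight fun x => ?_).trans Equiv.subtypeProdEquivProd)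
  exact Prod.ext_iff

/-- Finite semisimple modules over a principal ideal ring are isomorphic if the kernels of all
homotheties have the same cardinality. -/
theorem nonempty_linearEquiv_of_card_smul_eq_zero [IsPrincipalIdealRing R] (d : ℕ) :
    ∀ (M : Type*) (M' : Type*) [AddCommGroup M] [Module R M] [AddCommGroup M'] [Module R M']
      [Finite M] [Finite M'] [IsSemisimpleModule R M] [IsSemisimpleModule R M'],
      Nat.card M = d →
      (∀ p : R, Nat.card {x : M // p • x = 0} = Nat.card {x : M' // p • x = 0}) →
      Nonempty (M ≃ₗ[R] M') := by
  induction d using Nat.strong_induction_on with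
  | _ d ih =>
    intro M M' _ _ _ _ _ _ _ _ hd h
    rcases subsingleton_or_nontrivial M with hM | hM
    · have h0 := h 0
      rw [Nat.card_congr (Equiv.subtypeUnivEquiv fun x => zero_smul R x),
        Nat.card_congr (Equiv.subtypeUnivEquiv fun x => zero_smul R x), Nat.card_unique] at h0
      have : Subsingleton M' := (Nat.card_eq_one_iff_unique.1 h0.symm).1
      exact ⟨0, 0, fun _ => Subsingleton.elim _ _, fun _ => Subsingleton.elim _ _⟩
    · obtain ⟨N, hN⟩ := IsSemisimpleModule.exists_simple_submodule R M
      obtain ⟨I, hI, ⟨e⟩⟩ := isSimpleModule_iff_quot_maximal.1 hN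
      obtain ⟨π, hπ⟩ : ∃ π, I = Ideal.span {π} := ⟨_, (Ideal.span_singleton_generator I).symm⟩
      have hsimple : IsSimpleModule R (R ⧸ I) := isSimpleModule_iff_quot_maximal.2
        ⟨I, hI, ⟨LinearEquiv.refl _ _⟩⟩
      -- A simple submodule N ≅ R/(π) of M gives non-zero π-torsion in M. By the counts M' also has
      -- some, and a non-zero element of it generates a copy of R/(π) in M'.
      obtain ⟨v, hv, hv0⟩ : ∃ v : M', π • v = 0 ∧ v ≠ 0 := by
        have h1 : Nontrivial {x : M // π • x = 0} := by
          refine ⟨⟨(e.symm 1).1, ?_⟩, ⟨0, smul_zero _⟩, fun h => ?_⟩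
          · have h2 : π • e.symm 1 = 0 := by
              rw [← map_smul, map_eq_zero_iff _ e.symm.injective, Algebra.smul_def, mul_one]
              exact Ideal.Quotient.eq_zero_iff_mem.2 (hπ ▸ Ideal.mem_span_singleton_self π)
            exact congrArg Subtype.val h2
          · have h2 : e.symm 1 = 0 := Subtype.ext (congrArg (fun x => x.1) h)
            rw [map_eq_zero_iff _ e.symm.injective] at h2
            have : Nontrivial (R ⧸ I) := Ideal.Quotient.nontrivial_iff.2 hI.ne_top
            exact one_ne_zero h2
        have h2 : Nontrivial {x : M' // π • x = 0} := by
          rw [← Finite.one_lt_card_iff_nontrivial, ← h π, Finite.one_lt_card_iff_nontrivial]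
          exact h1
        obtain ⟨w, hw⟩ := exists_ne (⟨0, smul_zero _⟩ : {x : M' // π • x = 0})
        exact ⟨w.1, w.2, fun h => hw (Subtype.ext h)⟩
      have hle : I ≤ LinearMap.ker (LinearMap.toSpanSingleton R M' v) := by
        rw [hπ, Ideal.span_singleton_le_iff_mem]
        exact hv
      let f : (R ⧸ I) →ₗ[R] M' := Submodule.liftQ I _ hle
      have hf : Function.Injective f := by
        refine LinearMap.injective_of_ne_zero fun h => hv0 ?_
        have h1 : f (Submodule.Quotient.mk 1) = 0 := by rw [h]; rfl
        rw [Submodule.liftQ_apply, LinearMap.toSpanSingleton_apply, one_smul] at h1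
        exact h1
      let e' : N ≃ₗ[R] LinearMap.range f := e.trans (LinearEquiv.ofInjective f hf)
      obtain ⟨C, hC⟩ := exists_isCompl N
      obtain ⟨C', hC'⟩ := exists_isCompl (LinearMap.range f)
      let E := Submodule.prodEquivOfIsCompl N C hC
      let E' := Submodule.prodEquivOfIsCompl _ C' hC'
      have hN1 : 1 < Nat.card N := by
        have := IsSimpleModule.nontrivial R N
        exact Finite.one_lt_card
      have hcard : Nat.card C < d := by
        have h1 := Nat.card_congr E.toEquiv
        rw [Nat.card_prod, hd] at h1
        have h2 : 0 < Nat.card C := Nat.card_pos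
        nlinarith
      -- The counts are multiplicative in direct sums and positive, so the common simple summand
      -- cancels.
      obtain ⟨g⟩ := ih _ hcard C C' rfl fun p => by
        have h1 := h p
        rw [← card_smul_eq_zero_of_equiv E, ← card_smul_eq_zero_of_equiv E',
          card_smul_eq_zero_prod, card_smul_eq_zero_prod, card_smul_eq_zero_of_equiv e'] at h1
        have : Nonempty {x : LinearMap.range f // p • x = 0} := ⟨⟨0, smul_zero _⟩⟩
        exact Nat.eq_of_mul_eq_mul_left Nat.card_pos h1
      exact ⟨E.symm.trans ((LinearEquiv.prodCongr e' g).trans E')⟩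

end SemisimpleModules

/-! ### Descent of conjugacy to a finite field -/

section Conjugacy

open Polynomial

variable {K k : Type*} [Field K] [Field k]

/-- Reduce M to a diagonal matrix by invertible factors: these stay invertible under f, and the
number of non-zero diagonal entries does not change. -/
theorem rank_map {ι : Type*} [Fintype ι] [DecidableEq ι] (M : Matrix ι ι K) (f : K →+* k) :
    (M.map f).rank = M.rank := by
  classical
  obtain ⟨V, U, e, hV, hU, h⟩ := M.exists_rank_normal_form
  obtain ⟨w, hw⟩ : ∃ w, V * M * U = Matrix.diagonal w := by
    rw [h, ← Matrix.diagonal_one, ← Matrix.diagonal_zero, Matrix.fromBlocks_diagonal,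
      Matrix.submatrix_diagonal_equiv]
    exact ⟨_, rfl⟩
  have hV' := (V.isUnit_iff_isUnit_det).1 hV
  have hU' := (U.isUnit_iff_isUnit_det).1 hU
  have hmap : ∀ {W : Matrix ι ι K}, IsUnit W.det → IsUnit (W.map f).det := fun {W} hW => by
    rw [← RingHom.mapMatrix_apply, ← RingHom.map_det]
    exact hW.map f
  have hw' : V.map f * M.map f * U.map f = Matrix.diagonal fun i => f (w i) := by
    rw [← Matrix.map_mul, ← Matrix.map_mul, hw, Matrix.diagonal_map (map_zero f)]
  have h1 := Matrix.rank_diagonal w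
  have h2 := Matrix.rank_diagonal fun i => f (w i)
  rw [← hw, Matrix.rank_mul_eq_left_of_isUnit_det _ _ hU',
    Matrix.rank_mul_eq_right_of_isUnit_det _ _ hV'] at h1
  rw [← hw', Matrix.rank_mul_eq_left_of_isUnit_det _ _ (hmap hU'),
    Matrix.rank_mul_eq_right_of_isUnit_det _ _ (hmap hV')] at h2
  rw [h1, h2]
  refine Fintype.card_congr (Equiv.subtypeEquivRight fun i => ?_)
  rw [ne_eq, ne_eq, map_eq_zero]

/-- Diagonalisable matrices over a finite field that are conjugate over an extension field are
conjugate. -/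
theorem exists_conj_of_map_conj [Finite K] (f : K →+* k) {m : ℕ} {S S' : Matrix (Fin m) (Fin m) K}
    {P : K[X]} (hP : Squarefree P) (hS : aeval S P = 0) {h g : Matrix (Fin m) (Fin m) k}
    (hgh : g * h = 1) (hS' : S'.map f = g * S.map f * h) :
    ∃ u v : Matrix (Fin m) (Fin m) K, u * v = 1 ∧ v * u = 1 ∧ S' = u * S * v := by
  have hhg : h * g = 1 := mul_eq_one_comm.1 hgh
  have hmap : ∀ (p : K[X]) (T : Matrix (Fin m) (Fin m) K),
      (aeval T p).map f = aeval (T.map f) (p.map f) := by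
    intro p T
    rw [← RingHom.mapMatrix_apply, ← RingHom.mapMatrix_apply, aeval_def, aeval_def,
      eval₂_map, hom_eval₂]
    congr 1
    ext1 r
    simp only [RingHom.comp_apply, RingHom.mapMatrix_apply, Matrix.algebraMap_eq_diagonal]
    rw [Matrix.diagonal_map (map_zero f)]
    rfl
  have hconj : ∀ p : K[X], (aeval S' p).map f = g * (aeval S p).map f * h := by
    intro p
    rw [hmap, hmap, hS']
    induction p.map f using Polynomial.induction_on' with
    | add p q hp hq => rw [map_add, map_add, hp, hq, mul_add, add_mul]
    | monomial n a =>
      rw [aeval_monomial, aeval_monomial]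
      have : (g * S.map f * h) ^ n = g * S.map f ^ n * h := by
        induction n with
        | zero => rw [pow_zero, pow_zero, mul_one, hgh]
        | succ n ih =>
          rw [pow_succ, ih, pow_succ]
          calc g * S.map f ^ n * h * (g * S.map f * h) = g * S.map f ^ n * (h * g) * S.map f * h := by
                simp only [mul_assoc]
            _ = _ := by rw [hhg, mul_one]; simp only [mul_assoc]
      rw [this, ← mul_assoc, ← mul_assoc, Algebra.commutes, mul_assoc g]
  -- The ranks of all polynomials in S are unchanged by field extension and by conjugation. They
  -- determine the sizes of all torsion submodules of the K[X]-module of S, which is semisimple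
  -- because P is squarefree.
  have hrank : ∀ p : K[X], (aeval S' p).rank = (aeval S p).rank := by
    intro p
    have hg : IsUnit g.det := (g.isUnit_iff_isUnit_det).1 ⟨⟨g, h, hgh, hhg⟩, rfl⟩
    have hh : IsUnit h.det := (h.isUnit_iff_isUnit_det).1 ⟨⟨h, g, hhg, hgh⟩, rfl⟩
    rw [← rank_map _ f, hconj, Matrix.rank_mul_eq_left_of_isUnit_det _ _ hh,
      Matrix.rank_mul_eq_right_of_isUnit_det _ _ hg, rank_map]
  have hS'P : aeval S' P = 0 := by
    have h1 := hconj P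
    rw [hS] at h1
    have h2 : (aeval S' P).map f = 0 := by rw [h1]; simp
    ext i j
    have := congrFun (congrFun h2 i) j
    simpa using this
  have haeval : ∀ (T : Matrix (Fin m) (Fin m) K) (p : K[X]),
      aeval (Matrix.toLin' T) p = Matrix.toLin' (aeval T p) := fun T p =>
    Polynomial.aeval_algHom_apply (Matrix.toLinAlgEquiv' (R := K)).toAlgHom T p
  have hss : ∀ T : Matrix (Fin m) (Fin m) K, aeval T P = 0 →
      IsSemisimpleModule K[X] (Module.AEval' (Matrix.toLin' T)) := fun T hT =>
    Module.End.isSemisimple_of_squarefree_aeval_eq_zero hP (by rw [haeval, hT, map_zero])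
  have hcard : ∀ (T : Matrix (Fin m) (Fin m) K) (p : K[X]),
      Nat.card {x : Module.AEval' (Matrix.toLin' T) // p • x = 0} =
        Nat.card K ^ (m - (aeval T p).rank) := by
    intro T p
    have h1 : Nat.card {x : Module.AEval' (Matrix.toLin' T) // p • x = 0} =
        Nat.card (LinearMap.ker (Matrix.toLin' (aeval T p))) := by
      refine (Nat.card_congr ((Module.AEval'.of (Matrix.toLin' T)).toEquiv.subtypeEquiv
        fun x => ?_)).symm
      change _ ↔ p • Module.AEval'.of (Matrix.toLin' T) x = 0
      rw [← Module.AEval.of_aeval_smul, haeval, LinearEquiv.map_eq_zero_iff]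
      rfl
    have h2 := LinearMap.finrank_range_add_finrank_ker (Matrix.toLin' (aeval T p))
    rw [Module.finrank_fin_fun] at h2
    rw [h1, Module.natCard_eq_pow_finrank (K := K)]
    congr 1
    have h3 : (aeval T p).rank = Module.finrank K (LinearMap.range (Matrix.toLin' (aeval T p))) := rfl
    omega
  have := hss S hS
  have := hss S' hS'P
  have hfin : ∀ T : Matrix (Fin m) (Fin m) K, Finite (Module.AEval' (Matrix.toLin' T)) := fun T =>
    Finite.of_equiv _ (Module.AEval'.of (Matrix.toLin' T)).toEquiv
  have := hfin S
  have := hfin S'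
  obtain ⟨e⟩ := nonempty_linearEquiv_of_card_smul_eq_zero (R := K[X]) _
    (Module.AEval' (Matrix.toLin' S)) (Module.AEval' (Matrix.toLin' S')) rfl
    (fun p => by rw [hcard, hcard, hrank])
  let e' : (Fin m → K) ≃ₗ[K] (Fin m → K) :=
    ((Module.AEval'.of (Matrix.toLin' S)).trans (e.restrictScalars K)).trans
      (Module.AEval'.of (Matrix.toLin' S')).symm
  have he' : ∀ v, e' (Matrix.toLin' S v) = Matrix.toLin' S' (e' v) := by
    intro v
    have h1 : ∀ (T : Matrix (Fin m) (Fin m) K) (v : Fin m → K),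
        Module.AEval'.of (Matrix.toLin' T) (Matrix.toLin' T v) =
          (X : K[X]) • Module.AEval'.of (Matrix.toLin' T) v := fun T v => by
      rw [← Module.AEval.of_aeval_smul, aeval_X]
      rfl
    apply (Module.AEval'.of (Matrix.toLin' S')).injective
    change Module.AEval'.of (Matrix.toLin' S') ((Module.AEval'.of (Matrix.toLin' S')).symm
      (e (Module.AEval'.of (Matrix.toLin' S) (Matrix.toLin' S v)))) = _
    rw [h1 S', LinearEquiv.apply_symm_apply, h1 S, map_smul]
    change _ = X • Module.AEval'.of (Matrix.toLin' S') ((Module.AEval'.of (Matrix.toLin' S')).symm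
      (e (Module.AEval'.of (Matrix.toLin' S) v)))
    rw [LinearEquiv.apply_symm_apply]
  refine ⟨LinearMap.toMatrix' e'.toLinearMap, LinearMap.toMatrix' e'.symm.toLinearMap, ?_, ?_, ?_⟩
  · rw [← LinearMap.toMatrix'_comp, LinearEquiv.comp_symm, LinearMap.toMatrix'_id]
  · rw [← LinearMap.toMatrix'_comp, LinearEquiv.symm_comp, LinearMap.toMatrix'_id]
  · conv_rhs => rw [← LinearMap.toMatrix'_toLin' S]
    conv_lhs => rw [← LinearMap.toMatrix'_toLin' S']
    rw [← LinearMap.toMatrix'_comp, ← LinearMap.toMatrix'_comp]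
    congr 1
    apply LinearMap.ext
    intro v
    change _ = e' (Matrix.toLin' S (e'.symm v))
    rw [he', LinearEquiv.apply_symm_apply]

end Conjugacy

/-! ### Splitting off the eigenvalues 1 and -1 of the asymmetry -/

section Splitting

variable {F : Type*} [Field F]

/-- Two forms with the same diagonalisable asymmetry split off the eigenspace of the asymmetry for
an eigenvalue `c = ±1` simultaneously. -/
theorem exists_split_eigenspace (p : ℕ) [hp : Fact p.Prime] [CharP F p] (hp2 : p ≠ 2) {N : ℕ}
    (hN : N ≠ 0) {m : ℕ} {A B S : Matrix (Fin m) (Fin m) F} (hA : IsUnit A.det)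
    (hB : IsUnit B.det) (hAS : Aᵀ = A * S) (hBS : Bᵀ = B * S) (hS : S ^ p ^ N = S) {c : F}
    (hc : c * c = 1) :
    ∃ (a b : ℕ) (A₁ B₁ : Matrix (Fin a) (Fin a) F) (A' B' S' : Matrix (Fin b) (Fin b) F),
      Congr A (Matrix.fromBlocks A₁ 0 0 A') ∧ Congr B (Matrix.fromBlocks B₁ 0 0 B') ∧
      A₁ᵀ = c • A₁ ∧ B₁ᵀ = c • B₁ ∧ A'ᵀ = A' * S' ∧ B'ᵀ = B' * S' ∧ S' ^ p ^ N = S' ∧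
      IsUnit (S' - c • 1) ∧ (∀ c' : F, IsUnit (S - c' • 1) → IsUnit (S' - c' • 1)) ∧
      (IsUnit (S - c • 1) → a = 0) := by
  have hc0 : c ≠ 0 := left_ne_zero_of_mul_eq_one hc
  -- With this shape the exponent p^N - 1 = 2r + 2 is even, and p^N - 2 = 2r + 1 is the exponent
  -- that inverts T off its kernel.
  obtain ⟨r, hr⟩ : ∃ r, p ^ N = 2 * r + 3 := by
    obtain ⟨r, hr⟩ := (hp.out.odd_of_ne_two hp2).pow (n := N)
    have h2 : 1 < p ^ N := Nat.one_lt_pow hN hp.out.one_lt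
    exact ⟨r - 1, by omega⟩
  obtain ⟨hSu, hSA, -⟩ := transpose_mul_inv_of_asymmetry hA hAS
  obtain ⟨-, hSB, -⟩ := transpose_mul_inv_of_asymmetry hB hBS
  set T := S - c • (1 : Matrix (Fin m) (Fin m) F) with hT
  have hcpow : (-c) ^ (2 * r + 2) = 1 := by
    rw [show 2 * r + 2 = 2 * (r + 1) by ring, pow_mul, neg_sq, pow_two, hc, one_pow]
  have hTS : T * S = S * T := by rw [hT, sub_mul, mul_sub]; simp
  have hTQ : T ^ (2 * r + 3) = T := by
    have h1 : (c • (1 : Matrix (Fin m) (Fin m) F)) ^ p ^ N = c • 1 := by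
      have : c ^ p ^ N = c := by
        rw [hr, pow_succ, ← neg_neg c, neg_pow, neg_neg, hcpow]
        rw [show 2 * r + 2 = 2 * (r + 1) by ring, pow_mul]
        simp
      rw [smul_pow, one_pow, this]
    have h2 : Commute S (c • (1 : Matrix (Fin m) (Fin m) F)) := by
      rw [Commute, SemiconjBy]; simp
    rw [← hr, hT]
    rcases isEmpty_or_nonempty (Fin m) with he | he
    · exact Subsingleton.elim _ _
    · rw [sub_pow_char_pow_of_commute _ _ h2, hS, h1]
  have hSQ : S ^ (2 * r + 2) = 1 := by
    have h1 : S ^ (2 * r + 2) * S = S := by rw [← pow_succ, ← hr, hS]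
    have := congrArg (· * S⁻¹) h1
    simpa only [mul_assoc, Matrix.mul_nonsing_inv S hSu, mul_one] using this
  -- As T^(p^N) = T, this power is the idempotent whose kernel is the kernel of T, the eigenspace of
  -- S for c.
  set e := T ^ (2 * r + 2) with he
  have hTe : T * e = T := by rw [he, ← pow_succ', hTQ]
  have heT : e * T = T := by rw [he, ← pow_succ, hTQ]
  have hee : e * e = e := by
    rw [he, ← pow_add, show 2 * r + 2 + (2 * r + 2) = 2 * r + 3 + (2 * r + 1) by ring, pow_add, hTQ,
      ← pow_succ']
  have heS : e * S = S * e := by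
    rw [he]
    exact (Commute.pow_left (show Commute T S from hTS) _).eq
  -- The adjoint of T is S⁻¹ - c = -cS⁻¹T. In the power 2r + 2 the factors -c and S⁻¹ disappear, so
  -- e is self-adjoint and its image and kernel are orthogonal.
  have hself : ∀ A : Matrix (Fin m) (Fin m) F, Sᵀ * A = A * S⁻¹ → eᵀ * A = A * e := by
    intro A hSA
    have hcS : Commute S⁻¹ T := by
      have h3 : S⁻¹ * T * S = T := by
        rw [mul_assoc, hTS, Matrix.nonsing_inv_mul_cancel_left _ _ hSu]
      rw [Commute, SemiconjBy]
      conv_rhs => rw [← h3]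
      rw [mul_assoc, Matrix.mul_nonsing_inv S hSu, mul_one]
    have h1 : Tᵀ * A = A * (-c • (S⁻¹ * T)) := by
      have h2 : -c • (S⁻¹ * T) = S⁻¹ - c • 1 := by
        rw [hT, mul_sub, Matrix.nonsing_inv_mul S hSu, smul_sub, Matrix.mul_smul, mul_one,
          smul_smul, neg_mul, hc, neg_smul, neg_smul, one_smul]
        abel
      rw [h2, hT, Matrix.transpose_sub, Matrix.transpose_smul, Matrix.transpose_one, sub_mul, hSA,
        mul_sub]
      simp
    have h4 : ∀ j, (T ^ j)ᵀ * A = A * (-c • (S⁻¹ * T)) ^ j := by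
      intro j
      induction j with
      | zero => simp
      | succ j ih =>
        rw [pow_succ, Matrix.transpose_mul, mul_assoc, ih, ← mul_assoc, h1, mul_assoc, ← pow_succ']
    have hSinv : (S⁻¹) ^ (2 * r + 2) = 1 := by
      rw [Matrix.inv_pow', hSQ, inv_one]
    rw [he, h4, smul_pow, hcpow, one_smul, hcS.mul_pow, hSinv, one_mul]
  have hP : (1 - e) * (1 - e) = 1 - e := by
    rw [mul_sub, mul_one, sub_mul, one_mul, hee, sub_self, sub_zero]
  obtain ⟨a, M, L, hLM, hML⟩ := exists_factorization_of_idempotent hP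
  obtain ⟨b, M', L', hLM', hML'⟩ := exists_factorization_of_idempotent hee
  have h1e : 1 - (1 - e) = e := sub_sub_cancel 1 e
  have hsplit : ∀ A : Matrix (Fin m) (Fin m) F, Sᵀ * A = A * S⁻¹ →
      Congr A (Matrix.fromBlocks (Mᵀ * A * M) 0 0 (M'ᵀ * A * M')) := by
    intro A hSA
    have h := hself A hSA
    refine congr_fromBlocks_of_idempotent hP ?_ ?_ hLM hML hLM' (by rw [h1e, hML'])
    · rw [h1e, Matrix.transpose_sub, Matrix.transpose_one, sub_mul, one_mul, h, sub_mul, mul_assoc,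
        hee, sub_self]
    · rw [h1e, h, mul_assoc, mul_sub, mul_one, hee, sub_self, mul_zero]
  have hMe : e * M' = M' := by rw [← hML', Matrix.mul_assoc, hLM', Matrix.mul_one]
  have hLe : L' * e = L' := by rw [← hML', ← Matrix.mul_assoc, hLM', Matrix.one_mul]
  have hTM : T * M = 0 := by
    have hM : (1 - e) * M = M := by rw [← hML, Matrix.mul_assoc, hLM, Matrix.mul_one]
    rw [← hM, ← Matrix.mul_assoc, mul_sub, mul_one, hTe, sub_self, Matrix.zero_mul]
  have hSM : S * M = c • M := by
    rw [hT, Matrix.sub_mul, sub_eq_zero] at hTM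
    rw [hTM]
    simp
  have hcompr : ∀ X Y : Matrix (Fin m) (Fin m) F, e * Y = Y * e →
      (L' * X * M') * (L' * Y * M') = L' * (X * Y) * M' := by
    intro X Y hY
    calc (L' * X * M') * (L' * Y * M') = L' * X * ((M' * L') * Y) * M' := by
          simp only [Matrix.mul_assoc]
      _ = L' * X * Y * (e * M') := by rw [hML', hY]; simp only [Matrix.mul_assoc]
      _ = _ := by rw [hMe]; simp only [Matrix.mul_assoc]
  have hunit : ∀ c' : F, IsUnit (S - c' • (1 : Matrix (Fin m) (Fin m) F)) →
      IsUnit (L' * S * M' - c' • (1 : Matrix (Fin b) (Fin b) F)) := by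
    rintro c' ⟨U, hU⟩
    have h1 : L' * S * M' - c' • (1 : Matrix (Fin b) (Fin b) F) = L' * U.1 * M' := by
      rw [hU, Matrix.mul_sub, Matrix.sub_mul, Matrix.mul_smul, Matrix.smul_mul, Matrix.mul_one,
        hLM']
    have hUe : e * U.1 = U.1 * e := by rw [hU, mul_sub, sub_mul, heS]; simp
    have hUe' : e * U⁻¹.1 = U⁻¹.1 * e :=
      (Commute.units_inv_right (show Commute e U.1 from hUe)).eq
    rw [h1]
    refine ⟨⟨L' * U.1 * M', L' * U⁻¹.1 * M', ?_, ?_⟩, rfl⟩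
    · rw [hcompr _ _ hUe', Units.mul_inv, Matrix.mul_one, hLM']
    · rw [hcompr _ _ hUe, Units.inv_mul, Matrix.mul_one, hLM']
  have hsym : ∀ A : Matrix (Fin m) (Fin m) F, Aᵀ = A * S →
      (Mᵀ * A * M)ᵀ = c • (Mᵀ * A * M) ∧
      (M'ᵀ * A * M')ᵀ = (M'ᵀ * A * M') * (L' * S * M') := by
    intro A hAS
    constructor
    · rw [Matrix.transpose_mul, Matrix.transpose_mul, Matrix.transpose_transpose, hAS,
        Matrix.mul_assoc, Matrix.mul_assoc, hSM, Matrix.mul_smul, Matrix.mul_smul]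
    · rw [Matrix.transpose_mul, Matrix.transpose_mul, Matrix.transpose_transpose, hAS]
      calc M'ᵀ * (A * S * M') = M'ᵀ * A * (S * (e * M')) := by
            rw [hMe]; simp only [Matrix.mul_assoc]
        _ = M'ᵀ * A * (M' * L' * S) * M' := by
          rw [hML', heS]; simp only [Matrix.mul_assoc]
        _ = _ := by simp only [Matrix.mul_assoc]
  refine ⟨a, b, Mᵀ * A * M, Mᵀ * B * M, M'ᵀ * A * M', M'ᵀ * B * M', L' * S * M', hsplit A hSA,
    hsplit B hSB, (hsym A hAS).1, (hsym B hBS).1, (hsym A hAS).2, (hsym B hBS).2, ?_, ?_, hunit, ?_⟩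
  · have : ∀ j, (L' * S * M') ^ j = L' * S ^ j * M' := by
      intro j
      induction j with
      | zero => rw [pow_zero, pow_zero, Matrix.mul_one, hLM']
      | succ j ih => rw [pow_succ, ih, hcompr _ _ heS, pow_succ]
    rw [this, hS]
  -- On the image of e, where T^(2r + 2) is the identity, T has inverse T^(2r + 1).
  · have h1 : L' * S * M' - c • (1 : Matrix (Fin b) (Fin b) F) = L' * T * M' := by
      rw [hT, Matrix.mul_sub, Matrix.sub_mul, Matrix.mul_smul, Matrix.smul_mul, Matrix.mul_one,
        hLM']
    have h2 : ∀ i, e * T ^ i = T ^ i * e := fun i =>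
      (Commute.pow_right (show Commute e T from heT.trans hTe.symm) i).eq
    have h3 : L' * e * M' = 1 := by rw [hLe, hLM']
    rw [h1]
    refine ⟨⟨L' * T * M', L' * T ^ (2 * r + 1) * M', ?_, ?_⟩, rfl⟩
    · rw [hcompr _ _ (h2 _), ← pow_succ', ← he, h3]
    · rw [hcompr _ _ (heT.trans hTe.symm), ← pow_succ, ← he, h3]
  · rintro ⟨U, hU⟩
    have h1 : M = 0 := by
      have : U⁻¹.1 * (T * M) = M := by rw [← hU, ← Matrix.mul_assoc, Units.inv_mul, Matrix.one_mul]
      rw [← this, hTM, Matrix.mul_zero]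
    by_contra ha
    have : Nonempty (Fin a) := ⟨⟨0, Nat.pos_of_ne_zero ha⟩⟩
    rw [h1, Matrix.mul_zero] at hLM
    exact zero_ne_one hLM

end Splitting

/-! ### Rational forms that are congruent over an extension -/

section Uniqueness

/-- Congruent forms have conjugate asymmetries. -/
theorem asymmetry_eq_of_eq {F : Type*} [Field F] {m : ℕ}
    {A B S S' h g : Matrix (Fin m) (Fin m) F} (hB : IsUnit B.det)
    (hAS : Aᵀ = A * S) (hBS : Bᵀ = B * S') (hhg : h * g = 1) (e : B = hᵀ * A * h) :
    S' = g * S * h := by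
  have e1 : Bᵀ = hᵀ * Aᵀ * h := by
    rw [e, Matrix.transpose_mul, Matrix.transpose_mul, Matrix.transpose_transpose, mul_assoc]
  have e4 : B * (g * S * h) = B * S' := by
    rw [← hBS, e1, hAS, e]
    calc hᵀ * A * h * (g * S * h) = hᵀ * A * (h * g) * S * h := by simp only [mul_assoc]
      _ = _ := by rw [hhg, mul_one]; simp only [mul_assoc]
  have := congrArg (B⁻¹ * ·) e4
  simp only [Matrix.nonsing_inv_mul_cancel_left _ _ hB] at this
  exact this.symm

variable {K : Type*} [Field K] [Finite K]

/-- Split both forms along the eigenvalues 1 and -1. The parts for -1 are alternating and on the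
remainder S - S⁻¹ is invertible, so these parts are congruent. Their determinants then differ by a
square, and the hypothesis on the full determinants compares the symmetric parts for the eigenvalue
1. -/
theorem congr_of_asymmetry_pow_eq (p : ℕ) [hp : Fact p.Prime] [CharP K p] (hp2 : p ≠ 2) {N : ℕ}
    (hN : N ≠ 0) {m : ℕ} {A B S : Matrix (Fin m) (Fin m) K} (hA : IsUnit A.det)
    (hB : IsUnit B.det) (hAS : Aᵀ = A * S) (hBS : Bᵀ = B * S) (hS : S ^ p ^ N = S)
    (hdet : ¬ IsUnit (S - 1) → ∃ c, c ≠ 0 ∧ B.det = c ^ 2 * A.det) : Congr A B := by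
  have h2 : (2 : K) ≠ 0 := by
    have := (CharP.cast_eq_zero_iff K p 2).not.2 fun h =>
      hp2 ((Nat.prime_dvd_prime_iff_eq hp.out Nat.prime_two).1 h)
    exact_mod_cast this
  obtain ⟨a, b, A₁, B₁, A', B', S', hAA', hBB', hA₁s, hB₁s, hA's, hB's, hS', hS'1, -, ha⟩ :=
    exists_split_eigenspace p hp2 hN hA hB hAS hBS hS (c := 1) (one_mul 1)
  have hAu := hAA'.isUnit_det_iff.2 hA
  have hBu := hBB'.isUnit_det_iff.2 hB
  rw [Matrix.det_fromBlocks_zero₁₂] at hAu hBu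
  have hA'u := isUnit_of_mul_isUnit_right hAu
  have hB'u := isUnit_of_mul_isUnit_right hBu
  obtain ⟨a₂, b₂, A₂, B₂, A₃, B₃, S₃, hAA₃, hBB₃, hA₂s, hB₂s, hA₃s, hB₃s, -, hS₃', hS₃, -⟩ :=
    exists_split_eigenspace p hp2 hN hA'u hB'u hA's hB's hS' (c := -1) (by ring)
  have hA'u' := hAA₃.isUnit_det_iff.2 hA'u
  have hB'u' := hBB₃.isUnit_det_iff.2 hB'u
  rw [Matrix.det_fromBlocks_zero₁₂] at hA'u' hB'u'
  have h3 : Congr A₃ B₃ := by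
    have hA₃u := isUnit_of_mul_isUnit_right hA'u'
    have hB₃u := isUnit_of_mul_isUnit_right hB'u'
    refine congr_of_asymmetry_eq_of_finite p hp2 hA₃u hB₃u hA₃s hB₃s ?_
    have hS₃u := (transpose_mul_inv_of_asymmetry hA₃u hA₃s).1
    have h1 := hS₃ 1 hS'1
    rw [one_smul] at h1
    rw [neg_one_smul, sub_neg_eq_add] at hS₃'
    have h4 : S₃ - S₃⁻¹ = S₃⁻¹ * ((S₃ - 1) * (S₃ + 1)) := by
      have : (S₃ - 1) * (S₃ + 1) = S₃ * S₃ - 1 := by noncomm_ring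
      rw [this, mul_sub, mul_one, Matrix.nonsing_inv_mul_cancel_left _ _ hS₃u]
    rw [h4, Matrix.det_mul, Matrix.det_mul]
    exact (Matrix.isUnit_nonsing_inv_det _ hS₃u).mul
      (((Matrix.isUnit_iff_isUnit_det _).1 h1).mul ((Matrix.isUnit_iff_isUnit_det _).1 hS₃'))
  have h4 : Congr A₂ B₂ :=
    congr_of_alternating h2 a₂ A₂ B₂ (isUnit_of_mul_isUnit_left hA'u')
      (isUnit_of_mul_isUnit_left hB'u') (by rw [hA₂s, neg_one_smul]) (by rw [hB₂s, neg_one_smul])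
  have h5 : Congr A' B' := hAA₃.trans ((h4.fromBlocks h3).trans hBB₃.symm)
  refine hAA'.trans (Congr.trans (Congr.fromBlocks ?_ h5) hBB'.symm)
  by_cases hS1 : IsUnit (S - 1)
  · have ha0 : a = 0 := ha (by rwa [one_smul])
    subst ha0
    exact ⟨1, 1, by simp, by simp, Subsingleton.elim _ _⟩
  · refine congr_of_symmetric h2 a A₁ B₁ (isUnit_of_mul_isUnit_left hAu)
      (isUnit_of_mul_isUnit_left hBu) (by rw [hA₁s, one_smul]) (by rw [hB₁s, one_smul]) ?_
    obtain ⟨c, hc, hcd⟩ := hdet hS1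
    obtain ⟨x, hx, hxd⟩ := hAA'.exists_det_eq
    obtain ⟨y, hy, hyd⟩ := hBB'.exists_det_eq
    obtain ⟨z, hz, hzd⟩ := h5.exists_det_eq
    rw [Matrix.det_fromBlocks_zero₁₂] at hxd hyd
    refine ⟨y * c / (x * z), div_ne_zero (mul_ne_zero hy hc) (mul_ne_zero hx hz), ?_⟩
    have hA0 := hA'u.ne_zero
    rw [hzd, hcd] at hyd
    have h6 : (B₁.det * (x * z) ^ 2 - (y * c) ^ 2 * A₁.det) * A'.det = 0 := by
      linear_combination x ^ 2 * hyd - c ^ 2 * y ^ 2 * hxd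
    have h7 := sub_eq_zero.1 ((mul_eq_zero.1 h6).resolve_right hA0)
    field_simp
    linear_combination h7

/-- Over a finite field, two non-degenerate forms with diagonalisable asymmetry that become
congruent over an extension field are congruent, provided that the quotient of their determinants
is a square if the asymmetry has the eigenvalue `1`. -/
theorem congr_of_map_congr {k : Type*} [Field k] (f : K →+* k) (p : ℕ) [hp : Fact p.Prime]
    [CharP K p] (hp2 : p ≠ 2) {N : ℕ} (hN : N ≠ 0) {m : ℕ} {A B : Matrix (Fin m) (Fin m) K}
    (hA : IsUnit A.det) (hB : IsUnit B.det) (hAB : Congr (A.map f) (B.map f))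
    (hS : (A⁻¹ * Aᵀ) ^ p ^ N = A⁻¹ * Aᵀ)
    (hdet : (A - Aᵀ).det = 0 → ∃ c, c ≠ 0 ∧ B.det = c ^ 2 * A.det) : Congr A B := by
  set S := A⁻¹ * Aᵀ with hSdef
  set S' := B⁻¹ * Bᵀ with hS'def
  have hAS : Aᵀ = A * S := by rw [hSdef, Matrix.mul_nonsing_inv_cancel_left _ _ hA]
  have hBS : Bᵀ = B * S' := by rw [hS'def, Matrix.mul_nonsing_inv_cancel_left _ _ hB]
  obtain ⟨h, g, hgh, hhg, hBmap⟩ := hAB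
  have hmap : ∀ {C T : Matrix (Fin m) (Fin m) K}, Cᵀ = C * T →
      (C.map f)ᵀ = C.map f * T.map f := fun hC => by
    rw [← Matrix.map_mul, ← hC, Matrix.transpose_map]
  have hBf : IsUnit (B.map f).det := by
    rw [← RingHom.mapMatrix_apply, ← RingHom.map_det]
    exact hB.map f
  have hconj := asymmetry_eq_of_eq hBf (hmap hAS) (hmap hBS) hhg hBmap
  -- The asymmetry is killed by this separable polynomial, so its conjugacy over k descends to K.
  have hsq : Squarefree (Polynomial.X ^ p ^ N - Polynomial.X : Polynomial K) :=
    (galois_poly_separable p (p ^ N) (dvd_pow_self p hN)).squarefree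
  obtain ⟨u, v, huv, hvu, hS'⟩ := exists_conj_of_map_conj f hsq (by simp [hS]) hgh hconj
  -- Changing the basis of the second form by u gives it the asymmetry S of the first.
  have hC : Congr B (uᵀ * B * u) := ⟨u, v, hvu, huv, rfl⟩
  refine Congr.trans ?_ hC.symm
  have hCS : (uᵀ * B * u)ᵀ = uᵀ * B * u * S := by
    rw [Matrix.transpose_mul, Matrix.transpose_mul, Matrix.transpose_transpose, hBS, hS']
    calc uᵀ * (B * (u * S * v) * u) = uᵀ * B * u * S * (v * u) := by
          simp only [Matrix.mul_assoc]
      _ = _ := by rw [hvu, Matrix.mul_one]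
  refine congr_of_asymmetry_pow_eq p hp2 hN hA (hC.isUnit_det_iff.2 hB) hAS hCS hS fun hS1 => ?_
  -- A - Aᵀ = -A(S - 1), so A - Aᵀ is singular exactly when S has the eigenvalue 1.
  obtain ⟨c, hc, hcd⟩ := hdet (by
    by_contra h0
    apply hS1
    have e1 : A - Aᵀ = -A * (S - 1) := by rw [hAS, mul_sub, neg_mul, neg_mul, mul_one]; abel
    rw [e1, Matrix.det_mul] at h0
    exact (Matrix.isUnit_iff_isUnit_det _).2 (isUnit_iff_ne_zero.2 (right_ne_zero_of_mul h0)))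
  obtain ⟨d, hd, hdd⟩ := hC.exists_det_eq
  exact ⟨d * c, mul_ne_zero hd hc, by rw [hdd, hcd]; ring⟩

end Uniqueness

/-! ### Changing the discriminant of the symmetric part -/

section Twist

theorem Congr.map {F k ι κ : Type*} [Field F] [Field k] [Fintype ι] [DecidableEq ι] [Fintype κ]
    [DecidableEq κ] (f : F →+* k) {A : Matrix ι ι F} {B : Matrix κ κ F} (h : Congr A B) :
    Congr (A.map f) (B.map f) := by
  obtain ⟨h, g, hgh, hhg, rfl⟩ := h
  refine ⟨h.map f, g.map f, ?_, ?_, ?_⟩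
  · rw [← Matrix.map_mul, hgh, Matrix.map_one _ f.map_zero f.map_one]
  · rw [← Matrix.map_mul, hhg, Matrix.map_one _ f.map_zero f.map_one]
  · rw [Matrix.map_mul, Matrix.map_mul, Matrix.transpose_map]

theorem isUnit_det_map {F k ι : Type*} [Field F] [Field k] [Fintype ι] [DecidableEq ι]
    (f : F →+* k) {A : Matrix ι ι F} (h : IsUnit A.det) : IsUnit (A.map f).det := by
  rw [← RingHom.mapMatrix_apply, ← RingHom.map_det]
  exact h.map f

/-- A - Aᵀ undergoes the same congruence as A. For invertible A its singularity says that 1 is an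
eigenvalue of the asymmetry, a test that needs no inverse. -/
theorem Congr.det_sub_transpose_eq_zero {F ι κ : Type*} [Field F] [Fintype ι] [DecidableEq ι]
    [Fintype κ] [DecidableEq κ] {A : Matrix ι ι F} {B : Matrix κ κ F} (h : Congr A B)
    (hA : (A - Aᵀ).det = 0) : (B - Bᵀ).det = 0 := by
  have : Congr (A - Aᵀ) (B - Bᵀ) := by
    obtain ⟨h, g, hgh, hhg, rfl⟩ := h
    refine ⟨h, g, hgh, hhg, ?_⟩
    simp only [Matrix.transpose_mul, Matrix.transpose_transpose, Matrix.mul_sub, Matrix.sub_mul,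
      Matrix.mul_assoc]
  obtain ⟨c, -, hc⟩ := this.exists_det_eq
  rw [hc, hA, mul_zero]

/-- If the asymmetry of a form is diagonalisable with eigenvalue `1`, the determinant of the form
can be changed arbitrarily without changing the form over an algebraic closure. -/
theorem exists_congr_map_det_eq {F k : Type*} [Field F] [Field k] [IsAlgClosed k] (f : F →+* k)
    (p : ℕ) [hp : Fact p.Prime] [CharP F p] [CharP k p] (hp2 : p ≠ 2) {N : ℕ} (hN : N ≠ 0) {m : ℕ}
    {A : Matrix (Fin m) (Fin m) F} (hA : IsUnit A.det) (hS : (A⁻¹ * Aᵀ) ^ p ^ N = A⁻¹ * Aᵀ)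
    (h0 : (A - Aᵀ).det = 0) {d : F} (hd : d ≠ 0) :
    ∃ B : Matrix (Fin m) (Fin m) F, IsUnit B.det ∧ Congr (A.map f) (B.map f) ∧
      ∃ x, x ≠ 0 ∧ B.det = d * x ^ 2 * A.det := by
  have hAS : Aᵀ = A * (A⁻¹ * Aᵀ) := by rw [Matrix.mul_nonsing_inv_cancel_left _ _ hA]
  obtain ⟨a, b, A₁, -, A', -, S', hAA', -, hA₁s, -, hA's, -, hS', hS'1, -, -⟩ :=
    exists_split_eigenspace p hp2 hN hA hA hAS hAS hS (c := 1) (one_mul 1)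
  have hAu := hAA'.isUnit_det_iff.2 hA
  have hAu' := hAu
  rw [Matrix.det_fromBlocks_zero₁₂] at hAu'
  have hA₁u := isUnit_of_mul_isUnit_left hAu'
  have hA'u := isUnit_of_mul_isUnit_right hAu'
  rw [one_smul] at hA₁s hS'1
  -- Were the eigenspace for 1 zero, A - Aᵀ would be congruent to -A'(S' - 1), which is invertible.
  have ha : 0 < a := by
    by_contra ha
    have ha0 : a = 0 := by omega
    subst ha0
    have h1 := hAA'.det_sub_transpose_eq_zero h0
    rw [Matrix.fromBlocks_transpose, Matrix.transpose_zero, Matrix.transpose_zero, hA₁s,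
      sub_eq_add_neg, Matrix.fromBlocks_neg, Matrix.fromBlocks_add] at h1
    simp only [neg_zero, add_zero] at h1
    rw [Matrix.det_fromBlocks_zero₁₂, Matrix.det_isEmpty, one_mul, ← sub_eq_add_neg, hA's] at h1
    have e1 : A' - A' * S' = -A' * (S' - 1) := by rw [mul_sub, neg_mul, neg_mul, mul_one]; abel
    rw [e1, Matrix.det_mul, Matrix.det_neg] at h1
    have h2 := ((Matrix.isUnit_iff_isUnit_det _).1 hS'1).ne_zero
    have h3 := hA'u.ne_zero
    simp [h2, h3] at h1
  let i₀ : Fin a := ⟨0, ha⟩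
  -- Only the symmetric block is replaced. Over k both symmetric blocks have asymmetry 1, so they
  -- become congruent whatever their determinants.
  let B₁ : Matrix (Fin a) (Fin a) F := Matrix.diagonal fun i => if i = i₀ then d * A₁.det else 1
  have hB₁ : B₁.det = d * A₁.det := by
    rw [Matrix.det_diagonal, Finset.prod_ite_eq']
    simp
  have hB₁u : IsUnit B₁.det := by rw [hB₁]; exact (isUnit_iff_ne_zero.2 hd).mul hA₁u
  let e : Fin m ≃ Fin a ⊕ Fin b := Fintype.equivOfCardEq hAA'.card_eq
  have hB := congr_submatrix (Matrix.fromBlocks B₁ 0 0 A') e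
  have hmap : Congr (A₁.map f) (B₁.map f) :=
    congr_of_asymmetry_eq_of_isAlgClosed p hp2 (isUnit_det_map f hA₁u) (isUnit_det_map f hB₁u)
      (S := 1) (by rw [mul_one, ← Matrix.transpose_map, hA₁s])
      (by rw [mul_one, ← Matrix.transpose_map, Matrix.diagonal_transpose])
  have hfb : ∀ C : Matrix (Fin a) (Fin a) F, (Matrix.fromBlocks C 0 0 A').map f =
      Matrix.fromBlocks (C.map f) 0 0 (A'.map f) := by
    intro C
    rw [Matrix.fromBlocks_map]
    simp
  obtain ⟨x, hx, hxd⟩ := hAA'.exists_det_eq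
  refine ⟨_, hB.isUnit_det_iff.2 ?_, ?_, x, hx, ?_⟩
  · rw [Matrix.det_fromBlocks_zero₁₂]
    exact hB₁u.mul hA'u
  · refine (hAA'.map f).trans (Congr.trans ?_ (hB.map f))
    rw [hfb, hfb]
    exact hmap.fromBlocks (Congr.refl _)
  · rw [Matrix.det_submatrix_equiv_self, Matrix.det_fromBlocks_zero₁₂, hB₁]
    rw [Matrix.det_fromBlocks_zero₁₂] at hxd
    rw [mul_assoc, hxd, mul_assoc]

end Twist

/-! ### Lang's theorem -/

section Lang

open Polynomial in
/-- An additive polynomial of degree less than `q ^ s` that vanishes on `𝔽_{q^s}` is zero. -/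
theorem coeff_zero_of_forall_sum_eq_zero {K : Type*} [Field K] [Fintype K] {k : Type*} [Field k]
    [Algebra K k] [IsAlgClosed k] {s : ℕ} (hs : 0 < s) (c : ℕ → k)
    (h : ∀ z : k, z ^ Fintype.card K ^ s = z →
      ∑ i ∈ Finset.range s, c i * z ^ Fintype.card K ^ i = 0) : c 0 = 0 := by
  classical
  set q := Fintype.card K
  have hq : 1 < q := Fintype.one_lt_card
  obtain ⟨p, hp⟩ := CharP.exists K
  have : CharP k p := charP_of_injective_algebraMap (algebraMap K k).injective p
  have hsep : (X ^ q ^ s - X : k[X]).Separable :=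
    galois_poly_separable p _ ((CharP.cast_eq_zero_iff K p q |>.1 (FiniteField.cast_card_eq_zero K)).trans
      (dvd_pow_self q hs.ne'))
  have hcard : (X ^ q ^ s - X : k[X]).roots.toFinset.card = q ^ s := by
    rw [Multiset.toFinset_card_of_nodup (nodup_roots hsep),
      ← (IsAlgClosed.splits (X ^ q ^ s - X : k[X])).natDegree_eq_card_roots,
      FiniteField.X_pow_card_pow_sub_X_natDegree_eq k hs.ne' hq]
  set P : k[X] := ∑ i ∈ Finset.range s, C (c i) * X ^ q ^ i with hP
  have hdeg : P.natDegree < q ^ s := by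
    refine lt_of_le_of_lt (natDegree_sum_le_of_forall_le (n := q ^ (s - 1)) _ _ fun i hi => ?_)
      (Nat.pow_lt_pow_right hq (by omega))
    refine (natDegree_C_mul_X_pow_le _ _).trans (Nat.pow_le_pow_right hq.le ?_)
    have := Finset.mem_range.1 hi
    omega
  have hP0 : P = 0 := by
    refine eq_zero_of_natDegree_lt_card_of_eval_eq_zero' P
      (X ^ q ^ s - X : k[X]).roots.toFinset (fun z hz => ?_) (by rwa [hcard])
    rw [Multiset.mem_toFinset] at hz
    have hz' := isRoot_of_mem_roots hz
    rw [IsRoot, eval_sub, eval_pow, eval_X, sub_eq_zero] at hz'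
    rw [hP, eval_finsetSum]
    simpa using h z hz'
  have h1 : P.coeff 1 = c 0 := by
    rw [hP, finsetSum_coeff, Finset.sum_eq_single 0]
    · simp
    · intro i _ hi
      rw [coeff_C_mul, coeff_X_pow, if_neg, mul_zero]
      exact (Nat.one_lt_pow hi hq).ne
    · intro h0
      exact absurd (Finset.mem_range.2 hs) h0
  rw [← h1, hP0, coeff_zero]

variable {K : Type*} [Field K] [Fintype K] {k : Type*} [Field k] [Algebra K k]

/-- The entries of h generate a finite field L, and g ↦ F(g)h is an injective self-map of the finite
set of invertible matrices with entries in L; every point, in particular 1, is periodic. -/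
theorem exists_iterate_frobenius_mul_eq_one [Algebra.IsAlgebraic K k] {n : ℕ}
    (h : GL (Fin n) k) :
    ∃ s, 0 < s ∧ (fun g : GL (Fin n) k => frobGL K k n g * h)^[s] 1 = 1 := by
  classical
  let L : IntermediateField K k :=
    IntermediateField.adjoin K (Set.range fun ij : Fin n × Fin n => h.val ij.1 ij.2)
  have hfin : FiniteDimensional K L := by
    refine IntermediateField.finiteDimensional_adjoin fun x _ => ?_
    exact (Algebra.IsAlgebraic.isAlgebraic x).isIntegral
  have hL : Finite L := Module.finite_of_finite K
  set Φ := fun g : GL (Fin n) k => frobGL K k n g * h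
  let S : Set (GL (Fin n) k) := {g | ∀ i j, g.val i j ∈ L}
  have hS : S.Finite := by
    refine Set.Finite.of_finite_image (f := fun g i j => g.val i j) ?_
      (fun g _ g' _ e => Units.ext (by ext i j; exact congrFun (congrFun e i) j))
    refine Set.Finite.subset (Set.Finite.pi' fun i => Set.Finite.pi' fun j =>
      (Set.toFinite (L : Set k))) ?_
    rintro _ ⟨g, hg, rfl⟩ i j
    exact hg i j
  have hmaps : ∀ g : S, Φ g ∈ S := by
    rintro ⟨g, hg⟩ i j
    change (∑ l, (frobGL K k n g).val i l * h.val l j) ∈ L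
    refine L.sum_mem fun l _ => L.mul_mem ?_ (IntermediateField.subset_adjoin K _ ⟨(l, j), rfl⟩)
    change (g.val i l) ^ Fintype.card K ∈ L
    exact pow_mem (hg i l) _
  have : Finite S := hS
  let Ψ : S → S := fun g => ⟨Φ g, hmaps g⟩
  have hinj : Function.Injective Ψ := by
    rintro ⟨g, hg⟩ ⟨g', hg'⟩ e
    have e1 : frobGL K k n g * h = frobGL K k n g' * h := congrArg Subtype.val e
    have e2 := mul_right_cancel e1
    refine Subtype.ext (Units.ext (Matrix.ext fun i j => ?_))
    have e3 := congrArg (fun g : GL (Fin n) k => g.val i j) e2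
    exact (FiniteField.frobeniusAlgHom K k).injective e3
  have h1 : (1 : GL (Fin n) k) ∈ S := by
    intro i j
    change (if i = j then (1 : k) else 0) ∈ L
    split_ifs
    · exact L.one_mem
    · exact L.zero_mem
  obtain ⟨s, hs, hs'⟩ := hinj.mem_periodicPts (⟨1, h1⟩ : S)
  refine ⟨s, hs, ?_⟩
  have hsem : ∀ j, ((Ψ^[j] ⟨1, h1⟩ : S) : GL (Fin n) k) = Φ^[j] 1 := by
    intro j
    induction j with
    | zero => rfl
    | succ j ih => rw [Function.iterate_succ_apply', Function.iterate_succ_apply', ← ih]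
  rw [← hsem, hs']

/-- Lang's theorem for `GL_n`. -/
theorem exists_frobGL_mul_eq [Algebra.IsAlgebraic K k] [IsAlgClosed k] {n : ℕ}
    (h : GL (Fin n) k) : ∃ x : GL (Fin n) k, frobGL K k n x * h = x := by
  classical
  obtain ⟨s, hs, hN⟩ := exists_iterate_frobenius_mul_eq_one (K := K) h
  set q := Fintype.card K
  set M := fun i => (fun g : GL (Fin n) k => frobGL K k n g * h)^[i] 1 with hM
  have hM1 : ∀ i, M (i + 1) = frobGL K k n (M i) * h := fun i => by
    rw [hM]
    exact Function.iterate_succ_apply' _ _ _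
  -- Row vectors w with F(w)h = w: an invertible matrix with such rows solves the equation, so it
  -- suffices that they span.
  let fixed : Set (Fin n → k) := {w | (fun j => w j ^ q) ᵥ* h.val = w}
  have hadd : ∀ v w : Fin n → k, (fun j => (v + w) j ^ q) = (fun j => v j ^ q) + fun j => w j ^ q :=
    fun v w => funext fun j => map_add (FiniteField.frobeniusAlgHom K k) (v j) (w j)
  let Φ : (Fin n → k) →+ (Fin n → k) :=
    { toFun := fun w => (fun j => w j ^ q) ᵥ* h.val
      map_zero' := by
        have : (fun _ : Fin n => (0 : k) ^ q) = 0 := funext fun _ => zero_pow Fintype.card_ne_zero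
        simp only [Pi.zero_apply, this, Matrix.zero_vecMul]
      map_add' := fun v w => by rw [hadd, Matrix.add_vecMul] }
  -- Φ sends the i-th of these vectors to the next one, and they return to the start after s steps
  -- when z lies in 𝔽_{q^s}. The sum over a period is then fixed by Φ.
  let u : k → Fin n → ℕ → Fin n → k := fun z j i => fun l => z ^ q ^ i * (M i).val j l
  have hΦu : ∀ z j i, Φ (u z j i) = u z j (i + 1) := by
    intro z j i
    ext l
    change ∑ t, (z ^ q ^ i * (M i).val j t) ^ q * h.val t l = z ^ q ^ (i + 1) * (M (i + 1)).val j l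
    rw [hM1]
    change _ = z ^ q ^ (i + 1) * ∑ t, ((M i).val j t) ^ q * h.val t l
    rw [Finset.mul_sum]
    refine Finset.sum_congr rfl fun t _ => ?_
    rw [mul_pow, ← pow_mul, ← pow_succ, mul_assoc]
  have hfix : ∀ z j, z ^ q ^ s = z → (∑ i ∈ Finset.range s, u z j i) ∈ fixed := by
    intro z j hz
    change Φ _ = _
    rw [map_sum]
    simp only [hΦu]
    have h1 := Finset.sum_range_succ (u z j) s
    have h2 := Finset.sum_range_succ' (u z j) s
    have h3 : u z j s = u z j 0 := by
      change (fun l => z ^ q ^ s * (M s).val j l) = fun l => z ^ q ^ 0 * (M 0).val j l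
      have h4 : M s = M 0 := hN
      rw [h4, hz, pow_zero, pow_one]
    rw [h1, h3] at h2
    exact (add_right_cancel h2).symm
  have hspan : Submodule.span k fixed = ⊤ := by
    by_contra hne
    obtain ⟨φ, hφ, hφ0⟩ := Submodule.exists_le_ker_of_lt_top _ (lt_top_iff_ne_top.2 hne)
    apply hφ
    refine LinearMap.pi_ext' fun j => LinearMap.ext_ring ?_
    -- A linear form φ killing all fixed vectors gives an additive polynomial in z vanishing on
    -- 𝔽_{q^s}. Its coefficient of z is φ of the j-th row of `M 0`, the j-th basis vector.
    have h5 := coeff_zero_of_forall_sum_eq_zero (K := K) hs (fun i => φ ((M i).val j)) fun z hz => by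
      have h6 : φ (∑ i ∈ Finset.range s, u z j i) = 0 :=
        hφ0 (Submodule.subset_span (hfix z j hz))
      rw [map_sum] at h6
      rw [← h6]
      refine Finset.sum_congr rfl fun i _ => ?_
      rw [show u z j i = z ^ q ^ i • (M i).val j from rfl, map_smul, smul_eq_mul, mul_comm]
    have h7 : (M 0).val j = Pi.single j 1 := by
      change (1 : Matrix (Fin n) (Fin n) k) j = _
      ext l
      rw [Matrix.one_apply, Pi.single_apply]
      simp only [eq_comm]
    rw [h7] at h5
    simpa using h5
  let b := Module.Basis.ofSpan hspan.ge
  have hb : ∀ i, b i ∈ fixed := fun i => by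
    have := Module.Basis.ofSpan_subset hspan.ge
    exact this ⟨i, rfl⟩
  let e := b.indexEquiv (Pi.basisFun k (Fin n))
  have hx : IsUnit (Matrix.of fun i => b (e.symm i)) := by
    rw [← Matrix.linearIndependent_rows_iff_isUnit]
    exact b.linearIndependent.comp _ e.symm.injective
  obtain ⟨x, hx⟩ := hx
  refine ⟨x, Units.ext (Matrix.ext fun i j => ?_)⟩
  have := congrFun (hb (e.symm i)) j
  have hxi : x.val i = b (e.symm i) := by rw [hx]; rfl
  rw [hxi, ← this, ← hxi]
  rfl

end Lang

/-! ### Asymmetries of the diagonal representatives -/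

section Asymmetry

variable {n : ℕ} {k : Type*} [Field k]

theorem congr_form_iff {g g' : GL (Fin n) k} :
    Congr (form g) (form g') ↔ ∃ h : GL (Fin n) k, h * g * (theta h)⁻¹ = g' := by
  constructor
  · rintro ⟨x, y, hyx, hxy, e⟩
    let h : GL (Fin n) k := ⟨xᵀ, yᵀ, by rw [← Matrix.transpose_mul, hyx, Matrix.transpose_one],
      by rw [← Matrix.transpose_mul, hxy, Matrix.transpose_one]⟩
    refine ⟨h, form_injective ?_⟩
    rw [form_mul_theta_inv, e]
    rfl
  · rintro ⟨h, rfl⟩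
    refine ⟨h.valᵀ, (h⁻¹).valᵀ, ?_, ?_, ?_⟩
    · rw [← Matrix.transpose_mul, Units.mul_inv, Matrix.transpose_one]
    · rw [← Matrix.transpose_mul, Units.inv_mul, Matrix.transpose_one]
    · rw [form_mul_theta_inv, Matrix.transpose_transpose]

theorem isUnit_det_form (g : GL (Fin n) k) : IsUnit (form g).det := Matrix.isUnits_det_units _

/-- The diagonal entries of the asymmetry of the form attached to `diag(d)σ`. -/
def asym (d : Fin n → kˣ) (j : Fin n) : kˣ :=
  d j * gramSign n k j / (d j.rev * gramSign n k j.rev)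

theorem asym_rev (d : Fin n → kˣ) (j : Fin n) : asym d j.rev = (asym d j)⁻¹ := by
  rw [asym, asym, Fin.rev_rev, inv_div]

theorem form_diagGL_transpose (d : Fin n → kˣ) :
    (form (diagGL d))ᵀ = form (diagGL d) * Matrix.diagonal fun j => (asym d j : k) := by
  ext i j
  rw [Matrix.mul_diagonal, Matrix.transpose_apply, diagGL_mul_gram_apply, diagGL_mul_gram_apply]
  by_cases h : i = j.rev
  · subst h
    rw [if_pos (Fin.rev_rev j).symm, if_pos rfl, asym]
    norm_cast
    rw [mul_div_cancel]
  · rw [if_neg (fun e => h (by rw [e, Fin.rev_rev])), if_neg h, zero_mul]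

theorem det_form_diagGL_sub_transpose_eq_zero_iff (d : Fin n → kˣ) :
    (form (diagGL d) - (form (diagGL d))ᵀ).det = 0 ↔ ∃ i, asym d i = 1 := by
  have e1 : form (diagGL d) - (form (diagGL d))ᵀ =
      form (diagGL d) * Matrix.diagonal fun j => 1 - (asym d j : k) := by
    rw [form_diagGL_transpose, ← Matrix.diagonal_sub, mul_sub, Matrix.diagonal_one, mul_one]
  rw [e1, Matrix.det_mul, Matrix.det_diagonal, mul_eq_zero,
    or_iff_right (isUnit_det_form _).ne_zero, Finset.prod_eq_zero_iff]
  simp only [Finset.mem_univ, true_and, sub_eq_zero]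
  exact exists_congr fun i => ⟨fun h => Units.ext h.symm, fun h => by rw [h, Units.val_one]⟩

theorem exists_perm_of_map_eq {ι γ : Type*} [Fintype ι] {f g : ι → γ}
    (h : Finset.univ.val.map f = Finset.univ.val.map g) : ∃ σ : Equiv.Perm ι, g ∘ σ = f := by
  classical
  have hc : ∀ c, Nonempty ({i // f i = c} ≃ {i // g i = c}) := by
    intro c
    refine ⟨Fintype.equivOfCardEq ?_⟩
    have := congrArg (Multiset.count c) h
    rw [Multiset.count_map, Multiset.count_map] at this
    rw [Fintype.card_subtype, Fintype.card_subtype]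
    simpa only [eq_comm, Finset.card_def, Finset.filter_val] using this
  exact ⟨Equiv.ofFiberEquiv fun c => (hc c).some, funext fun i => Equiv.ofFiberEquiv_map _ i⟩

/-- Congruent forms have conjugate asymmetries, hence equal characteristic polynomials. Conversely,
permuting the basis makes the diagonal asymmetries equal, and equal asymmetries suffice over k. -/
theorem congr_form_diagGL_iff [IsAlgClosed k] (p : ℕ) [Fact p.Prime] [CharP k p] (hp2 : p ≠ 2)
    (d d' : Fin n → kˣ) : Congr (form (diagGL d)) (form (diagGL d')) ↔
      Finset.univ.val.map (asym d) = Finset.univ.val.map (asym d') := by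
  constructor
  · rintro ⟨h, g, hgh, hhg, e⟩
    have h1 := asymmetry_eq_of_eq (isUnit_det_form _) (form_diagGL_transpose d)
      (form_diagGL_transpose d') hhg e
    have h2 := congrArg Matrix.charpoly h1
    rw [Matrix.charpoly_mul_comm, ← mul_assoc, hhg, one_mul, Matrix.charpoly_diagonal,
      Matrix.charpoly_diagonal] at h2
    have h3 := congrArg Polynomial.roots h2
    have h4 : ∀ s : Fin n → kˣ, (∏ i, (Polynomial.X - Polynomial.C (s i : k))).roots =
        (Finset.univ.val.map s).map Units.val := by
      intro s
      rw [Multiset.map_map]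
      exact Polynomial.roots_multiset_prod_X_sub_C (Finset.univ.val.map fun i => (s i : k)) ▸ by
        rw [Multiset.map_map]; rfl
    rw [h4, h4] at h3
    exact (Multiset.map_injective Units.val_injective h3).symm
  · intro h
    obtain ⟨σ, hσ⟩ := exists_perm_of_map_eq h.symm
    refine (congr_submatrix (form (diagGL d)) σ).trans ?_
    refine congr_of_asymmetry_eq_of_isAlgClosed p hp2 ?_ (isUnit_det_form _) ?_
      (form_diagGL_transpose d')
    · rw [Matrix.det_submatrix_equiv_self]
      exact isUnit_det_form _
    · rw [Matrix.transpose_submatrix, form_diagGL_transpose, ← hσ]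
      ext i j
      simp [Matrix.mul_diagonal]

theorem sum_fin_eq_sum_half {M : Type*} [AddCommMonoid M] (f : Fin n → M) :
    ∑ i, f i = ∑ j : Fin (n / 2), f (Fin.castLE (Nat.div_le_self n 2) j) +
      ∑ j : Fin (n / 2), f (Fin.castLE (Nat.div_le_self n 2) j).rev +
      ∑ i : {i : Fin n // ¬ i.val < n / 2 ∧ ¬ i.rev.val < n / 2}, f i := by
  let φ : (Fin (n / 2) ⊕ Fin (n / 2)) ⊕ {i : Fin n // ¬ i.val < n / 2 ∧ ¬ i.rev.val < n / 2} →
      Fin n := Sum.elim (Sum.elim (Fin.castLE (Nat.div_le_self n 2))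
        fun j => (Fin.castLE (Nat.div_le_self n 2) j).rev) Subtype.val
  have hφ : Function.Bijective φ := by
    constructor
    · rintro ((i | i) | i) ((j | j) | j) h <;>
        have h' := congrArg Fin.val h <;>
        have hi := i.2 <;> have hj := j.2 <;>
        simp only [φ, Sum.elim_inl, Sum.elim_inr, Fin.val_rev, Fin.val_castLE] at h' hi hj <;>
        first
        | (congr 2; omega)
        | (congr 1; ext; omega)
    · intro i
      by_cases h1 : i.val < n / 2
      · exact ⟨.inl (.inl ⟨i, h1⟩), rfl⟩
      · by_cases h2 : i.rev.val < n / 2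
        · exact ⟨.inl (.inr ⟨i.rev, h2⟩), Fin.rev_rev i⟩
        · exact ⟨.inr ⟨i, h1, h2⟩, rfl⟩
  rw [← hφ.sum_comp, Fintype.sum_sum_type, Fintype.sum_sum_type]
  rfl

variable (n k) in
/-- The sign in the asymmetry of the form attached to `[a₁, …, a_m]σ`. -/
def asymSign : kˣ := if Even n then -1 else 1

theorem asymSign_mul_self : asymSign n k * asymSign n k = 1 := by
  unfold asymSign
  split_ifs <;> simp

theorem gramSign_div (j : Fin n) (hj : j.val < n / 2) :
    gramSign n k j / gramSign n k j.rev = asymSign n k := by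
  unfold gramSign asymSign
  have h := Fin.val_rev j
  by_cases hn : Even n
  · have hn2 : n % 2 = 0 := Nat.even_iff.1 hn
    simp only [if_pos hn]
    rw [if_pos (by omega), if_neg (by omega), one_div, inv_neg, inv_one]
  · rw [if_neg hn, if_neg hn, if_neg hn, div_one]

/-- The diagonal entries of `[a₁, …, a_m]`. -/
def symEntry (a : Fin (n / 2) → kˣ) (i : Fin n) : kˣ :=
  if h : i.val < n / 2 then a ⟨i.val, h⟩
  else if h' : (Fin.rev i).val < n / 2 then (a ⟨(Fin.rev i).val, h'⟩)⁻¹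
  else 1

theorem asym_symEntry (a : Fin (n / 2) → kˣ) (j : Fin (n / 2)) :
    asym (symEntry a) (Fin.castLE (Nat.div_le_self n 2) j) = asymSign n k * a j ^ 2 := by
  have hj : (Fin.castLE (Nat.div_le_self n 2) j).val < n / 2 := j.isLt
  have h1 : symEntry a (Fin.castLE (Nat.div_le_self n 2) j) = a j := dif_pos hj
  have h2 : symEntry a (Fin.castLE (Nat.div_le_self n 2) j).rev = (a j)⁻¹ := by
    rw [symEntry, dif_neg, dif_pos]
    · simp only [Fin.rev_rev]
      rfl
    · rw [Fin.rev_rev]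
      exact hj
    · rw [Fin.val_rev]
      omega
  rw [asym, mul_div_mul_comm, gramSign_div _ hj, h1, h2, div_inv_eq_mul, mul_comm, pow_two]

theorem asym_eq_one_of_middle (d : Fin n → kˣ) {i : Fin n} (h1 : ¬ i.val < n / 2)
    (h2 : ¬ i.rev.val < n / 2) : asym d i = 1 := by
  have : i.rev = i := by
    ext
    rw [Fin.val_rev] at h2 ⊢
    omega
  rw [asym, this, div_self']

/-- Only the asymmetry matters, and its entries at j and rev j are inverse to each other; take a_j
to be a square root of the entry at j up to the sign `asymSign`. -/
theorem exists_congr_symDiag [IsAlgClosed k] (p : ℕ) [Fact p.Prime] [CharP k p] (hp2 : p ≠ 2)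
    (d : Fin n → kˣ) : ∃ a : Fin (n / 2) → kˣ, Congr (form (diagGL d)) (form (symDiag a)) := by
  have hsq : ∀ c : kˣ, ∃ b : kˣ, b ^ 2 = c := by
    intro c
    obtain ⟨z, hz⟩ := IsAlgClosed.exists_pow_nat_eq (c : k) (n := 2) two_pos
    have hz0 : z ≠ 0 := by
      rintro rfl
      exact c.ne_zero (by rw [← hz]; simp)
    exact ⟨Units.mk0 z hz0, Units.ext (by simpa using hz)⟩
  choose r hr using hsq
  refine ⟨fun j => r (asymSign n k * asym d (Fin.castLE (Nat.div_le_self n 2) j)), ?_⟩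
  set a : Fin (n / 2) → kˣ :=
    fun j => r (asymSign n k * asym d (Fin.castLE (Nat.div_le_self n 2) j)) with ha
  refine (congr_form_diagGL_iff p hp2 d (symEntry a)).2
    (congrArg (fun s => Finset.univ.val.map s) (funext fun i => ?_))
  have hlt : ∀ i : Fin n, i.val < n / 2 → asym d i = asym (symEntry a) i := by
    intro i h1
    have := asym_symEntry a ⟨i, h1⟩
    rw [ha, hr, ← mul_assoc, asymSign_mul_self, one_mul] at this
    exact this.symm
  by_cases h1 : i.val < n / 2
  · exact hlt i h1
  · by_cases h2 : i.rev.val < n / 2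
    · have := hlt _ h2
      rw [asym_rev, asym_rev] at this
      exact inv_injective this
    · rw [asym_eq_one_of_middle d h1 h2, asym_eq_one_of_middle _ h1 h2]

/-- Squaring removes the sign, so `hat a` records a² up to inversion, which is what the asymmetry
sees. -/
theorem hat_eq_hat_iff (a b : kˣ) :
    hat a = hat b ↔ a ^ 2 = b ^ 2 ∨ (a ^ 2)⁻¹ = b ^ 2 := by
  rw [hat, hat, Quotient.eq]
  change (b = a ∨ b = -a ∨ b = a⁻¹ ∨ b = -a⁻¹) ↔ _
  have hsq : ∀ x y : kˣ, x ^ 2 = y ^ 2 ↔ y = x ∨ y = -x := by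
    intro x y
    simp only [Units.ext_iff, Units.val_pow_eq_pow_val, Units.val_neg]
    rw [eq_comm, sq_eq_sq_iff_eq_or_eq_neg]
  rw [← inv_pow, hsq, hsq]
  tauto

-- Each a_j contributes the two eigenvalues ±a_j² and ±a_j⁻², with the sign `asymSign`. These
-- coincide when b⁴ = 1, whence the factor 2; the last sum accounts for the middle index, whose
-- asymmetry is 1.
open Classical in
theorem count_asym_symEntry (a : Fin (n / 2) → kˣ) (b : kˣ) :
    (Finset.univ.val.map (asym (symEntry a))).count (asymSign n k * b ^ 2) =
      (if (b ^ 2) ^ 2 = 1 then 2 else 1) * {j | hat (a j) = hat b}.ncard +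
      ∑ _i : {i : Fin n // ¬ i.val < n / 2 ∧ ¬ i.rev.val < n / 2},
        if 1 = asymSign n k * b ^ 2 then 1 else 0 := by
  have hcount : (Finset.univ.val.map (asym (symEntry a))).count (asymSign n k * b ^ 2) =
      ∑ i, if asym (symEntry a) i = asymSign n k * b ^ 2 then 1 else 0 := by
    rw [Multiset.count_map, ← Finset.card_filter, Finset.card_def, Finset.filter_val]
    simp only [eq_comm]
  rw [hcount, sum_fin_eq_sum_half, ← Finset.sum_add_distrib]
  congr 1
  · rw [Set.ncard_eq_toFinset_card', Set.toFinset_ofPred, Finset.card_filter, Finset.mul_sum]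
    refine Finset.sum_congr rfl fun j _ => ?_
    have hs : (asymSign n k)⁻¹ = asymSign n k := inv_eq_of_mul_eq_one_right asymSign_mul_self
    rw [asym_rev, asym_symEntry, mul_inv, hs]
    simp only [hat_eq_hat_iff, mul_right_inj]
    by_cases hb : (b ^ 2) ^ 2 = 1
    · have hb' : (b ^ 2)⁻¹ = b ^ 2 := inv_eq_of_mul_eq_one_right (by rw [← pow_two, hb])
      have hiff : (a j ^ 2)⁻¹ = b ^ 2 ↔ a j ^ 2 = b ^ 2 := by rw [inv_eq_iff_eq_inv, hb']
      simp only [if_pos hb, hiff, or_self, two_mul]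
    · rw [if_neg hb, one_mul]
      by_cases h1 : a j ^ 2 = b ^ 2
      · have h2 : ¬ (b ^ 2)⁻¹ = b ^ 2 := fun h => hb (by rw [pow_two]; nth_rw 1 [← h]; simp)
        simp [h1, h2]
      · simp [h1]
  · refine Finset.sum_congr rfl fun i _ => ?_
    rw [asym_eq_one_of_middle _ i.2.1 i.2.2]

/-- `[a₁, …, a_m]σ` and `[a'₁, …, a'_m]σ` are conjugate if and only if the multisets of the
`â_j` and `â'_j` coincide. -/
theorem congr_form_symDiag_iff [IsAlgClosed k] (p : ℕ) [Fact p.Prime] [CharP k p] (hp2 : p ≠ 2)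
    (a a' : Fin (n / 2) → kˣ) : Congr (form (symDiag a)) (form (symDiag a')) ↔
      ∀ y : KHat k, {j | hat (a j) = y}.ncard = {j | hat (a' j) = y}.ncard := by
  classical
  refine (congr_form_diagGL_iff p hp2 (symEntry a) (symEntry a')).trans ?_
  have key : ∀ b : kˣ, (Finset.univ.val.map (asym (symEntry a))).count (asymSign n k * b ^ 2) =
      (Finset.univ.val.map (asym (symEntry a'))).count (asymSign n k * b ^ 2) ↔
      {j | hat (a j) = hat b}.ncard = {j | hat (a' j) = hat b}.ncard := by
    intro b
    rw [count_asym_symEntry, count_asym_symEntry, Nat.add_right_cancel_iff]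
    split_ifs <;> simp
  constructor
  · intro h y
    induction y using Quotient.inductionOn with
    | h b => exact (key b).1 (by rw [h])
  · intro h
    ext c
    obtain ⟨z, hz⟩ := IsAlgClosed.exists_pow_nat_eq ((asymSign n k * c : kˣ) : k) (n := 2) two_pos
    have hz0 : z ≠ 0 := by
      rintro rfl
      exact (asymSign n k * c).ne_zero (by rw [← hz]; simp)
    have hc : asymSign n k * Units.mk0 z hz0 ^ 2 = c := by
      have : Units.mk0 z hz0 ^ 2 = asymSign n k * c := Units.ext (by simpa using hz)
      rw [this, ← mul_assoc, asymSign_mul_self, one_mul]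
    rw [← hc]
    convert (key _).2 (h _)

theorem det_form_symDiag_sub_transpose_eq_zero_iff (a : Fin (n / 2) → kˣ) :
    (form (symDiag a) - (form (symDiag a))ᵀ).det = 0 ↔
      Odd n ∨ (Even n ∧ ∃ j, a j ^ 2 = -1) := by
  refine (det_form_diagGL_sub_transpose_eq_zero_iff (symEntry a)).trans ?_
  by_cases hn : Even n
  · have hs : asymSign n k = -1 := if_pos hn
    rw [or_iff_right (Nat.not_odd_iff_even.2 hn), and_iff_right hn]
    have h1 : ∀ x : kˣ, asymSign n k * x = 1 ↔ x = -1 := fun x => by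
      rw [hs, neg_one_mul, neg_eq_iff_eq_neg]
    constructor
    · rintro ⟨i, hi⟩
      by_cases h2 : i.val < n / 2
      · have := asym_symEntry a ⟨i, h2⟩
        exact ⟨⟨i, h2⟩, (h1 _).1 (by rw [← this]; exact hi)⟩
      · have h3 : i.rev.val < n / 2 := by
          obtain ⟨r, rfl⟩ := hn
          rw [Fin.val_rev]
          omega
        have := asym_symEntry a ⟨i.rev, h3⟩
        exact ⟨⟨i.rev, h3⟩, (h1 _).1 (by
          rw [← this]
          refine (asym_rev _ i).trans ?_
          rw [hi, inv_one])⟩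
    · rintro ⟨j, hj⟩
      exact ⟨_, (asym_symEntry a j).trans ((h1 _).2 hj)⟩
  · have hn' := Nat.not_even_iff_odd.1 hn
    refine iff_of_true ?_ (Or.inl hn')
    obtain ⟨r, hr⟩ := hn'
    exact ⟨⟨n / 2, by omega⟩, asym_eq_one_of_middle _ (by simp) (by rw [Fin.val_rev]; simp; omega)⟩

end Asymmetry

/-! ### Frobenius orbits and the combinatorial data -/

section Orbits

theorem neg_one_ne_one_units {K k : Type*} [Field K] [Field k] [Algebra K k]
    (hK : ringChar K ≠ 2) : (-1 : kˣ) ≠ 1 := by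
  intro h
  have h1 : (-1 : k) = 1 := by simpa using congrArg Units.val h
  have h2 : algebraMap K k (-1) = algebraMap K k 1 := by simpa using h1
  exact Ring.neg_one_ne_one_of_char_ne_two hK ((algebraMap K k).injective h2)

variable {K : Type*} [Field K] [Fintype K] {k : Type*} [Field k] [Algebra K k]
  [Algebra.IsAlgebraic K k]

theorem frobHat_hat (a : kˣ) : frobHat K k (hat a) = hat (a ^ Fintype.card K) := rfl

theorem frobHat_pow_hat (a : kˣ) (s : ℕ) :
    (frobHat K k ^ s) (hat a) = hat (a ^ Fintype.card K ^ s) := by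
  induction s with
  | zero => simp
  | succ s ih => rw [pow_succ', Equiv.Perm.mul_apply, ih, frobHat_hat, ← pow_mul, ← pow_succ]

theorem exists_pow_card_pow_eq {ι : Type*} [Finite ι] (z : ι → k) :
    ∃ s, 0 < s ∧ ∀ i, z i ^ Fintype.card K ^ s = z i := by
  let L : IntermediateField K k := IntermediateField.adjoin K (Set.range z)
  have hfin : FiniteDimensional K L := by
    have := (Set.finite_range z).to_subtype
    exact IntermediateField.finiteDimensional_adjoin fun x _ =>
      (Algebra.IsAlgebraic.isAlgebraic x).isIntegral
  have hL : Finite L := Module.finite_of_finite K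
  have := Fintype.ofFinite L
  refine ⟨Module.finrank K L, Module.finrank_pos, fun i => ?_⟩
  have h := FiniteField.pow_card (⟨z i, IntermediateField.subset_adjoin K _ ⟨i, rfl⟩⟩ : L)
  rw [Module.card_eq_pow_finrank (K := K)] at h
  exact congrArg Subtype.val h

theorem orb_eq_orb_iff {y y' : KHat k} : orb K y = orb K y' ↔ (frobHat K k).SameCycle y y' :=
  Quotient.eq

theorem orb_frobHat (y : KHat k) : orb K (frobHat K k y) = orb K y :=
  orb_eq_orb_iff.2 (Equiv.Perm.sameCycle_apply_left.2 (Equiv.Perm.SameCycle.refl _ _))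

/-- An element of k* is fixed by some positive power of the Frobenius, so finitely many powers
exhaust its orbit. -/
theorem finite_orb_eq (x : PhiStar K k) : {y : KHat k | orb K y = x}.Finite := by
  induction x using Quotient.inductionOn with
  | h y₀ =>
    induction y₀ using Quotient.inductionOn with
    | h a =>
      obtain ⟨s, hs, ha⟩ := exists_pow_card_pow_eq (K := K) fun _ : Unit => (a : k)
      have ha' : (frobHat K k ^ s) (hat a) = hat a := by
        rw [frobHat_pow_hat]
        congr 1
        exact Units.ext (by simpa using ha ())
      refine ((Finset.range s).finite_toSet.image fun i => (frobHat K k ^ i) (hat a)).subset ?_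
      intro y hy
      obtain ⟨i, hi⟩ := (orb_eq_orb_iff.1 hy).symm
      have hs' : (0 : ℤ) < s := by exact_mod_cast hs
      refine ⟨(i % s).toNat, ?_, ?_⟩
      · rw [Finset.mem_coe, Finset.mem_range]
        have := Int.emod_lt_of_pos i hs'
        omega
      · have h1 := Int.emod_nonneg i hs'.ne'
        change (frobHat K k ^ (i % s).toNat) (hat a) = y
        rw [← zpow_natCast, Int.toNat_of_nonneg h1, ← hi]
        conv_rhs => rw [← Int.emod_add_mul_ediv i s, zpow_add, zpow_mul, zpow_natCast]
        rw [Equiv.Perm.mul_apply]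
        congr 1
        exact (Equiv.Perm.zpow_apply_eq_self_of_apply_eq_self ha' _).symm

theorem eq_of_orb_eq_of_fixed {y y' : KHat k} (hy : frobHat K k y = y)
    (h : orb K y' = orb K y) : y' = y := by
  obtain ⟨i, hi⟩ := (orb_eq_orb_iff.1 h).symm
  rw [← hi]
  exact Equiv.Perm.zpow_apply_eq_self_of_apply_eq_self hy i

theorem frobHat_hat_one : frobHat K k (hat 1) = hat 1 := by rw [frobHat_hat, one_pow]

theorem eq_of_orb_eq_orbOne {y : KHat k} (h : orb K y = orbOne K k) : y = hat 1 :=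
  eq_of_orb_eq_of_fixed frobHat_hat_one h

variable [IsAlgClosed k]

theorem imag_sq : imag k ^ 2 = -1 := (exists_sq_eq_neg_one k).choose_spec

theorem hat_eq_hat_imag_iff (a : kˣ) : hat a = hat (imag k) ↔ a ^ 2 = -1 := by
  rw [hat_eq_hat_iff, imag_sq, inv_eq_iff_eq_inv, inv_neg, inv_one, or_self]

theorem hat_one_ne_hat_imag {K k : Type*} [Field K] [Field k] [Algebra K k] [IsAlgClosed k]
    (hK : ringChar K ≠ 2) : hat 1 ≠ hat (imag k) := fun h =>
  neg_one_ne_one_units hK (by rw [← (hat_eq_hat_imag_iff _).1 h, one_pow])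

theorem frobHat_hat_imag (hK : ringChar K ≠ 2) : frobHat K k (hat (imag k)) = hat (imag k) := by
  rw [frobHat_hat, hat_eq_hat_imag_iff, ← pow_mul, mul_comm, pow_mul, imag_sq]
  exact (Nat.odd_iff.2 (FiniteField.odd_card_of_char_ne_two hK)).neg_one_pow

theorem eq_of_orb_eq_orbI (hK : ringChar K ≠ 2) {y : KHat k} (h : orb K y = orbI K k) :
    y = hat (imag k) :=
  eq_of_orb_eq_of_fixed (frobHat_hat_imag hK) h

theorem orbOne_ne_orbI (hK : ringChar K ≠ 2) : orbOne K k ≠ orbI K k := fun h =>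
  hat_one_ne_hat_imag hK (eq_of_orb_eq_orbI hK h)

theorem eigMult_hat_one (f : PhiStar K k →₀ ℕ) : eigMult f (hat 1) = f (orbOne K k) / 2 :=
  if_pos (Or.inl rfl)

theorem eigMult_hat_imag (f : PhiStar K k →₀ ℕ) :
    eigMult f (hat (imag k)) = f (orbI K k) / 2 :=
  if_pos (Or.inr rfl)

theorem eigMult_frobHat (hK : ringChar K ≠ 2) (f : PhiStar K k →₀ ℕ) (y : KHat k) :
    eigMult f (frobHat K k y) = eigMult f y := by
  have h1 : frobHat K k y = hat 1 ↔ y = hat 1 := by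
    rw [← (frobHat K k).injective.eq_iff (a := y), frobHat_hat_one]
  have h2 : frobHat K k y = hat (imag k) ↔ y = hat (imag k) := by
    rw [← (frobHat K k).injective.eq_iff (a := y), frobHat_hat_imag hK]
  by_cases h : y = hat 1 ∨ y = hat (imag k)
  · rw [eigMult, eigMult, if_pos h, if_pos (by rwa [h1, h2]), orb_frobHat]
  · rw [eigMult, eigMult, if_neg h, if_neg (by rwa [h1, h2]), orb_frobHat]

open Classical in
/-- The multiplicities attached to `f`, as a finitely supported function. -/
noncomputable def eigFinsupp (f : PhiStar K k →₀ ℕ) : KHat k →₀ ℕ :=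
  Finsupp.onFinset (f.support.biUnion fun x => (finite_orb_eq x).toFinset) (eigMult f) (by
    intro y hy
    rw [Finset.mem_biUnion]
    refine ⟨orb K y, ?_, by simp⟩
    rw [Finsupp.mem_support_iff]
    intro h0
    apply hy
    unfold eigMult
    rw [h0]
    simp)

/-- An ordinary orbit x carries f(x)|x| in total multiplicity. The two special classes are fixed
points whose multiplicities are halved, which leaves the two remainders. -/
theorem phiNorm_eq (hK : ringChar K ≠ 2) (f : PhiStar K k →₀ ℕ) :
    phiNorm f = 2 * (eigFinsupp f).sum (fun _ => id) + f (orbOne K k) % 2 + f (orbI K k) % 2 := by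
  classical
  set T : Finset (PhiStar K k) := insert (orbOne K k) (insert (orbI K k) f.support) with hT
  set S : Finset (KHat k) := T.biUnion fun x => (finite_orb_eq x).toFinset with hS
  have hsum : (eigFinsupp f).sum (fun _ => id) = ∑ y ∈ S, eigMult f y := by
    refine Finsupp.onFinset_sum _ (fun _ => rfl) |>.trans (Finset.sum_subset ?_ ?_)
    · refine Finset.biUnion_subset_biUnion_of_subset_left _ ?_
      exact (Finset.subset_insert _ _).trans (Finset.subset_insert _ _)
    · intro y _ hy
      by_contra h
      have := Finsupp.mem_support_iff.2 (show eigFinsupp f y ≠ 0 from h)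
      exact hy (Finsupp.support_onFinset_subset this)
  have hfib : ∑ y ∈ S, eigMult f y =
      ∑ x ∈ T, ∑ y ∈ (finite_orb_eq x).toFinset, eigMult f y := by
    refine Finset.sum_biUnion fun x _ x' _ hxx' => Finset.disjoint_left.2 fun y hy hy' => hxx' ?_
    rw [Set.Finite.mem_toFinset] at hy hy'
    exact hy.symm.trans hy'
  have hE : ∀ x, x ≠ orbOne K k → x ≠ orbI K k →
      ∑ y ∈ (finite_orb_eq x).toFinset, eigMult f y = f x * orbSize x := by
    intro x h1 h2
    rw [Finset.sum_congr rfl (g := fun _ => f x), Finset.sum_const, smul_eq_mul, mul_comm, orbSize,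
      Set.ncard_eq_toFinset_card _ (finite_orb_eq x)]
    intro y hy
    rw [Set.Finite.mem_toFinset] at hy
    have hy' : orb K y = x := hy
    rw [eigMult, if_neg, hy']
    rintro (rfl | rfl)
    · exact h1 hy'.symm
    · exact h2 hy'.symm
  have hfix : ∀ y₀ : KHat k, frobHat K k y₀ = y₀ →
      ∑ y ∈ (finite_orb_eq (orb K y₀)).toFinset, eigMult f y = eigMult f y₀ := by
    intro y₀ h0
    rw [show (finite_orb_eq (orb K y₀)).toFinset = {y₀} from ?_, Finset.sum_singleton]
    ext y
    rw [Set.Finite.mem_toFinset, Finset.mem_singleton]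
    exact ⟨fun h => eq_of_orb_eq_of_fixed h0 h, fun h => by rw [h]; rfl⟩
  have h1 : orbOne K k ∉ insert (orbI K k) ((f.support.erase (orbOne K k)).erase (orbI K k)) := by
    simp [orbOne_ne_orbI hK]
  have hTe : T = insert (orbOne K k) (insert (orbI K k)
      ((f.support.erase (orbOne K k)).erase (orbI K k))) := by
    ext x
    simp only [hT, Finset.mem_insert, Finset.mem_erase]
    tauto
  rw [hsum, hfib, hTe, Finset.sum_insert h1, Finset.sum_insert (by simp), orbOne, orbI,
    hfix _ frobHat_hat_one, hfix _ (frobHat_hat_imag hK), eigMult_hat_one, eigMult_hat_imag,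
    Finset.sum_congr rfl (g := fun x => f x * orbSize x), phiNorm]
  · have h3 : ∑ x ∈ (f.support.erase (orbOne K k)).erase (orbI K k), 2 * f x * orbSize x =
        2 * ∑ x ∈ (f.support.erase (orbOne K k)).erase (orbI K k), f x * orbSize x := by
      rw [Finset.mul_sum]
      simp only [mul_assoc]
    rw [h3]
    simp only [orbOne, orbI]
    omega
  · intro x hx
    rw [Finset.mem_erase, Finset.mem_erase] at hx
    exact hE x hx.2.1 hx.1

variable {n : ℕ}

theorem TBar.even_orbI (hK : ringChar K ≠ 2) (t : TBar K k n) : t.1 (orbI K k) % 2 = 0 := by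
  have h1 := phiNorm_eq hK t.1
  have h2 := t.2.1
  rw [t.2.2] at h1
  omega

theorem TBar.sum_eigFinsupp (hK : ringChar K ≠ 2) (t : TBar K k n) :
    (eigFinsupp t.1).sum (fun _ => id) = n / 2 := by
  have h1 := phiNorm_eq hK t.1
  have h2 := t.2.1
  rw [t.2.2] at h1
  omega

theorem exists_fiber_ncard_eq {α β : Type*} {π : α → β} (hπ : Function.Surjective π) {m : ℕ}
    (c : β →₀ ℕ) (hc : c.sum (fun _ => id) = m) :
    ∃ a : Fin m → α, ∀ y, {j | π (a j) = y}.ncard = c y := by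
  classical
  obtain ⟨l, hl⟩ := Quotient.exists_rep (Finsupp.toMultiset c)
  have hlen : l.length = m := by
    rw [← hc, ← Finsupp.card_toMultiset, ← hl]
    rfl
  subst hlen
  choose r hr using hπ
  refine ⟨fun j => r (l.get j), fun y => ?_⟩
  simp only [hr]
  rw [← Finsupp.count_toMultiset, ← hl]
  change _ = Multiset.count y (l : Multiset β)
  have h1 : (l : Multiset β) = Finset.univ.val.map l.get := by
    rw [Fin.univ_val_map, List.ofFn_get]
  rw [h1, Multiset.count_map, Set.ncard_eq_toFinset_card', Set.toFinset_ofPred, Finset.card_def,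
    Finset.filter_val]
  simp only [eq_comm]

theorem exists_ncard_eq_eigMult (hK : ringChar K ≠ 2) (t : TBar K k n) :
    ∃ a : Fin (n / 2) → kˣ, ∀ y, {j | hat (a j) = y}.ncard = eigMult t.1 y :=
  exists_fiber_ncard_eq Quotient.mk_surjective (eigFinsupp t.1) (t.sum_eigFinsupp hK)

/-- Halving loses only a parity, and both parities are known: f(1̂) has that of n and f(î) is even.
-/
theorem eigMult_injective (hK : ringChar K ≠ 2) {t t' : TBar K k n}
    (h : ∀ y, eigMult t.1 y = eigMult t'.1 y) : t = t' := by
  refine Subtype.ext (Finsupp.ext fun x => ?_)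
  induction x using Quotient.inductionOn with
  | h y =>
    change t.1 (orb K y) = t'.1 (orb K y)
    by_cases h1 : y = hat 1
    · have h2 := h (hat 1)
      rw [eigMult_hat_one, eigMult_hat_one] at h2
      have h3 := t.2.1
      have h4 := t'.2.1
      rw [h1]
      change t.1 (orbOne K k) = t'.1 (orbOne K k)
      omega
    · by_cases h2 : y = hat (imag k)
      · have h3 := h (hat (imag k))
        rw [eigMult_hat_imag, eigMult_hat_imag] at h3
        have h4 := t.even_orbI hK
        have h5 := t'.even_orbI hK
        rw [h2]
        change t.1 (orbI K k) = t'.1 (orbI K k)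
        omega
      · have h3 := h y
        rwa [eigMult, eigMult, if_neg (by tauto), if_neg (by tauto)] at h3

/-- Multiplicities that are invariant under the Frobenius come from a unique element of `TBar`. -/
theorem exists_eigMult_eq (hK : ringChar K ≠ 2) (a : Fin (n / 2) → kˣ)
    (ha : ∀ y, {j | hat (a j) = frobHat K k y}.ncard = {j | hat (a j) = y}.ncard) :
    ∃ t : TBar K k n, ∀ y, {j | hat (a j) = y}.ncard = eigMult t.1 y := by
  classical
  set c : KHat k → ℕ := fun y => {j | hat (a j) = y}.ncard with hc
  have hcyc : ∀ y y' : KHat k, (frobHat K k).SameCycle y y' → c y = c y' := by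
    rintro y y' ⟨i, rfl⟩
    induction i using Int.induction_on generalizing y with
    | zero => rfl
    | succ i ih => rw [zpow_add_one, Equiv.Perm.mul_apply, ← ih]; exact (ha y).symm
    | pred i ih =>
      rw [zpow_sub_one, Equiv.Perm.mul_apply, ← ih]
      have := ha ((frobHat K k)⁻¹ y)
      rwa [show frobHat K k ((frobHat K k)⁻¹ y) = y from (frobHat K k).apply_symm_apply y] at this
  let c' : PhiStar K k → ℕ := fun x => Quotient.liftOn x c fun y y' h => hcyc y y' h
  -- This undoes the halving at the two special orbits; the term n % 2 at 1̂ accounts for the middle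
  -- entry 1 of the diagonal matrix.
  let F : PhiStar K k → ℕ := fun x =>
    if x = orbOne K k then 2 * c' x + n % 2 else if x = orbI K k then 2 * c' x else c' x
  let f : PhiStar K k →₀ ℕ := Finsupp.onFinset
    (insert (orbOne K k) (Finset.univ.image fun j => orb K (hat (a j)))) F (by
      intro x hx
      rw [Finset.mem_insert]
      by_contra! hx'
      apply hx
      have h0 : c' x = 0 := by
        induction x using Quotient.inductionOn with
        | h y =>
          change {j | hat (a j) = y}.ncard = 0
          rw [Set.ncard_eq_zero]
          refine Set.eq_empty_of_forall_notMem fun j hj => hx'.2 ?_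
          rw [Finset.mem_image]
          exact ⟨j, Finset.mem_univ _, by rw [show hat (a j) = y from hj]; rfl⟩
      simp [F, hx'.1, h0])
  have hf1 : f (orbOne K k) = 2 * c (hat 1) + n % 2 := if_pos rfl
  have hfi : f (orbI K k) = 2 * c (hat (imag k)) :=
    (if_neg (orbOne_ne_orbI hK).symm).trans (if_pos rfl)
  have heig : ∀ y, eigMult f y = c y := by
    intro y
    by_cases h1 : y = hat 1
    · rw [h1, eigMult_hat_one, hf1]
      omega
    · by_cases h2 : y = hat (imag k)
      · rw [h2, eigMult_hat_imag, hfi]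
        omega
      · rw [eigMult, if_neg (by tauto)]
        exact (if_neg fun h => h1 (eq_of_orb_eq_orbOne h)).trans
          (if_neg fun h => h2 (eq_of_orb_eq_orbI hK h))
  have hsum : (eigFinsupp f).sum (fun _ => id) = n / 2 := by
    have h1 : (eigFinsupp f).sum (fun _ => id) =
        ∑ y ∈ Finset.univ.image fun j => hat (a j), c y := by
      refine (Finsupp.sum_of_support_subset _ ?_ _ fun _ _ => rfl).trans
        (Finset.sum_congr rfl fun y _ => heig y)
      intro y hy
      rw [Finsupp.mem_support_iff] at hy
      have hy' : c y ≠ 0 := by rw [← heig]; exact hy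
      obtain ⟨j, hj⟩ := Set.nonempty_of_ncard_ne_zero hy'
      exact Finset.mem_image.2 ⟨j, Finset.mem_univ _, hj⟩
    rw [h1]
    have h2 := Finset.card_eq_sum_card_image (fun j => hat (a j)) Finset.univ
    rw [Finset.card_univ, Fintype.card_fin] at h2
    refine Eq.trans (Finset.sum_congr rfl fun y _ => ?_) h2.symm
    change {j | hat (a j) = y}.ncard = _
    rw [Set.ncard_eq_toFinset_card', Set.toFinset_ofPred]
  refine ⟨⟨f, ?_, ?_⟩, fun y => (heig y).symm⟩
  · rw [hf1]
    omega
  · rw [phiNorm_eq hK, hsum, hf1, hfi]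
    omega

/-- Both sides say that the asymmetry has the eigenvalue 1. For n odd both hold automatically, since
f(1̂) is odd; for n even both say that some a_j has square -1. -/
theorem orthNontrivial_iff (hK : ringChar K ≠ 2) (t : TBar K k n) (a : Fin (n / 2) → kˣ)
    (ha : ∀ y, {j | hat (a j) = y}.ncard = eigMult t.1 y) :
    OrthNontrivial t ↔ (form (symDiag a) - (form (symDiag a))ᵀ).det = 0 := by
  rw [det_form_symDiag_sub_transpose_eq_zero_iff, OrthNontrivial]
  have h1 : Odd n → 0 < t.1 (orbOne K k) := fun hn => by
    have h2 := t.2.1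
    have h3 := Nat.odd_iff.1 hn
    omega
  have h2 : 0 < t.1 (orbI K k) ↔ ∃ j, a j ^ 2 = -1 := by
    have h3 := ha (hat (imag k))
    rw [eigMult_hat_imag] at h3
    have h4 := t.even_orbI hK
    have h5 : 0 < t.1 (orbI K k) ↔ 0 < {j | hat (a j) = hat (imag k)}.ncard := by omega
    rw [h5, Set.ncard_pos]
    simp only [hat_eq_hat_imag_iff]
    rfl
  rw [h2]
  tauto

end Orbits

/-! ### Geometric conjugacy classes -/

section GeometricClasses

variable {n : ℕ} {k : Type*} [Field k]

/-- The conjugacy class of `gσ` under `GL_n(k)`. -/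
def geomClass (κ : Kind) (g : GL (Fin n) k) : Set (Bar n k κ) :=
  Set.range fun h : GL (Fin n) k => incl h * (incl g * sig κ) * (incl h)⁻¹

theorem incl_mul_sig_mem_geomClass {κ : Kind} {g g' : GL (Fin n) k} :
    incl g' * sig κ ∈ geomClass κ g ↔ Congr (form g) (form g') := by
  rw [congr_form_iff]
  refine exists_congr fun h => ?_
  dsimp only
  rw [conj_incl_mul_sig, incl_mul_sig_inj]

theorem mem_geomClass_iff {κ : Kind} {g : GL (Fin n) k} {x : Bar n k κ} :
    x ∈ geomClass κ g ↔ ∃ g', x = incl g' * sig κ ∧ Congr (form g) (form g') := by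
  constructor
  · rintro ⟨h, rfl⟩
    exact ⟨_, conj_incl_mul_sig κ h g, congr_form_iff.2 ⟨h, rfl⟩⟩
  · rintro ⟨g', rfl, h⟩
    exact incl_mul_sig_mem_geomClass.2 h

theorem geomClass_eq_iff {κ : Kind} {g g' : GL (Fin n) k} :
    geomClass κ g = geomClass κ g' ↔ Congr (form g) (form g') := by
  constructor
  · intro h
    have h1 : incl g' * sig κ ∈ geomClass κ g := by
      rw [h]
      exact incl_mul_sig_mem_geomClass.2 (Congr.refl _)
    exact incl_mul_sig_mem_geomClass.1 h1
  · intro h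
    ext x
    rw [mem_geomClass_iff, mem_geomClass_iff]
    exact exists_congr fun g'' => and_congr_right fun _ => ⟨h.symm.trans, h.trans⟩

theorem isQuasiSemisimple_iff_exists_congr_symDiag [IsAlgClosed k] (p : ℕ) [Fact p.Prime]
    [CharP k p] (hp2 : p ≠ 2) (κ : Kind) (g : GL (Fin n) k) :
    IsQuasiSemisimple (incl g * sig κ) ↔
      ∃ a : Fin (n / 2) → kˣ, Congr (form g) (form (symDiag a)) := by
  rw [isQuasiSemisimple_iff_exists_diagGL]
  constructor
  · rintro ⟨h, d, hd⟩
    obtain ⟨a, ha⟩ := exists_congr_symDiag p hp2 d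
    exact ⟨a, (congr_form_iff.2 ⟨h, hd⟩).trans ha⟩
  · rintro ⟨a, ha⟩
    obtain ⟨h, hh⟩ := congr_form_iff.1 ha
    exact ⟨h, _, hh⟩

end GeometricClasses

/-! ### Frobenius and rational elements -/

section Frobenius

variable {K : Type*} [Field K] [Fintype K] {k : Type*} [Field k] [Algebra K k] {n : ℕ}

/-- The polynomial X^q - X has at most q roots, and the elements of K already provide q of them. -/
theorem exists_algebraMap_eq_of_pow_card_eq {z : k} (hz : z ^ Fintype.card K = z) :
    ∃ c : K, algebraMap K k c = z := by
  classical
  by_contra! h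
  have h1 : z ∉ Finset.univ.image (algebraMap K k) := by simpa using h
  have hX : (Polynomial.X ^ Fintype.card K - Polynomial.X : Polynomial k) ≠ 0 :=
    FiniteField.X_pow_card_sub_X_ne_zero k Fintype.one_lt_card
  have h2 : insert z (Finset.univ.image (algebraMap K k)) ⊆
      (Polynomial.X ^ Fintype.card K - Polynomial.X : Polynomial k).roots.toFinset := by
    intro x hx
    rw [Multiset.mem_toFinset, Polynomial.mem_roots hX]
    simp only [Polynomial.IsRoot, Polynomial.eval_sub, Polynomial.eval_pow, Polynomial.eval_X,
      sub_eq_zero]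
    rcases Finset.mem_insert.1 hx with rfl | hx
    · exact hz
    · obtain ⟨c, -, rfl⟩ := Finset.mem_image.1 hx
      rw [← map_pow, FiniteField.pow_card]
  have h3 := Finset.card_le_card h2
  rw [Finset.card_insert_of_notMem h1,
    Finset.card_image_of_injective _ (algebraMap K k).injective, Finset.card_univ] at h3
  have h4 := (Multiset.toFinset_card_le _).trans (Polynomial.card_roots'
    (Polynomial.X ^ Fintype.card K - Polynomial.X : Polynomial k))
  rw [FiniteField.X_pow_card_sub_X_natDegree_eq k Fintype.one_lt_card] at h4
  omega

theorem frobGL_apply (g : GL (Fin n) k) (i j : Fin n) :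
    (frobGL K k n g).val i j = g.val i j ^ Fintype.card K := rfl

theorem frobGL_eq_self_iff {g : GL (Fin n) k} :
    frobGL K k n g = g ↔ ∃ A : Matrix (Fin n) (Fin n) K, A.map (algebraMap K k) = g.val := by
  constructor
  · intro h
    have h1 : ∀ i j, ∃ c : K, algebraMap K k c = g.val i j := fun i j =>
      exists_algebraMap_eq_of_pow_card_eq (by rw [← frobGL_apply, h])
    choose A hA using h1
    exact ⟨Matrix.of A, by ext i j; exact hA i j⟩
  · rintro ⟨A, hA⟩
    refine Units.ext (Matrix.ext fun i j => ?_)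
    rw [frobGL_apply, ← hA, Matrix.map_apply, ← map_pow, FiniteField.pow_card]

theorem frobGL_mul_gram_eq_self_iff {g : GL (Fin n) k} :
    frobGL K k n (g * gram n k .standard) = g * gram n k .standard ↔ frobGL K k n g = g := by
  rw [map_mul, frobGL_gram, mul_left_inj]

theorem frobGL_theta (g : GL (Fin n) k) : frobGL K k n (theta g) = theta (frobGL K k n g) :=
  frobGL_extAut K k n .standard g

theorem exists_map_eq_form {g : GL (Fin n) k} (hg : frobGL K k n g = g) :
    ∃ A : Matrix (Fin n) (Fin n) K, A.map (algebraMap K k) = form g ∧ IsUnit A.det := by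
  obtain ⟨A, hA⟩ := frobGL_eq_self_iff.1 (frobGL_mul_gram_eq_self_iff.2 hg)
  refine ⟨A, hA, isUnit_iff_ne_zero.2 fun h0 => (isUnit_det_form g).ne_zero ?_⟩
  rw [form, ← hA, ← RingHom.mapMatrix_apply, ← RingHom.map_det, h0, map_zero]

theorem exists_form_eq_map {A : Matrix (Fin n) (Fin n) K} (hA : IsUnit A.det) :
    ∃ g : GL (Fin n) k, frobGL K k n g = g ∧ form g = A.map (algebraMap K k) := by
  obtain ⟨u, hu⟩ := (Matrix.isUnit_iff_isUnit_det _).2 (isUnit_det_map (algebraMap K k) hA)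
  have hu' : u * (gram n k .standard)⁻¹ * gram n k .standard = u := inv_mul_cancel_right _ _
  refine ⟨u * (gram n k .standard)⁻¹, frobGL_mul_gram_eq_self_iff.1 ?_, ?_⟩
  · rw [hu', frobGL_eq_self_iff]
    exact ⟨A, hu.symm⟩
  · rw [form, hu', hu]

theorem exists_conj_of_congr {g g' : GL (Fin n) k} {A B : Matrix (Fin n) (Fin n) K}
    (hA : A.map (algebraMap K k) = form g) (hB : B.map (algebraMap K k) = form g')
    (hAB : Congr A B) :
    ∃ h : GL (Fin n) k, frobGL K k n h = h ∧ h * g * (theta h)⁻¹ = g' := by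
  obtain ⟨x, y, hyx, hxy, e⟩ := hAB
  let f := algebraMap K k
  have h1 : xᵀ.map f * yᵀ.map f = 1 := by
    rw [← Matrix.map_mul, ← Matrix.transpose_mul, hyx, Matrix.transpose_one,
      Matrix.map_one _ f.map_zero f.map_one]
  have h2 : yᵀ.map f * xᵀ.map f = 1 := by
    rw [← Matrix.map_mul, ← Matrix.transpose_mul, hxy, Matrix.transpose_one,
      Matrix.map_one _ f.map_zero f.map_one]
  let h : GL (Fin n) k := ⟨xᵀ.map f, yᵀ.map f, h1, h2⟩
  refine ⟨h, frobGL_eq_self_iff.2 ⟨_, rfl⟩, form_injective ?_⟩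
  rw [form_mul_theta_inv, ← hB, e, ← hA]
  change xᵀ.map f * A.map f * (xᵀ.map f)ᵀ = _
  rw [Matrix.map_mul, Matrix.map_mul, Matrix.transpose_map, Matrix.transpose_transpose]

theorem det_form (g : GL (Fin n) k) : (form g).det = g.val.det * (gram n k .standard).val.det :=
  Matrix.det_mul _ _

theorem det_gram_ne_zero : (gram n k .standard).val.det ≠ 0 :=
  (Matrix.isUnits_det_units _).ne_zero

theorem frobGL_symDiag (a : Fin (n / 2) → kˣ) :
    frobGL K k n (symDiag a) = symDiag fun j => a j ^ Fintype.card K := by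
  refine Units.ext (Matrix.ext fun i j => ?_)
  rw [frobGL_apply]
  change (Matrix.diagonal fun i => (symEntry a i : k)) i j ^ _ =
    (Matrix.diagonal fun i => (symEntry (fun j => a j ^ Fintype.card K) i : k)) i j
  rw [Matrix.diagonal_apply, Matrix.diagonal_apply]
  split_ifs
  · rw [← Units.val_pow_eq_pow_val]
    congr 1
    unfold symEntry
    split_ifs <;> simp
  · exact zero_pow Fintype.card_ne_zero

variable [Algebra.IsAlgebraic K k]

theorem frobGL_surjective : Function.Surjective (frobGL K k n) := by
  intro g
  let e := FiniteField.frobeniusAlgEquivOfAlgebraic K k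
  refine ⟨Matrix.GeneralLinearGroup.map (e.symm : k →+* k) g, Units.ext (Matrix.ext fun i j => ?_)⟩
  exact e.apply_symm_apply (g.val i j)

theorem frobBar_image_geomClass (κ : Kind) (g : GL (Fin n) k) :
    frobBar K k n κ '' geomClass κ g = geomClass κ (frobGL K k n g) := by
  have h1 : ∀ h : GL (Fin n) k, frobBar K k n κ (incl h * (incl g * sig κ) * (incl h)⁻¹) =
      incl (frobGL K k n h) * (incl (frobGL K k n g) * sig κ) * (incl (frobGL K k n h))⁻¹ := by
    intro h
    rw [conj_incl_mul_sig, frobBar_incl_mul_sig, conj_incl_mul_sig, map_mul (frobGL K k n),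
      map_mul (frobGL K k n), map_inv (frobGL K k n), frobGL_theta]
  ext x
  constructor
  · rintro ⟨_, ⟨h, rfl⟩, rfl⟩
    exact ⟨frobGL K k n h, (h1 h).symm⟩
  · rintro ⟨h, rfl⟩
    obtain ⟨h, rfl⟩ := frobGL_surjective (K := K) h
    exact ⟨_, ⟨h, rfl⟩, h1 h⟩

theorem congr_form_frobGL_symDiag_iff [IsAlgClosed k] (p : ℕ) [Fact p.Prime] [CharP k p]
    (hp2 : p ≠ 2) (a : Fin (n / 2) → kˣ) :
    Congr (form (frobGL K k n (symDiag a))) (form (symDiag a)) ↔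
      ∀ y : KHat k, {j | hat (a j) = frobHat K k y}.ncard = {j | hat (a j) = y}.ncard := by
  rw [frobGL_symDiag, congr_form_symDiag_iff p hp2]
  have h1 : ∀ y : KHat k, {j | hat (a j ^ Fintype.card K) = frobHat K k y} = {j | hat (a j) = y} := by
    intro y
    ext j
    change hat _ = _ ↔ hat _ = _
    rw [← frobHat_hat, (frobHat K k).injective.eq_iff]
  constructor
  · intro h y
    rw [← h, h1]
  · intro h y
    obtain ⟨y, rfl⟩ := (frobHat K k).surjective y
    rw [h1, h]

/-- An `F`-stable class contains an `F`-fixed element. -/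
theorem exists_frobGL_eq_self_of_congr [IsAlgClosed k] {g : GL (Fin n) k}
    (hg : Congr (form (frobGL K k n g)) (form g)) :
    ∃ g' : GL (Fin n) k, frobGL K k n g' = g' ∧ Congr (form g) (form g') := by
  obtain ⟨h, hh⟩ := congr_form_iff.1 hg
  -- With h carrying F(g) to g, Lang's theorem gives F(x) = xh, and twisting g by x then makes it
  -- F-fixed.
  obtain ⟨x, hx⟩ := exists_frobGL_mul_eq (K := K) h⁻¹
  have hx' : frobGL K k n x = x * h := by rw [← hx, inv_mul_cancel_right, hx]
  refine ⟨x * g * (theta x)⁻¹, ?_, congr_form_iff.2 ⟨x, rfl⟩⟩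
  rw [map_mul, map_mul, map_inv, frobGL_theta, hx']
  conv_rhs => rw [← hh]
  rw [map_mul]
  group

/-- Over k the asymmetry is conjugate to a diagonal matrix, whose finitely many entries lie in one
finite field; a power of the Frobenius fixes them all. This is semisimplicity in the form used over
K. -/
theorem asymmetry_pow_eq_of_map_eq_form [IsAlgClosed k] (p : ℕ) [Fact p.Prime] [CharP K p]
    (κ : Kind) {g : GL (Fin n) k} (hg : IsQuasiSemisimple (incl g * sig κ))
    {A : Matrix (Fin n) (Fin n) K} (hA : A.map (algebraMap K k) = form g) (hAu : IsUnit A.det) :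
    ∃ N ≠ 0, (A⁻¹ * Aᵀ) ^ p ^ N = A⁻¹ * Aᵀ := by
  obtain ⟨x, d, hd⟩ := (isQuasiSemisimple_iff_exists_diagGL κ g).1 hg
  obtain ⟨h, y, hyh, hhy, e⟩ := (congr_form_iff.2 ⟨x, hd⟩).symm
  set S := A⁻¹ * Aᵀ with hS
  have hAS : Aᵀ = A * S := by rw [hS, Matrix.mul_nonsing_inv_cancel_left _ _ hAu]
  have hS' : (form g)ᵀ = form g * S.map (algebraMap K k) := by
    rw [← hA, ← Matrix.map_mul, ← hAS, Matrix.transpose_map]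
  have hconj := asymmetry_eq_of_eq (isUnit_det_form g) (form_diagGL_transpose d) hS' hhy e
  obtain ⟨s, hs, hsd⟩ := exists_pow_card_pow_eq (K := K) fun j => (asym d j : k)
  obtain ⟨r, -, hr⟩ := FiniteField.card K p
  refine ⟨r * s, mul_ne_zero r.ne_zero hs.ne', ?_⟩
  have hpow : ∀ (D : Matrix (Fin n) (Fin n) k) (i : ℕ), (y * D * h) ^ i = y * D ^ i * h := by
    intro D i
    induction i with
    | zero => rw [pow_zero, pow_zero, mul_one, hyh]
    | succ i ih =>
      rw [pow_succ, ih, pow_succ]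
      calc y * D ^ i * h * (y * D * h) = y * D ^ i * (h * y) * D * h := by simp only [mul_assoc]
        _ = _ := by rw [hhy, mul_one]; simp only [mul_assoc]
  have hinj : Function.Injective
      ((algebraMap K k).mapMatrix : Matrix (Fin n) (Fin n) K →+* Matrix (Fin n) (Fin n) k) :=
    Matrix.map_injective (algebraMap K k).injective
  apply hinj
  rw [map_pow, RingHom.mapMatrix_apply, hconj, hpow, Matrix.diagonal_pow, pow_mul, ← hr]
  congr 4
  funext j
  exact hsd j

end Frobenius

/-! ### Rational classes and the determinant modulo squares -/

section RationalClasses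

variable {K : Type*} [Field K] [Fintype K] {k : Type*} [Field k] [Algebra K k] {n : ℕ}

variable (K) in
/-- Conjugacy of `gσ` and `g'σ` under `GL_n(k)^F`. -/
def RatConj (g g' : GL (Fin n) k) : Prop :=
  ∃ h : GL (Fin n) k, frobGL K k n h = h ∧ h * g * (theta h)⁻¹ = g'

variable (K) in
/-- The determinant of `g` is the square of an element of `K`. -/
def IsSquareDet (g : GL (Fin n) k) : Prop :=
  ∃ b : K, algebraMap K k b ^ 2 = (g : Matrix (Fin n) (Fin n) k).det

theorem exists_algebraMap_eq_det {g : GL (Fin n) k} (hg : frobGL K k n g = g) :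
    ∃ u : K, u ≠ 0 ∧ algebraMap K k u = g.val.det := by
  obtain ⟨A, hA⟩ := frobGL_eq_self_iff.1 hg
  have h1 : algebraMap K k A.det = g.val.det := by
    rw [RingHom.map_det, RingHom.mapMatrix_apply, hA]
  refine ⟨A.det, ?_, h1⟩
  rintro h0
  rw [h0, map_zero] at h1
  exact (Matrix.isUnits_det_units g).ne_zero h1.symm

theorem RatConj.exists_det_eq {g g' : GL (Fin n) k} (h : RatConj K g g') :
    ∃ u : K, u ≠ 0 ∧ g'.val.det = algebraMap K k u ^ 2 * g.val.det := by
  obtain ⟨h, hF, rfl⟩ := h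
  obtain ⟨u, hu, hud⟩ := exists_algebraMap_eq_det hF
  refine ⟨u, hu, ?_⟩
  have h1 := congrArg Matrix.det (form_mul_theta_inv h g)
  rw [Matrix.det_mul, Matrix.det_mul, Matrix.det_transpose, det_form, det_form] at h1
  refine mul_right_cancel₀ (det_gram_ne_zero (n := n) (k := k)) ?_
  rw [h1, hud]
  ring

theorem RatConj.refl (g : GL (Fin n) k) : RatConj K g g := ⟨1, map_one _, by simp⟩

theorem RatConj.symm {g g' : GL (Fin n) k} (h : RatConj K g g') : RatConj K g' g := by
  obtain ⟨h, hF, rfl⟩ := h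
  refine ⟨h⁻¹, by rw [map_inv, hF], ?_⟩
  rw [map_inv]
  group

theorem RatConj.trans {g g' g'' : GL (Fin n) k} (h : RatConj K g g') (h' : RatConj K g' g'') :
    RatConj K g g'' := by
  obtain ⟨h, hF, rfl⟩ := h
  obtain ⟨h', hF', rfl⟩ := h'
  refine ⟨h' * h, by rw [map_mul, hF, hF'], ?_⟩
  rw [map_mul]
  group

theorem RatConj.congr {g g' : GL (Fin n) k} (h : RatConj K g g') : Congr (form g) (form g') :=
  congr_form_iff.2 (h.imp fun _ => And.right)

theorem RatConj.isSquareDet {g g' : GL (Fin n) k} (h : RatConj K g g') (hg : IsSquareDet K g) :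
    IsSquareDet K g' := by
  obtain ⟨u, -, hu⟩ := h.exists_det_eq
  obtain ⟨b, hb⟩ := hg
  exact ⟨u * b, by rw [hu, ← hb, map_mul, mul_pow]⟩

/-- The squares have index at most 2 in K*, so two non-squares also differ by a square. -/
theorem exists_det_eq_sq_mul {g g' : GL (Fin n) k} (hg : frobGL K k n g = g)
    (hg' : frobGL K k n g' = g') (h : IsSquareDet K g ↔ IsSquareDet K g') :
    ∃ c : K, c ≠ 0 ∧ g'.val.det = algebraMap K k c ^ 2 * g.val.det := by
  classical
  obtain ⟨u, hu, hud⟩ := exists_algebraMap_eq_det hg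
  obtain ⟨v, hv, hvd⟩ := exists_algebraMap_eq_det hg'
  have hsq : ∀ {g : GL (Fin n) k} {u : K}, algebraMap K k u = g.val.det →
      (IsSquareDet K g ↔ IsSquare u) := by
    intro g u hu
    rw [isSquare_iff_exists_sq]
    refine exists_congr fun b => ?_
    rw [← hu, ← map_pow, (algebraMap K k).injective.eq_iff, eq_comm]
  rw [hsq hud, hsq hvd] at h
  have huv : IsSquare (v / u) := by
    by_cases h1 : IsSquare u
    · exact (h.1 h1).div h1
    · have h2 : ¬ IsSquare v := fun h2 => h1 (h.2 h2)
      rw [← quadraticChar_neg_one_iff_not_isSquare] at h1 h2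
      rw [← quadraticChar_one_iff_isSquare (div_ne_zero hv hu), div_eq_mul_inv, map_mul, h2,
        ← MulChar.inv_apply', quadraticChar_isQuadratic K |>.inv, h1]
      norm_num
  obtain ⟨c, hc⟩ := isSquare_iff_exists_sq _ |>.1 huv
  refine ⟨c, ?_, ?_⟩
  · rintro rfl
    exact div_ne_zero hv hu (by rw [hc]; simp)
  · rw [← hud, ← hvd, ← map_pow, ← hc, ← map_mul, div_mul_cancel₀ _ hu]

theorem mem_rationalClass_iff {κ : Kind} {g g' : GL (Fin n) k} :
    (incl g' * sig κ ∈ {x : Bar n k κ | ∃ h : GL (Fin n) k, frobGL K k n h = h ∧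
      x = incl h * (incl g * sig κ) * (incl h)⁻¹}) ↔ RatConj K g g' := by
  rw [Set.mem_ofPred_eq, RatConj]
  simp only [conj_incl_mul_sig, incl_mul_sig_inj, eq_comm (a := g')]

theorem rationalClass_eq_of_ratConj {κ : Kind} {g g' : GL (Fin n) k} (h : RatConj K g g') :
    {x : Bar n k κ | ∃ h : GL (Fin n) k, frobGL K k n h = h ∧
      x = incl h * (incl g * sig κ) * (incl h)⁻¹} =
    {x : Bar n k κ | ∃ h : GL (Fin n) k, frobGL K k n h = h ∧
      x = incl h * (incl g' * sig κ) * (incl h)⁻¹} := by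
  have key : ∀ {g g' : GL (Fin n) k}, RatConj K g g' → ∀ x : Bar n k κ,
      (∃ h : GL (Fin n) k, frobGL K k n h = h ∧
        x = incl h * (incl g * sig κ) * (incl h)⁻¹) → ∃ h : GL (Fin n) k, frobGL K k n h = h ∧
          x = incl h * (incl g' * sig κ) * (incl h)⁻¹ := by
    rintro g g' hgg' _ ⟨h, hF, rfl⟩
    rw [conj_incl_mul_sig]
    exact mem_rationalClass_iff.2 (hgg'.symm.trans ⟨h, hF, rfl⟩)
  exact Set.ext fun x => ⟨key h x, key h.symm x⟩

variable [Algebra.IsAlgebraic K k] [IsAlgClosed k]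

/-- The determinants of the forms differ from those of g and g' by the common factor det 𝒥, so
squareness of their quotient can be read on g and g'. -/
theorem ratConj_of_congr (hK : ringChar K ≠ 2) (κ : Kind) {g g' : GL (Fin n) k}
    (hg : frobGL K k n g = g) (hg' : frobGL K k n g' = g')
    (hqs : IsQuasiSemisimple (incl g * sig κ)) (h : Congr (form g) (form g'))
    (hdet : (form g - (form g)ᵀ).det = 0 → (IsSquareDet K g ↔ IsSquareDet K g')) :
    RatConj K g g' := by
  obtain ⟨A, hA, hAu⟩ := exists_map_eq_form hg
  obtain ⟨B, hB, hBu⟩ := exists_map_eq_form hg'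
  have hp : Fact (ringChar K).Prime := ⟨CharP.char_is_prime K _⟩
  obtain ⟨N, hN, hS⟩ := asymmetry_pow_eq_of_map_eq_form (ringChar K) κ hqs hA hAu
  refine exists_conj_of_congr hA hB (congr_of_map_congr (algebraMap K k) (ringChar K) hK hN hAu hBu
    (by rwa [hA, hB]) hS fun h0 => ?_)
  have h1 : (form g - (form g)ᵀ).det = 0 := by
    rw [← hA, ← Matrix.transpose_map, ← Matrix.map_sub _ (map_sub (algebraMap K k)),
      ← RingHom.mapMatrix_apply, ← RingHom.map_det, h0, map_zero]
  obtain ⟨c, hc, hcd⟩ := exists_det_eq_sq_mul hg hg' (hdet h1)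
  refine ⟨c, hc, (algebraMap K k).injective ?_⟩
  rw [map_mul, map_pow, RingHom.map_det, RingHom.map_det, RingHom.mapMatrix_apply,
    RingHom.mapMatrix_apply, hA, hB, det_form, det_form, hcd, mul_assoc]

theorem exists_congr_isSquareDet_iff (hK : ringChar K ≠ 2) (κ : Kind) {g : GL (Fin n) k}
    (hg : frobGL K k n g = g) (hqs : IsQuasiSemisimple (incl g * sig κ))
    (h0 : (form g - (form g)ᵀ).det = 0) {ε : K} (hε : ε ≠ 0) :
    ∃ g' : GL (Fin n) k, frobGL K k n g' = g' ∧ Congr (form g) (form g') ∧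
      (IsSquareDet K g' ↔ IsSquare ε) := by
  obtain ⟨A, hA, hAu⟩ := exists_map_eq_form hg
  have hp : Fact (ringChar K).Prime := ⟨CharP.char_is_prime K _⟩
  have hk : CharP k (ringChar K) := charP_of_injective_algebraMap (algebraMap K k).injective _
  obtain ⟨N, hN, hS⟩ := asymmetry_pow_eq_of_map_eq_form (ringChar K) κ hqs hA hAu
  obtain ⟨u, hu, hud⟩ := exists_algebraMap_eq_det hg
  have h1 : (A - Aᵀ).det = 0 := by
    apply (algebraMap K k).injective
    rw [RingHom.map_det, RingHom.mapMatrix_apply, Matrix.map_sub _ (map_sub (algebraMap K k)),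
      Matrix.transpose_map, hA, h0, map_zero]
  -- Scaling by ε det g rather than by ε turns the new determinant of g' into ε times a square,
  -- whatever det g was.
  obtain ⟨B, hBu, hAB, x, hx, hBd⟩ := exists_congr_map_det_eq (algebraMap K k) (ringChar K) hK hN
    hAu hS h1 (mul_ne_zero hε hu)
  obtain ⟨g', hg', hB⟩ := exists_form_eq_map (k := k) hBu
  refine ⟨g', hg', by rwa [hA, ← hB] at hAB, ?_⟩
  have hdet : g'.val.det = algebraMap K k (ε * (u * x) ^ 2) := by
    refine mul_right_cancel₀ (det_gram_ne_zero (n := n) (k := k)) ?_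
    rw [← det_form, hB, ← RingHom.mapMatrix_apply, ← RingHom.map_det, hBd, map_mul (algebraMap K k),
      RingHom.map_det _ A, RingHom.mapMatrix_apply, hA, det_form, ← hud, ← mul_assoc,
      ← map_mul]
    congr 2
    ring
  rw [IsSquareDet, hdet]
  simp only [← map_pow, (algebraMap K k).injective.eq_iff]
  rw [isSquare_iff_exists_sq]
  have hux : u * x ≠ 0 := mul_ne_zero hu hx
  constructor
  · rintro ⟨b, hb⟩
    exact ⟨b / (u * x), by rw [div_pow, hb, mul_div_cancel_right₀ _ (pow_ne_zero 2 hux)]⟩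
  · rintro ⟨b, hb⟩
    exact ⟨b * (u * x), by rw [mul_pow, hb]⟩

end RationalClasses

/-! ### Parametrisation of the F-stable classes -/

section Parametrisation

variable {K : Type*} [Field K] [Fintype K] {k : Type*} [Field k] [Algebra K k]
  [Algebra.IsAlgebraic K k] [IsAlgClosed k] {n : ℕ}

theorem mem_fStableClasses_iff (hK : ringChar K ≠ 2) (κ : Kind) (C : Set (Bar n k κ)) :
    C ∈ FStableClasses K k n κ ↔ ∃ a : Fin (n / 2) → kˣ, C = geomClass κ (symDiag a) ∧
      ∀ y : KHat k, {j | hat (a j) = frobHat K k y}.ncard = {j | hat (a j) = y}.ncard := by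
  have hp : Fact (ringChar K).Prime := ⟨CharP.char_is_prime K _⟩
  have hk : CharP k (ringChar K) := charP_of_injective_algebraMap (algebraMap K k).injective _
  have key : ∀ a : Fin (n / 2) → kˣ,
      frobBar K k n κ '' geomClass κ (symDiag a) = geomClass κ (symDiag a) ↔
        ∀ y : KHat k, {j | hat (a j) = frobHat K k y}.ncard = {j | hat (a j) = y}.ncard :=
    fun a => by
      rw [frobBar_image_geomClass, geomClass_eq_iff,
        congr_form_frobGL_symDiag_iff (ringChar K) hK]
  constructor
  · rintro ⟨⟨g, hg, rfl⟩, hF⟩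
    obtain ⟨a, ha⟩ := (isQuasiSemisimple_iff_exists_congr_symDiag (ringChar K) hK κ g).1 hg
    have h1 : geomClass κ g = geomClass κ (symDiag a) := geomClass_eq_iff.2 ha
    refine ⟨a, h1, (key a).1 ?_⟩
    rw [← h1]
    exact hF
  · rintro ⟨a, rfl, ha⟩
    exact ⟨⟨symDiag a, (isQuasiSemisimple_iff_exists_congr_symDiag (ringChar K) hK κ _).2
      ⟨a, Congr.refl _⟩, rfl⟩, (key a).2 ha⟩

/-- The parametrisation of the `F`-stable quasi-semi-simple classes. -/
theorem exists_equiv_fStableClasses (hK : ringChar K ≠ 2) (κ : Kind) :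
    ∃ ψ : TBar K k n ≃ FStableClasses K k n κ, ∀ t, ∃ a : Fin (n / 2) → kˣ,
      (∀ y, {j | hat (a j) = y}.ncard = eigMult t.1 y) ∧
      (ψ t : Set (Bar n k κ)) = geomClass κ (symDiag a) := by
  have hp : Fact (ringChar K).Prime := ⟨CharP.char_is_prime K _⟩
  have hk : CharP k (ringChar K) := charP_of_injective_algebraMap (algebraMap K k).injective _
  choose a ha using exists_ncard_eq_eigMult (n := n) (k := k) hK
  let ψ : TBar K k n → FStableClasses K k n κ := fun t =>
    ⟨geomClass κ (symDiag (a t)), (mem_fStableClasses_iff hK κ _).2 ⟨a t, rfl, fun y => by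
      rw [ha, ha, eigMult_frobHat hK]⟩⟩
  have hψ : Function.Bijective ψ := by
    constructor
    · intro t t' h
      have h1 := geomClass_eq_iff.1 (congrArg Subtype.val h)
      rw [congr_form_symDiag_iff (ringChar K) hK] at h1
      exact eigMult_injective hK fun y => by rw [← ha, ← ha, h1]
    · rintro ⟨C, hC⟩
      obtain ⟨b, rfl, hb⟩ := (mem_fStableClasses_iff hK κ C).1 hC
      obtain ⟨t, ht⟩ := exists_eigMult_eq hK b hb
      refine ⟨t, Subtype.ext (geomClass_eq_iff.2 ?_)⟩
      rw [congr_form_symDiag_iff (ringChar K) hK]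
      exact fun y => by rw [ha, ht]
  exact ⟨Equiv.ofBijective ψ hψ, fun t => ⟨a t, ha t, rfl⟩⟩

end Parametrisation

end TwistedGL

/-! ### The two bijections -/

theorem proposition6p1p3
    (K : Type*) [Field K] [Fintype K] (hK : ringChar K ≠ 2)
    (k : Type*) [Field k] [Algebra K k] [Algebra.IsAlgebraic K k] [IsAlgClosed k]
    (n : ℕ) (κ : Kind) :
    ∃ (ψ : TBar K k n ≃ FStableClasses K k n κ)
      (Ψ : RationalClasses K k n κ ≃ SignedTBar K k n),
      -- `ψ` sends `t` to the class of `[a₁, …, a_m]σ`, the multiset of the `â_j` being read on `t`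
      (∀ t : TBar K k n, ∃ a : Fin (n / 2) → kˣ,
        incl (symDiag a) * sig κ ∈ (ψ t : Set (Bar n k κ))) ∧
      (∀ (t : TBar K k n) (a : Fin (n / 2) → kˣ),
        incl (symDiag a) * sig κ ∈ (ψ t : Set (Bar n k κ)) ↔
          ∀ y : KHat k, {j | hat (a j) = y}.ncard = eigMult t.1 y) ∧
      -- the second component of `Ψ D` is the geometric class that contains `D`
      (∀ D : RationalClasses K k n κ,
        (D : Set (Bar n k κ)) ⊆ (ψ (Ψ D).1.2 : Set (Bar n k κ))) ∧
      -- where both signs occur, the sign of the class of `gσ` is the quadratic character of `det g`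
      (∀ D : RationalClasses K k n κ, OrthNontrivial (Ψ D).1.2 →
        ∀ g : GL (Fin n) k, frobGL K k n g = g → incl g * sig κ ∈ (D : Set (Bar n k κ)) →
          ((Ψ D).1.1 = 1 ↔
            ∃ b : K, algebraMap K k b ^ 2 = (g : Matrix (Fin n) (Fin n) k).det)) := by

  classical
  obtain ⟨ψ, hψ⟩ := exists_equiv_fStableClasses (n := n) (k := k) hK κ
  have hp : Fact (ringChar K).Prime := ⟨CharP.char_is_prime K _⟩
  have hk : CharP k (ringChar K) := charP_of_injective_algebraMap (algebraMap K k).injective _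
  choose a ha hψa using hψ
  have hmem : ∀ (g : GL (Fin n) k) (t : TBar K k n),
      incl g * sig κ ∈ (ψ t : Set (Bar n k κ)) ↔ Congr (form (symDiag (a t))) (form g) := by
    intro g t
    rw [hψa, incl_mul_sig_mem_geomClass]
  have horth : ∀ (g : GL (Fin n) k) (t : TBar K k n), incl g * sig κ ∈ (ψ t : Set (Bar n k κ)) →
      (OrthNontrivial t ↔ (form g - (form g)ᵀ).det = 0) := by
    intro g t h
    rw [hmem] at h
    rw [orthNontrivial_iff hK t (a t) (ha t)]
    exact ⟨h.det_sub_transpose_eq_zero, h.symm.det_sub_transpose_eq_zero⟩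
  have hqs : ∀ (g : GL (Fin n) k) (t : TBar K k n), incl g * sig κ ∈ (ψ t : Set (Bar n k κ)) →
      IsQuasiSemisimple (incl g * sig κ) := fun g t h =>
    (isQuasiSemisimple_iff_exists_congr_symDiag (ringChar K) hK κ g).2 ⟨a t, ((hmem g t).1 h).symm⟩
  have hex : ∀ g : GL (Fin n) k, frobGL K k n g = g → IsQuasiSemisimple (incl g * sig κ) →
      ∃ t, incl g * sig κ ∈ (ψ t : Set (Bar n k κ)) := by
    intro g hg hq
    let C : FStableClasses K k n κ := ⟨geomClass κ g, ⟨g, hq, rfl⟩, by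
      rw [frobBar_image_geomClass, hg]⟩
    refine ⟨ψ.symm C, ?_⟩
    rw [Equiv.apply_symm_apply]
    exact incl_mul_sig_mem_geomClass.2 (Congr.refl _)
  have huniq : ∀ (g g' : GL (Fin n) k) (t t' : TBar K k n),
      incl g * sig κ ∈ (ψ t : Set (Bar n k κ)) → incl g' * sig κ ∈ (ψ t' : Set (Bar n k κ)) →
      Congr (form g) (form g') → t = t' := by
    intro g g' t t' h h' hgg'
    rw [hmem] at h h'
    apply ψ.injective
    refine Subtype.ext ?_
    rw [hψa, hψa, geomClass_eq_iff]
    exact h.trans (hgg'.trans h'.symm)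
  choose r hrF hrq hrD using fun D : RationalClasses K k n κ => D.2
  choose τ hτ using fun D : RationalClasses K k n κ => hex (r D) (hrF D) (hrq D)
  have hmemD : ∀ (D : RationalClasses K k n κ) (g : GL (Fin n) k),
      incl g * sig κ ∈ (D : Set (Bar n k κ)) ↔ RatConj K (r D) g := by
    intro D g
    rw [hrD D]
    exact mem_rationalClass_iff
  -- The sign defaults to 1 when the orthogonal factor is trivial, so the constraint on pairs holds
  -- by construction.
  let Θ : RationalClasses K k n κ → SignedTBar K k n := fun D =>
    ⟨(if OrthNontrivial (τ D) ∧ ¬ IsSquareDet K (r D) then -1 else 1, τ D), fun h => by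
      by_contra h'
      rw [if_neg fun hh => h' hh.1] at h
      exact absurd (show (1 : ℤˣ) = -1 from h) (by decide)⟩
  have hsign : ∀ D, OrthNontrivial (τ D) → ((Θ D).1.1 = 1 ↔ IsSquareDet K (r D)) := by
    intro D hD
    by_cases hs : IsSquareDet K (r D)
    · exact iff_of_true (if_neg fun hh => hh.2 hs) hs
    · refine iff_of_false (fun h => ?_) hs
      have : (Θ D).1.1 = -1 := if_pos ⟨hD, hs⟩
      rw [this] at h
      exact absurd h (by decide)
  have hunit : ∀ u v : ℤˣ, (u = 1 ↔ v = 1) → u = v := by decide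
  have hΘ : Function.Bijective Θ := by
    constructor
    · intro D D' h
      have hτ' : τ D = τ D' := congrArg (fun p : SignedTBar K k n => p.1.2) h
      have hs : (Θ D).1.1 = (Θ D').1.1 := congrArg (fun p : SignedTBar K k n => p.1.1) h
      have hc : Congr (form (r D)) (form (r D')) :=
        ((hmem _ _).1 (hτ D)).symm.trans (hτ' ▸ (hmem _ _).1 (hτ D'))
      -- The same datum makes the forms congruent over k, and the same sign settles the only
      -- rational obstruction.
      have hconj := ratConj_of_congr hK κ (hrF D) (hrF D') (hrq D) hc fun h0 => by
        have ho := (horth _ _ (hτ D)).2 h0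
        rw [← hsign D ho, ← hsign D' (hτ' ▸ ho), hs]
      refine Subtype.ext ?_
      rw [hrD D, hrD D']
      exact rationalClass_eq_of_ratConj hconj
    · rintro ⟨⟨η, t⟩, hη⟩
      -- For surjectivity, Lang's theorem supplies a rational point of the class, whose determinant
      -- is then adjusted modulo squares when the orthogonal factor allows it.
      have hstab := (ψ t).2.2
      rw [hψa, frobBar_image_geomClass, geomClass_eq_iff] at hstab
      obtain ⟨g₁, hg₁, hc₁⟩ := exists_frobGL_eq_self_of_congr hstab
      have hm₁ := (hmem g₁ t).2 hc₁
      obtain ⟨g, hg, hm, hs⟩ : ∃ g : GL (Fin n) k, frobGL K k n g = g ∧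
          incl g * sig κ ∈ (ψ t : Set (Bar n k κ)) ∧
          (OrthNontrivial t → (IsSquareDet K g ↔ η = 1)) := by
        by_cases ho : OrthNontrivial t
        · obtain ⟨ε, hε, hεη⟩ : ∃ ε : K, ε ≠ 0 ∧ (IsSquare ε ↔ η = 1) := by
            rcases Int.units_eq_one_or η with rfl | rfl
            · exact ⟨1, one_ne_zero, iff_of_true IsSquare.one rfl⟩
            · obtain ⟨ε, hε⟩ := FiniteField.exists_nonsquare hK
              refine ⟨ε, ?_, iff_of_false hε (by decide)⟩
              rintro rfl
              exact hε IsSquare.zero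
          obtain ⟨g, hg, hc, hs⟩ := exists_congr_isSquareDet_iff hK κ hg₁ (hqs _ _ hm₁)
            ((horth _ _ hm₁).1 ho) hε
          exact ⟨g, hg, (hmem _ _).2 (hc₁.trans hc), fun _ => hs.trans hεη⟩
        · exact ⟨g₁, hg₁, hm₁, fun h => absurd h ho⟩
      let D : RationalClasses K k n κ := ⟨_, g, hg, hqs _ _ hm, rfl⟩
      -- The representative chosen for D need not be g, but it is rationally conjugate to g, and
      -- this preserves both the datum and the sign.
      have hrg : RatConj K (r D) g := (hmemD D g).1 (mem_rationalClass_iff.2 (RatConj.refl g))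
      have hτt : τ D = t := huniq _ _ _ _ (hτ D) hm hrg.congr
      refine ⟨D, Subtype.ext (Prod.ext ?_ hτt)⟩
      by_cases ho : OrthNontrivial t
      · refine hunit _ _ ?_
        rw [hsign D (hτt.symm ▸ ho), ← hs ho]
        exact ⟨hrg.isSquareDet, hrg.symm.isSquareDet⟩
      · have h1 : (Θ D).1.1 = 1 := if_neg fun hh => ho (hτt ▸ hh.1)
        rw [h1]
        rcases Int.units_eq_one_or η with h | h
        · exact h.symm
        · exact absurd (hη h) ho
  refine ⟨ψ, Equiv.ofBijective Θ hΘ, fun t => ⟨a t, (hmem _ _).2 (Congr.refl _)⟩, ?_, ?_, ?_⟩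
  · intro t b
    rw [hmem, congr_form_symDiag_iff (ringChar K) hK]
    exact forall_congr' fun y => by rw [ha, eq_comm]
  · intro D x hx
    rw [hrD D] at hx
    obtain ⟨h, hF, rfl⟩ := hx
    rw [conj_incl_mul_sig]
    exact (hmem _ _).2 (((hmem _ _).1 (hτ D)).trans (congr_form_iff.2 ⟨h, rfl⟩))
  · intro D ho g hg hgD
    have hrg := (hmemD D g).1 hgD
    exact (hsign D ho).trans ⟨hrg.isSquareDet, hrg.symm.isSquareDet⟩
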